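/- **Conventions.** A difference field is a field $K$ with a ring endomorphism $\sigma$ (not necessarily onto); write $a^\sigma=\sigma(a)$, $K^\sigma=\sigma(K)$, and let $p$ be the characteristic exponent. Embeddings and extensions of difference fields are compatible with $\sigma$. $K$ is inversive if $\sigma$ is onto; the inversive hull $K^{\sigma^{-\infty}}$ is the inversive extension of $K$ that embeds uniquely over $K$ in every inversive extension of $K$. $K$ is closed under twists if for every $n$ there is a field endomorphism $\tau$ of $K$ with $\tau(x^{p^n})=\sigma(x)$ for all $x$. $K$ is a model of $\mathrm{FE}$ if it is closed under twists and every element of $K$ that is separably algebraic over $K^\sigma$ lies in $K^\sigma$. Let $L/K$ be an extension of difference fields. It is transformally separable if $K$ and $L^\sigma$ are linearly disjoint over $K^\sigma$; an element $a\in L$ is transformally algebraic over $K$ if $f(a,a^\sigma,a^{\sigma^2},\dots)=0$ for some nonzero polynomial $f$ over $K$, and $L/K$ is transformally algebraic if all elements of $L$ are; it is transformally separably algebraic if it is both transformally separable and transformally algebraic. A family $x$ in $L$ is transformally independent if the elements $x_i^{\sigma^n}$ are algebraically independent over $K$, and a transformal transcendence basis if it is maximal such. A twisted difference polynomial over $K$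 is a finite formal $K$-linear combination of monomials $x^\nu$ with $\nu=\lambda_0+\sum_{k\ge1}\lambda_k\sigma^k$ (a finite sum), $\lambda_0\in\mathbf N$ and $\lambda_k\in\mathbf N[1/p]$ for $k\geq 1$; its derivative is given by $(x^\nu)'=\lambda_0x^{\nu-1}$. An element $a$ is a simple root of $f$ if $f(a)=0$ and $f'(a)\ne0$. For a tuple $x$ in a model $E$ of $\mathrm{FE}$ extending $F$, $F(x^{\mathbf N[\sigma/p^\infty]})$ is the subfield of $E$ generated over $F$ by the $x_i$ and all $x_i^{\sigma^n/p^m}$ ($n\geq1$, $m\ge0$). For an extension $E/F$ of models of $\mathrm{FE}$, $E$ is finitely generated over $F$ as a model of $\mathrm{FE}$ if there is a finite subset of $E$ contained in no proper intermediate difference field of $E/F$ that is a model of $\mathrm{FE}$. **Theorem.** 1. Let $E/F$ be an extension of models of $\mathrm{FE}$. There is a unique intermediate difference field $F\subseteq\widetilde F\subseteq E$ that is a model of $\mathrm{FE}$, is transformally separably algebraic over $F$, and is such that for every model $L$ of $\mathrm{FE}$ transformally separably algebraic over $F$, every embedding of $L$ in $E$ over $F$ lands inside $\widetilde F$. It is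 called the relative transformal separable algebraic closure of $F$ in $E$. 2. Let $E/F$ be an extension of models of $\mathrm{FE}$. The set of elements of $E$ that are simple roots of twisted difference polynomials over $F$ is an intermediate difference field and a model of $\mathrm{FE}$, and it is the relative transformal separable algebraic closure of $F$ in $E$. 3. In the situation of (1), $E$ is transformally separable over $\widetilde F$ if and only if it is transformally separable over $F$. 4. Let $F$ be a model of $\mathrm{FE}$. The inversive hull $F^{\sigma^{-\infty}}$ exists, and there is an equivalence from the category of models of $\mathrm{FE}$ transformally separably algebraic over $F$ (with embeddings over $F$) to the category of perfect, inversive difference fields transformally algebraic over $F^{\sigma^{-\infty}}$ (with embeddings over $F^{\sigma^{-\infty}}$). It is canonical: it sends each $E$ to an inversive hull of $E$, through an embedding of $E$ that is natural in $E$ and compatible with $F\to F^{\sigma^{-\infty}}$. 5. Let $E/F$ be a transformally separable extension of models of $\mathrm{FE}$ with $E$ finitely generated over $F$ as a model of $\mathrm{FE}$. Then there is a finite transformal transcendence basis $x$ of $E$ over $F$ such that $E$ is transformally separably algebraic over $F(x^{\mathbf N[\sigma/p^\infty]})$. 6. Let $A$ be a model of $\mathrm{FE}$ that is separably closed as a field,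 and let $A_1,A_2$ be models of $\mathrm{FE}$ transformally separable over $A$. Then $A_1$ and $A_2$ are linearly disjoint over $A$: there is a difference field extension of $A$, equipped with embeddings of $A_1$ and $A_2$ over $A$, that is generated as a difference field by their images and in which these images are linearly disjoint over $A$. Every such difference field, that is, the tensor product $A_1\otimes_AA_2$ (the fraction field of the ring-theoretic tensor product), is a model of $\mathrm{FE}$. -/

import Mathlib

open CategoryTheory

universe u

noncomputable section

namespace FE

/-! ### Difference fields -/

/-- A difference field: a field with a distinguished ring endomorphism (injective, since `K` is a
field, but not assumed to be onto). -/
class DifferenceField (K : Type*) [Field K] where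
  /-- the distinguished endomorphism -/
  sigma : K →+* K

/-- The distinguished endomorphism of a difference field. -/
abbrev σ {K : Type*} [Field K] [DifferenceField K] : K →+* K := DifferenceField.sigma

/-- A homomorphism of fields compatible with the distinguished endomorphisms. -/
def IsDifferenceHom {K L : Type*} [Field K] [DifferenceField K] [Field L] [DifferenceField L]
    (f : K →+* L) : Prop := ∀ x, f (σ x) = σ (f x)

/-- `L` is a difference field extension of `K`. -/
class IsDifferenceExtension (K L : Type*) [Field K] [DifferenceField K] [Field L]
    [DifferenceField L] [Algebra K L] : Prop where
  isDifferenceHom : IsDifferenceHom (algebraMap K L)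

/-- A difference field is inversive if `σ` is onto. -/
def IsInversive (K : Type*) [Field K] [DifferenceField K] : Prop :=
  Function.Surjective (σ : K →+* K)

/-- `i : K → K'` is an inversive hull of `K`: the difference field `K'` is inversive, and it embeds
uniquely over `K` in every inversive difference field extension of `K`. -/
structure IsInversiveHull {K K' : Type u} [Field K] [DifferenceField K] [Field K']
    [DifferenceField K'] (i : K →+* K') : Prop where
  isDifferenceHom : IsDifferenceHom i
  isInversive : IsInversive K'
  existsUnique : ∀ (L : Type u) [Field L] [DifferenceField L] (j : K →+* L),
    IsDifferenceHom j → IsInversive L → ∃! k : K' →+* L, IsDifferenceHom k ∧ k.comp i = j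

/-- An intermediate difference field of an extension `E / F`. -/
structure IntermediateDifferenceField (F E : Type*) [Field F] [Field E] [DifferenceField E]
    [Algebra F E] extends IntermediateField F E where
  sigma_mem : ∀ x ∈ toIntermediateField, σ x ∈ toIntermediateField

instance {F E : Type*} [Field F] [Field E] [DifferenceField E] [Algebra F E]
    (M : IntermediateDifferenceField F E) : DifferenceField M.toIntermediateField where
  sigma := ((σ : E →+* E).comp (algebraMap M.toIntermediateField E)).codRestrict
    M.toIntermediateField (fun x => M.sigma_mem x x.2)

instance {F E : Type*} [Field F] [DifferenceField F] [Field E] [DifferenceField E] [Algebra F E]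
    [IsDifferenceExtension F E] (M : IntermediateDifferenceField F E) :
    IsDifferenceExtension F M.toIntermediateField where
  isDifferenceHom x := Subtype.ext (IsDifferenceExtension.isDifferenceHom (K := F) (L := E) x)

instance {F E : Type*} [Field F] [Field E] [DifferenceField E] [Algebra F E]
    (M : IntermediateDifferenceField F E) :
    IsDifferenceExtension M.toIntermediateField E where
  isDifferenceHom _ := rfl

/-! ### Linear disjointness, transformally separable and transformally algebraic extensions -/

/-- For subfields `A ≤ B`, `A ≤ C` of `Ω`: the fields `B` and `C` are linearly disjoint over `A`
in `Ω`, that is, every finite sequence in `B` that is linearly independent over `A` remains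
linearly independent over `C`. -/
def LinearlyDisjoint {Ω : Type*} [Field Ω] (A B C : Subfield Ω) : Prop :=
  ∀ (n : ℕ) (a : Fin n → Ω), (∀ k, a k ∈ B) → LinearIndependent A a → LinearIndependent C a

section Extensions

variable (K L : Type*) [Field K] [DifferenceField K] [Field L] [DifferenceField L] [Algebra K L]

/-- `L` is transformally separable over `K`: the fields `K` and `L^σ` are linearly disjoint
over `K^σ` (in `L`). -/
def IsTransformallySeparable : Prop :=
  LinearlyDisjoint ((algebraMap K L).comp (σ : K →+* K)).fieldRange (algebraMap K L).fieldRange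
    (σ : L →+* L).fieldRange

variable {L} in
/-- `a` is transformally algebraic over `K`: it is a zero of a nonzero difference polynomial
over `K`, that is, of a polynomial in `x, x^σ, x^(σ^2), …` with coefficients in `K`. -/
def IsTransformallyAlgebraicElement (a : L) : Prop :=
  ∃ f : MvPolynomial ℕ K, f ≠ 0 ∧ MvPolynomial.aeval (fun n : ℕ => σ^[n] a) f = 0

/-- `L` is transformally algebraic over `K`. -/
def IsTransformallyAlgebraic : Prop := ∀ a : L, IsTransformallyAlgebraicElement K a

/-- `L` is transformally separably algebraic over `K`. -/
def IsTransformallySeparablyAlgebraic : Prop :=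
  IsTransformallySeparable K L ∧ IsTransformallyAlgebraic K L

variable {L}

/-- The family `x` is transformally independent over `K`: no nonzero difference polynomial over
`K` vanishes at `x`. -/
def IsTransformallyIndependent {ι : Type*} (x : ι → L) : Prop :=
  AlgebraicIndependent K (fun k : ι × ℕ => σ^[k.2] (x k.1))

/-- The family `x` is a transformal transcendence basis of `L` over `K`: a maximal transformally
independent family. -/
def IsTransformalTranscendenceBasis {ι : Type*} (x : ι → L) : Prop :=
  IsTransformallyIndependent K x ∧
    ∀ a : L, ¬ IsTransformallyIndependent K (fun o : Option ι => o.elim a x)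

end Extensions

/-! ### Difference fields closed under twists and the theory FE -/

/-- `K` is closed under twists: every power of the Frobenius `x ↦ x ^ p` factors through `σ`,
where `p` is the characteristic exponent. -/
def IsClosedUnderTwists (K : Type*) [Field K] [DifferenceField K] : Prop :=
  ∀ n : ℕ, ∃ τ : K →+* K, ∀ x, τ (x ^ ringExpChar K ^ n) = σ x

/-- `K` is a model of the theory FE: it is closed under twists, and `K` is a primary extension of
`K^σ`, that is, `K^σ` is relatively separably algebraically closed in `K`. -/
structure IsModel (K : Type*) [Field K] [DifferenceField K] : Prop where
  isClosedUnderTwists : IsClosedUnderTwists K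
  primary : ∀ x : K, IsSeparable (σ : K →+* K).fieldRange x → x ∈ (σ : K →+* K).fieldRange

/-! ### Twisted difference polynomials -/

/-- The additive monoid of the rational numbers `k / p ^ m` with `k` and `m` natural numbers. -/
def natInvPow (p : ℕ) : AddSubmonoid ℚ where
  carrier := {r | ∃ m k : ℕ, r * (p : ℚ) ^ m = k}
  zero_mem' := ⟨0, 0, by simp⟩
  add_mem' := by
    rintro r s ⟨m, k, h⟩ ⟨m', k', h'⟩
    refine ⟨m + m', k * p ^ m' + k' * p ^ m, ?_⟩
    push_cast
    rw [← h, ← h']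
    ring

/-- The exponents of twisted difference monomials: the pair `(l, μ)` stands for the formal sum
`l + ∑ k, μ k * σ ^ (k + 1)`, where `l` is a natural number and each `μ k` is of the form
(natural number) / (power of `p`). -/
abbrev TwistedExponent (p : ℕ) : Type := ℕ × (ℕ →₀ natInvPow p)

/-- The ring of twisted difference polynomials in one variable over `K`: formal finite `K`-linear
combinations of twisted difference monomials `x ^ ν`, with `x ^ ν * x ^ μ = x ^ (ν + μ)`. -/
abbrev TwistedPolynomial (K : Type*) [Field K] : Type _ :=
  AddMonoidAlgebra K (TwistedExponent (ringExpChar K))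

/-- `fracPow p y r` is `y ^ r` for `r = k / p ^ m`: the unique element `z` with
`z ^ (p ^ m) = y ^ k` whenever `r = k / p ^ m`. It exists if `y` has `p ^ m`-th roots for all `m`;
in a field closed under twists, this is the case for `y = σ ^ n a` with `0 < n`. -/
def fracPow {E : Type*} [Field E] (p : ℕ) (y : E) (r : natInvPow p) : E :=
  Classical.epsilon fun z : E =>
    ∀ m k : ℕ, (r : ℚ) * (p : ℚ) ^ m = k → z ^ p ^ m = y ^ k

/-- The value `a ^ ν` at `a` of the twisted difference monomial with exponent `ν`. -/
def monomialValue {E : Type*} [Field E] [DifferenceField E] {p : ℕ} (a : E)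
    (ν : TwistedExponent p) : E :=
  a ^ ν.1 * ν.2.prod fun k r => fracPow p (σ^[k + 1] a) r

namespace TwistedPolynomial

variable {K : Type*} [Field K]

/-- The value at `a` of a twisted difference polynomial. -/
def value {E : Type*} [Field E] [DifferenceField E] [Algebra K E] (f : TwistedPolynomial K)
    (a : E) : E :=
  f.coeff.sum fun ν c => algebraMap K E c * monomialValue a ν

/-- The transformal derivative: the `K`-derivation with `x' = 1` which vanishes on the monomials
`x ^ ν` with `ν` of constant term zero. So `(x ^ (l + μ))' = l * x ^ ((l - 1) + μ)` for `l` a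
natural number and `μ` of constant term zero. -/
def derivative (f : TwistedPolynomial K) : TwistedPolynomial K :=
  f.coeff.sum fun ν c => AddMonoidAlgebra.single (ν.1 - 1, ν.2) (c * (ν.1 : K))

end TwistedPolynomial

/-- `a` is a simple root of the twisted difference polynomial `f`. -/
def IsSimpleRoot {K E : Type*} [Field K] [Field E] [DifferenceField E] [Algebra K E]
    (f : TwistedPolynomial K) (a : E) : Prop :=
  f.value a = 0 ∧ f.derivative.value a ≠ 0

/-! ### The relative transformal separable algebraic closure -/

/-- `M` is the relative transformal separable algebraic closure of `F` in `E`: it is a model of FE,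
transformally separably algebraic over `F`, and every embedding over `F` in `E` of a model of FE
transformally separably algebraic over `F` lands inside `M`. -/
structure IsRelativeClosure {F E : Type u} [Field F] [DifferenceField F] [Field E]
    [DifferenceField E] [Algebra F E] (M : IntermediateDifferenceField F E) : Prop where
  isModel : IsModel M.toIntermediateField
  separablyAlgebraic : IsTransformallySeparablyAlgebraic F M.toIntermediateField
  lands : ∀ (L : Type u) [Field L] [DifferenceField L] [Algebra F L] [IsDifferenceExtension F L],
    IsModel L → IsTransformallySeparablyAlgebraic F L →
      ∀ j : L →ₐ[F] E, IsDifferenceHom (j : L →+* E) → ∀ x, j x ∈ M.toIntermediateField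

/-! ### Categories of difference field extensions -/

/-- A difference field extension of `F`. -/
structure DifferenceExtension (F : Type u) [Field F] [DifferenceField F] where
  carrier : Type u
  [field : Field carrier]
  [differenceField : DifferenceField carrier]
  [algebra : Algebra F carrier]
  [isDifferenceExtension : IsDifferenceExtension F carrier]

attribute [instance] DifferenceExtension.field DifferenceExtension.differenceField
  DifferenceExtension.algebra DifferenceExtension.isDifferenceExtension

/-- The category of difference field extensions of `F`: the morphisms are the embeddings of
difference fields over `F`. -/
instance (F : Type u) [Field F] [DifferenceField F] : Category.{u} (DifferenceExtension F) where
  Hom X Y := {f : X.carrier →ₐ[F] Y.carrier // IsDifferenceHom (f : X.carrier →+* Y.carrier)}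
  id X := ⟨AlgHom.id F X.carrier, fun _ => rfl⟩
  comp f g := ⟨g.1.comp f.1, fun x =>
    (congrArg g.1 (f.2 x)).trans (g.2 (f.1 x))⟩

/-- The extensions of `F` that are models of FE transformally separably algebraic over `F`. -/
def separablyAlgebraicModels (F : Type u) [Field F] [DifferenceField F] :
    ObjectProperty (DifferenceExtension F) := fun X =>
  IsModel X.carrier ∧ IsTransformallySeparablyAlgebraic F X.carrier

/-- The extensions of `F` that are perfect, inversive and transformally algebraic over `F`. -/
def perfectInversiveAlgebraic (F : Type u) [Field F] [DifferenceField F] :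
    ObjectProperty (DifferenceExtension F) := fun X =>
  PerfectField X.carrier ∧ IsInversive X.carrier ∧ IsTransformallyAlgebraic F X.carrier

/-! ### Finite generation and twisted generation -/

/-- `E` is finitely generated over `F` as a model of FE: for some finite set `S`, the only
intermediate difference field of `E / F` that is a model of FE and contains `S` is `E`. -/
def IsFinitelyGeneratedModel (F E : Type*) [Field F] [Field E] [DifferenceField E]
    [Algebra F E] : Prop :=
  ∃ S : Finset E, ∀ M : IntermediateDifferenceField F E, IsModel M.toIntermediateField →
    (S : Set E) ⊆ (M.toIntermediateField : Set E) → M.toIntermediateField = ⊤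

/-- The twisted difference field generated by the subset `S` of `E` over `F`: it is generated as a
field over `F` by the elements of `S` and by the elements `s ^ (σ ^ n / p ^ m)` with `s ∈ S` and
`0 < n`. -/
def twistedAdjoin (F : Type*) {E : Type*} [Field F] [DifferenceField F] [Field E]
    [DifferenceField E] [Algebra F E] [IsDifferenceExtension F E] (S : Set E) :
    IntermediateDifferenceField F E where
  toIntermediateField := IntermediateField.adjoin F
    {y | ∃ s ∈ S, ∃ n m : ℕ, (n = 0 → m = 0) ∧ y ^ ringExpChar E ^ m = σ^[n] s}
  sigma_mem x hx := by
    induction hx using IntermediateField.adjoin_induction with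
    | mem y hy =>
      obtain ⟨s, hs, n, m, -, h⟩ := hy
      refine IntermediateField.subset_adjoin F _ ⟨s, hs, n + 1, m, by simp, ?_⟩
      rw [← map_pow, h, Function.iterate_succ_apply']
    | algebraMap c =>
      rw [← IsDifferenceExtension.isDifferenceHom (K := F) (L := E) c]
      exact IntermediateField.algebraMap_mem _ _
    | add x y _ _ hx hy => rw [map_add]; exact add_mem hx hy
    | inv x _ hx => rw [map_inv₀]; exact inv_mem hx
    | mul x y _ _ hx hy => rw [map_mul]; exact mul_mem hx hy

/-! ### Tensor products of difference fields -/

/-- `B`, with the embeddings `i₁` and `i₂` over `A`, is a linearly free compositum of the difference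
field extensions `A₁` and `A₂` of `A`: it is generated as a difference field by the images of `A₁`
and `A₂`, and these are linearly disjoint over `A` in `B`. Up to a unique isomorphism this is the
(field theoretic) tensor product of `A₁` and `A₂` over `A`. -/
structure IsLinearlyFreeCompositum {A A₁ A₂ B : Type*} [Field A] [Field A₁] [DifferenceField A₁]
    [Field A₂] [DifferenceField A₂] [Field B] [DifferenceField B] [Algebra A A₁] [Algebra A A₂]
    [Algebra A B] (i₁ : A₁ →ₐ[A] B) (i₂ : A₂ →ₐ[A] B) : Prop where
  isDifferenceHom_left : IsDifferenceHom (i₁ : A₁ →+* B)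
  isDifferenceHom_right : IsDifferenceHom (i₂ : A₂ →+* B)
  generates : ∀ S : Subfield B, (∀ x ∈ S, σ x ∈ S) → (∀ x, i₁ x ∈ S) → (∀ x, i₂ x ∈ S) → S = ⊤
  linearlyDisjoint : LinearlyDisjoint (algebraMap A B).fieldRange (i₁ : A₁ →+* B).fieldRange
    (i₂ : A₂ →+* B).fieldRange

end FE

end

/-! All extensions are embedded in one difference field Ω and treated as subfields of it. For a
subfield D, `tw D` consists of all p^n-th roots in Ω of elements of σ(D). If D is closed under
twists, `tw D` is a perfect subfield of D. If D is a model of FE, `tw D` is moreover relatively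
algebraically closed in D. Tensoring D over `tw D` with any field then gives a domain
(`isDomain_tensorProduct`), and linear disjointness over `tw D` passes to algebraic extensions
(`LinearlyDisjoint.of_algClosure`).

The main tool turns transformal separability into ordinary separability. For fields F ≤ D with F
closed under twists, it amounts to Mac Lane's condition for D/F together with disjointness of F and
`tw D` over `tw F` (`transSep_of_frob_of_tw` and `TransSep.linearlyDisjoint_frob`,
`TransSep.linearlyDisjoint_tw`). If F is a model and D is closed under twists and of finite
transcendence degree over F, comparing a transcendence basis u with σ(u) shows that D/F is
transformally separable exactly when D is separably algebraic over `F ⊔ tw D`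
(`TransSep.le_sepClosure`, `ModelSubfield.transSep_of_le_sepClosure`).

When D is generated over F by a finite set S and its twists, `F ⊔ tw D` is generated by the twists
alone, so the condition says that S is separable over its own twists. For one element this means,
after clearing denominators, being a simple root of a twisted difference polynomial. Hence finitely
many simple roots generate a transformally separable extension made of simple roots, which gives (1)
and (2). For (3), the closure M is separable over `F ⊔ tw M`, and both conditions of the criterion
can be lifted from F to M.

For (4), the hull is the colimit of K → K → ⋯ along σ. In a perfect inversive field Z which is
transformally algebraic over the hull of F, a power of σ brings each element into the relative
closure of F, so Z is the hull of that closure. Two models over F with the same hull coincide inside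
it, because `σ x ∈ Y` forces `x ∈ Y` in a transformally separable extension of Y.

For (5), a separating transcendence basis of the finitely generated field K(S), over `K = F ⊔ tw E`,
is the required transformal basis.

For (6), σ embeds A₁ ⊗ A₂ over A into the tensor product over the perfect field `tw A`, which is
algebraically closed in A₂; that product is a domain. That the compositum is a model is proved by
specialization (`mem_sup_of_mem_algClosure`): an element separable over its image under σ lies in
the compositum of `tw A₁` and `tw A₂`, hence is also purely inseparable over that image. -/

noncomputable section

namespace FE

/-! ### Relative closures of subfields -/

section Closures

variable {Ω : Type*} [Field Ω]

/-- The relative algebraic closure of a subfield. -/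
def algClosure (K : Subfield Ω) : Subfield Ω := (algebraicClosure K Ω).toSubfield

/-- The relative separable algebraic closure of a subfield. -/
def sepClosure (K : Subfield Ω) : Subfield Ω := (separableClosure K Ω).toSubfield

/-- The relative perfect closure of a subfield. -/
def insepClosure (K : Subfield Ω) : Subfield Ω := (perfectClosure K Ω).toSubfield

theorem mem_algClosure {K : Subfield Ω} {x : Ω} : x ∈ algClosure K ↔ IsAlgebraic K x :=
  mem_algebraicClosure_iff

theorem mem_sepClosure {K : Subfield Ω} {x : Ω} : x ∈ sepClosure K ↔ IsSeparable K x :=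
  mem_separableClosure_iff

theorem expChar_subfield (q : ℕ) [ExpChar Ω q] (K : Subfield Ω) : ExpChar K q :=
  RingHom.expChar K.subtype K.subtype.injective q

theorem mem_insepClosure (q : ℕ) [ExpChar Ω q] {K : Subfield Ω} {x : Ω} :
    x ∈ insepClosure K ↔ ∃ n : ℕ, x ^ q ^ n ∈ K := by
  have : ExpChar K q := expChar_subfield q K
  change x ∈ perfectClosure K Ω ↔ _
  rw [mem_perfectClosure_iff_pow_mem q]
  exact exists_congr fun n => ⟨fun ⟨y, hy⟩ => hy ▸ y.2, fun h => ⟨⟨_, h⟩, rfl⟩⟩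

theorem le_algClosure (K : Subfield Ω) : K ≤ algClosure K := fun x hx =>
  mem_algClosure.2 (isAlgebraic_algebraMap (⟨x, hx⟩ : K))

theorem le_sepClosure (K : Subfield Ω) : K ≤ sepClosure K := fun x hx =>
  mem_sepClosure.2 (isSeparable_algebraMap (⟨x, hx⟩ : K))

theorem sepClosure_le_algClosure (K : Subfield Ω) : sepClosure K ≤ algClosure K := fun _ hx =>
  mem_algClosure.2 (mem_sepClosure.1 hx).isIntegral.isAlgebraic

theorem algClosure_mono {K L : Subfield Ω} (h : K ≤ L) : algClosure K ≤ algClosure L := by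
  intro x hx
  let _ := (Subfield.inclusion h).toAlgebra
  have : IsScalarTower K L Ω := IsScalarTower.of_algebraMap_eq fun _ => rfl
  exact mem_algClosure.2 ((mem_algClosure.1 hx).tower_top L)

theorem sepClosure_mono {K L : Subfield Ω} (h : K ≤ L) : sepClosure K ≤ sepClosure L := by
  intro x hx
  let _ := (Subfield.inclusion h).toAlgebra
  have : IsScalarTower K L Ω := IsScalarTower.of_algebraMap_eq fun _ => rfl
  exact mem_sepClosure.2 ((mem_sepClosure.1 hx).tower_top L)

theorem algClosure_idem (K : Subfield Ω) : algClosure (algClosure K) = algClosure K := by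
  refine le_antisymm (fun x hx => ?_) (le_algClosure _)
  have h : IsAlgebraic (algebraicClosure K Ω) x := mem_algClosure.1 hx
  exact mem_algClosure.2 (h.restrictScalars K)

theorem sepClosure_idem (K : Subfield Ω) : sepClosure (sepClosure K) = sepClosure K := by
  refine le_antisymm (fun x hx => ?_) (le_sepClosure _)
  have h : IsSeparable (separableClosure K Ω) x := mem_sepClosure.1 hx
  exact mem_sepClosure.2 (h.of_algebra_isSeparable_of_isSeparable K)

theorem algClosure_le {K L : Subfield Ω} (h : K ≤ algClosure L) : algClosure K ≤ algClosure L :=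
  (algClosure_mono h).trans (algClosure_idem L).le

theorem sepClosure_le {K L : Subfield Ω} (h : K ≤ sepClosure L) : sepClosure K ≤ sepClosure L :=
  (sepClosure_mono h).trans (sepClosure_idem L).le

/-- Polynomials over Ω with coefficients in K, rather than polynomials over K, make transport along
a field homomorphism a matter of mapping coefficients. -/
theorem mem_algClosure_iff_polynomial {K : Subfield Ω} {x : Ω} :
    x ∈ algClosure K ↔ ∃ p : Polynomial Ω, p ≠ 0 ∧ (∀ n, p.coeff n ∈ K) ∧ p.eval x = 0 := by
  rw [mem_algClosure]
  constructor
  · rintro ⟨p, hp, h⟩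
    refine ⟨p.map (algebraMap K Ω), (Polynomial.map_ne_zero_iff (algebraMap K Ω).injective).2 hp,
      fun n => ?_, ?_⟩
    · rw [Polynomial.coeff_map]; exact (p.coeff n).2
    · rwa [Polynomial.eval_map_algebraMap]
  · rintro ⟨p, hp, hc, h⟩
    obtain ⟨r, rfl⟩ : ∃ r : Polynomial K, r.map (algebraMap K Ω) = p := by
      rw [← Polynomial.mem_lifts, Polynomial.lifts_iff_coeff_lifts]
      exact fun n => ⟨⟨_, hc n⟩, rfl⟩
    refine ⟨r, fun h0 => hp (by rw [h0, Polynomial.map_zero]), ?_⟩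
    rwa [Polynomial.eval_map_algebraMap] at h

/-- Any polynomial with x as a simple root will do, irreducible or not. If the derivative of the
minimal polynomial were zero, the product rule would make the derivative of each of its multiples
vanish at x. -/
theorem mem_sepClosure_iff_polynomial {K : Subfield Ω} {x : Ω} :
    x ∈ sepClosure K ↔ ∃ p : Polynomial Ω, (∀ n, p.coeff n ∈ K) ∧ p.eval x = 0 ∧
      p.derivative.eval x ≠ 0 := by
  rw [mem_sepClosure]
  constructor
  · intro h
    refine ⟨(minpoly K x).map (algebraMap K Ω), fun n => ?_, ?_, ?_⟩
    · rw [Polynomial.coeff_map]; exact ((minpoly K x).coeff n).2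
    · rw [Polynomial.eval_map_algebraMap, minpoly.aeval]
    · rw [Polynomial.derivative_map, Polynomial.eval_map_algebraMap]
      exact h.aeval_derivative_ne_zero (minpoly.aeval K x)
  · rintro ⟨p, hc, h, h'⟩
    obtain ⟨r, rfl⟩ : ∃ r : Polynomial K, r.map (algebraMap K Ω) = p := by
      rw [← Polynomial.mem_lifts, Polynomial.lifts_iff_coeff_lifts]
      exact fun n => ⟨⟨_, hc n⟩, rfl⟩
    rw [Polynomial.eval_map_algebraMap] at h
    rw [Polynomial.derivative_map, Polynomial.eval_map_algebraMap] at h'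
    have hr : r ≠ 0 := by rintro rfl; simp at h'
    have hi : IsIntegral K x := IsAlgebraic.isIntegral ⟨r, hr, h⟩
    obtain ⟨s, rfl⟩ := minpoly.dvd K x h
    refine (Polynomial.separable_iff_derivative_ne_zero (minpoly.irreducible hi)).2 fun h0 => h' ?_
    simp [h0]

theorem map_mem_algClosure {Ω' : Type*} [Field Ω'] (f : Ω →+* Ω') {K : Subfield Ω} {x : Ω}
    (hx : x ∈ algClosure K) : f x ∈ algClosure (K.map f) := by
  rw [mem_algClosure_iff_polynomial] at hx ⊢
  obtain ⟨p, hp, hc, h⟩ := hx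
  refine ⟨p.map f, (Polynomial.map_ne_zero_iff f.injective).2 hp, fun n => ?_, ?_⟩
  · rw [Polynomial.coeff_map]; exact Subfield.mem_map.2 ⟨_, hc n, rfl⟩
  · rw [Polynomial.eval_map, Polynomial.eval₂_at_apply, h, map_zero]

theorem map_mem_sepClosure {Ω' : Type*} [Field Ω'] (f : Ω →+* Ω') {K : Subfield Ω} {x : Ω}
    (hx : x ∈ sepClosure K) : f x ∈ sepClosure (K.map f) := by
  rw [mem_sepClosure_iff_polynomial] at hx ⊢
  obtain ⟨p, hc, h, h'⟩ := hx
  refine ⟨p.map f, fun n => ?_, ?_, ?_⟩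
  · rw [Polynomial.coeff_map]; exact Subfield.mem_map.2 ⟨_, hc n, rfl⟩
  · rw [Polynomial.eval_map, Polynomial.eval₂_at_apply, h, map_zero]
  · rw [Polynomial.derivative_map, Polynomial.eval_map, Polynomial.eval₂_at_apply]
    exact (map_ne_zero f).2 h'

theorem exists_polynomial_map_eq {Ω' : Type*} [Field Ω'] (f : Ω →+* Ω') {K : Subfield Ω}
    {p : Polynomial Ω'} (hc : ∀ n, p.coeff n ∈ K.map f) :
    ∃ r : Polynomial Ω, (∀ n, r.coeff n ∈ K) ∧ r.map f = p := by
  obtain ⟨r, rfl⟩ : ∃ r : Polynomial Ω, r.map f = p := by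
    rw [← Polynomial.mem_lifts, Polynomial.lifts_iff_coeff_lifts]
    exact fun n => let ⟨y, _, hy⟩ := Subfield.mem_map.1 (hc n); ⟨y, hy⟩
  refine ⟨r, fun n => ?_, rfl⟩
  obtain ⟨y, hy, h⟩ := Subfield.mem_map.1 (hc n)
  rw [Polynomial.coeff_map] at h
  exact f.injective h ▸ hy

theorem mem_algClosure_of_map {Ω' : Type*} [Field Ω'] (f : Ω →+* Ω') {K : Subfield Ω} {x : Ω}
    (hx : f x ∈ algClosure (K.map f)) : x ∈ algClosure K := by
  rw [mem_algClosure_iff_polynomial] at hx ⊢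
  obtain ⟨p, hp, hc, h⟩ := hx
  obtain ⟨r, hr, rfl⟩ := exists_polynomial_map_eq f hc
  refine ⟨r, fun h0 => hp (by rw [h0, Polynomial.map_zero]), hr, f.injective ?_⟩
  rwa [Polynomial.eval_map, Polynomial.eval₂_at_apply, ← map_zero f] at h

theorem mem_sepClosure_of_map {Ω' : Type*} [Field Ω'] (f : Ω →+* Ω') {K : Subfield Ω} {x : Ω}
    (hx : f x ∈ sepClosure (K.map f)) : x ∈ sepClosure K := by
  rw [mem_sepClosure_iff_polynomial] at hx ⊢
  obtain ⟨p, hc, h, h'⟩ := hx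
  obtain ⟨r, hr, rfl⟩ := exists_polynomial_map_eq f hc
  refine ⟨r, hr, f.injective ?_, fun h0 => h' ?_⟩
  · rwa [Polynomial.eval_map, Polynomial.eval₂_at_apply, ← map_zero f] at h
  · rw [Polynomial.derivative_map, Polynomial.eval_map, Polynomial.eval₂_at_apply, h0, map_zero]

/-- The minimal polynomial has the form g(X^(q^n)) with g separable, and g kills x^(q^n). -/
theorem exists_pow_mem_sepClosure (q : ℕ) [ExpChar Ω q] {K : Subfield Ω} {x : Ω}
    (hx : x ∈ algClosure K) : ∃ n : ℕ, x ^ q ^ n ∈ sepClosure K := by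
  have : ExpChar K q := expChar_subfield q K
  obtain ⟨g, hg, n, h⟩ :=
    (minpoly.irreducible (mem_algClosure.1 hx).isIntegral).hasSeparableContraction q
  refine ⟨n, mem_sepClosure.2 (hg.of_dvd (minpoly.dvd K _ ?_))⟩
  rw [← Polynomial.expand_aeval, h, minpoly.aeval]

end Closures

/-! ### Linear disjointness -/

section LinearDisjointness

variable {Ω : Type*} [Field Ω] {A B C : Subfield Ω}

theorem linearlyDisjoint_iff_sum : LinearlyDisjoint A B C ↔ ∀ (n : ℕ) (a c : Fin n → Ω),
    (∀ k, a k ∈ B) → (∀ k, c k ∈ C) → LinearIndependent A a → ∑ k, c k * a k = 0 →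
      ∀ k, c k = 0 := by
  refine ⟨fun h n a c ha hc hi hs k => ?_, fun h n a ha hi => ?_⟩
  · have := Fintype.linearIndependent_iff.1 (h n a ha hi) (fun k => ⟨c k, hc k⟩)
      (by simpa [Subfield.smul_def] using hs) k
    exact congrArg Subtype.val this
  · refine Fintype.linearIndependent_iff.2 fun g hg k => Subtype.ext ?_
    exact h n a (fun k => g k) ha (fun k => (g k).2) hi (by simpa [Subfield.smul_def] using hg) k

theorem LinearlyDisjoint.linearIndependent (h : LinearlyDisjoint A B C) {ι : Type*} {a : ι → Ω}
    (ha : ∀ i, a i ∈ B) (hi : LinearIndependent A a) : LinearIndependent C a := by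
  rw [linearIndependent_iff_finset_linearIndependent]
  intro s
  have e := s.equivFin
  have h1 := h s.card (a ∘ Subtype.val ∘ e.symm) (fun k => ha _)
    (hi.comp _ (Subtype.val_injective.comp e.symm.injective))
  have h2 := h1.comp e e.injective
  convert h2 using 1
  ext i
  simp

theorem linearlyDisjoint_iff_extendScalars (hB : A ≤ B) (hC : A ≤ C) : LinearlyDisjoint A B C ↔
    (Subfield.extendScalars hB).LinearDisjoint (Subfield.extendScalars hC) := by
  constructor
  · intro h
    refine .of_basis_left (Module.Basis.ofVectorSpace A (Subfield.extendScalars hB)) ?_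
    refine h.linearIndependent (fun i => SetLike.coe_mem _) ?_
    exact (Module.Basis.linearIndependent _).map' (Subfield.extendScalars hB).val.toLinearMap
      (LinearMap.ker_eq_bot.2 (RingHom.injective _))
  · intro h n a ha hi
    have := h.linearIndependent_left 
      (a := fun k => (⟨a k, ha k⟩ : Subfield.extendScalars hB))
      (hi.of_comp (Subfield.extendScalars hB).val.toLinearMap)
    exact this

theorem LinearlyDisjoint.symm (h : LinearlyDisjoint A B C) (hB : A ≤ B) (hC : A ≤ C) :
    LinearlyDisjoint A C B :=
  (linearlyDisjoint_iff_extendScalars hC hB).2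
    ((linearlyDisjoint_iff_extendScalars hB hC).1 h).symm

theorem LinearlyDisjoint.mono {B' C' : Subfield Ω} (h : LinearlyDisjoint A B C) (hB : B' ≤ B)
    (hC : C' ≤ C) : LinearlyDisjoint A B' C' := by
  rw [linearlyDisjoint_iff_sum] at h ⊢
  exact fun n a c ha hc => h n a c (fun k => hB (ha k)) (fun k => hC (hc k))

/-- Independence of a family in B is carried from A to B' and then, the family lying in `B ⊔ B'`,
from B' to C. -/
theorem LinearlyDisjoint.trans {B' : Subfield Ω} (h : LinearlyDisjoint A B B')
    (h' : LinearlyDisjoint B' (B ⊔ B') C) : LinearlyDisjoint A B C := fun n a ha hi =>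
  h' n a (fun k => le_sup_left (a := B) (ha k)) (h n a ha hi)

theorem mem_sup_iff_div {K L : Subfield Ω} {x : Ω} : x ∈ K ⊔ L ↔
    ∃ y ∈ Submodule.span K (L : Set Ω), ∃ z ∈ Submodule.span K (L : Set Ω), y / z = x := by
  have h1 : K ⊔ L = (IntermediateField.adjoin K (L : Set Ω)).toSubfield := by
    rw [IntermediateField.adjoin_toSubfield, Subfield.closure_union, Subfield.closure_eq]
    congr 1
    have : Set.range (algebraMap K Ω) = K := Subtype.range_coe
    rw [this, Subfield.closure_eq]
  have h2 : Subalgebra.toSubmodule (Algebra.adjoin K (L : Set Ω)) =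
      Submodule.span K (L : Set Ω) := by
    rw [Algebra.adjoin_eq_span]
    congr 1
    exact congrArg SetLike.coe (Submonoid.closure_eq L.toSubmonoid)
  rw [h1, IntermediateField.mem_toSubfield, IntermediateField.mem_adjoin_iff_div]
  simp_rw [← h2, Subalgebra.mem_toSubmodule, eq_comm (a := x)]

theorem mul_mem_span_subfield {K L : Subfield Ω} {x y : Ω}
    (hx : x ∈ Submodule.span K (L : Set Ω)) (hy : y ∈ Submodule.span K (L : Set Ω)) :
    x * y ∈ Submodule.span K (L : Set Ω) := by
  have h := Submodule.mul_mem_mul hx hy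
  rw [Submodule.span_mul_span] at h
  refine Submodule.span_mono ?_ h
  rintro _ ⟨a, ha, b, hb, rfl⟩
  exact L.mul_mem ha hb

theorem mem_span_subfield_iff {K L : Subfield Ω} {x : Ω} : x ∈ Submodule.span K (L : Set Ω) ↔
    ∃ (n : ℕ) (c l : Fin n → Ω), (∀ k, c k ∈ K) ∧ (∀ k, l k ∈ L) ∧ ∑ k, c k * l k = x := by
  rw [Submodule.mem_span_set']
  constructor
  · rintro ⟨n, f, g, h⟩
    exact ⟨n, fun k => f k, fun k => g k, fun k => (f k).2, fun k => (g k).2, h⟩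
  · rintro ⟨n, c, l, hc, hl, h⟩
    exact ⟨n, fun k => ⟨c k, hc k⟩, fun k => ⟨l k, hl k⟩, h⟩

/-- A finite family in `K ⊔ L` has a common denominator in the `K`-span of `L`. -/
theorem exists_common_denominator {K L : Subfield Ω} {ι : Type*} [Fintype ι] {f : ι → Ω}
    (hf : ∀ i, f i ∈ K ⊔ L) : ∃ d : Ω, d ≠ 0 ∧ ∀ i, f i * d ∈ Submodule.span K (L : Set Ω) := by
  classical
  have h1 : (1 : Ω) ∈ Submodule.span K (L : Set Ω) := Submodule.subset_span L.one_mem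
  have key (i : ι) : ∃ z ∈ Submodule.span K (L : Set Ω), z ≠ 0 ∧
      f i * z ∈ Submodule.span K (L : Set Ω) := by
    obtain ⟨y, hy, z, hz, h⟩ := mem_sup_iff_div.1 (hf i)
    -- The quotient representation allows the denominator 0; the element is then 0 by convention,
    -- and 1 serves as denominator.
    by_cases h0 : z = 0
    · refine ⟨1, h1, one_ne_zero, ?_⟩
      rw [← h, h0, div_zero, zero_mul]
      exact zero_mem _
    · exact ⟨z, hz, h0, by rwa [← h, div_mul_cancel₀ _ h0]⟩
  choose z hz hz0 hfz using key
  refine ⟨∏ i, z i, Finset.prod_ne_zero_iff.2 fun i _ => hz0 i, fun i => ?_⟩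
  rw [← Finset.mul_prod_erase _ _ (Finset.mem_univ i), ← mul_assoc]
  refine mul_mem_span_subfield (hfz i) ?_
  refine Finset.prod_induction _ (· ∈ Submodule.span K (L : Set Ω))
    (fun _ _ => mul_mem_span_subfield) h1 fun j _ => hz j

theorem exists_basis_subfield {Ω : Type u} [Field Ω] {A B : Subfield Ω} (h : A ≤ B) :
    ∃ (ι : Type u) (b : ι → Ω), (∀ i, b i ∈ B) ∧
    LinearIndependent A b ∧ (B : Set Ω) ⊆ Submodule.span A (Set.range b) := by
  let v := Module.Basis.ofVectorSpace A (Subfield.extendScalars h)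
  let f := (Subfield.extendScalars h).val.toLinearMap
  refine ⟨_, fun i => v i, fun i => (v i).2, v.linearIndependent.map' f
    (LinearMap.ker_eq_bot.2 (RingHom.injective _)), fun x hx => ?_⟩
  rw [show (Set.range fun i => ((v i : Subfield.extendScalars h) : Ω)) = f '' Set.range v from
    Set.range_comp f v, Submodule.span_image, v.span_eq]
  exact ⟨⟨x, hx⟩, trivial, rfl⟩

/-- Base change from A to C'. In a relation ∑ f i * c i = 0 with `f i ∈ B ⊔ C'`, denominators are
cleared and the f i are expanded in an A-basis b of B with coefficients `k i j ∈ C'`. Disjointness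
kills each ∑ i, k i j * c i, and independence of c over C' then kills each k i j. -/
theorem LinearlyDisjoint.sup {C' : Subfield Ω} (h : LinearlyDisjoint A B C) (hB : A ≤ B)
    (hA : A ≤ C') (hC : C' ≤ C) : LinearlyDisjoint C' (B ⊔ C') C := by
  classical
  refine LinearlyDisjoint.symm ?_ hC le_sup_right
  rw [linearlyDisjoint_iff_sum]
  intro n c f hc hf hi hs
  obtain ⟨d, hd, hfd⟩ := exists_common_denominator (K := C') (L := B) (f := f)
    fun k => by rw [sup_comm]; exact hf k
  obtain ⟨ι, b, hb, hbi, hbs⟩ := exists_basis_subfield hB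
  have hspan : Submodule.span C' (B : Set Ω) ≤ Submodule.span C' (Set.range b) := by
    rw [Submodule.span_le]
    intro x hx
    have hx := hbs hx
    obtain ⟨m, g, l, rfl⟩ := (Submodule.mem_span_set' ..).1 hx
    refine sum_mem fun i _ => ?_
    exact Submodule.smul_mem _ (⟨g i, hA (g i).2⟩ : C') (Submodule.subset_span (l i).2)
  choose k hk using fun i => Finsupp.mem_span_range_iff_exists_finsupp.1 (hspan (hfd i))
  let s : Finset ι := Finset.univ.biUnion fun i => (k i).support
  have hk' (i : Fin n) : f i * d = ∑ j ∈ s, (k i j : Ω) * b j := by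
    rw [← hk i, Finsupp.sum_of_support_subset (s := s) _
      (Finset.subset_biUnion_of_mem (fun i => (k i).support) (Finset.mem_univ i)) _ (by simp)]
    rfl
  have hmem (j : ι) : ∑ i, (k i j : Ω) * c i ∈ C :=
    sum_mem fun i _ => C.mul_mem (hC (k i j).2) (hc i)
  have hzero := linearIndependent_iff'.1 (h.linearIndependent hb hbi) s
    (fun j => ⟨_, hmem j⟩) (by
      simp_rw [Subfield.smul_def, smul_eq_mul, Finset.sum_mul]
      rw [Finset.sum_comm]
      calc ∑ i, ∑ j ∈ s, (k i j : Ω) * c i * b j = ∑ i, f i * c i * d := by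
            refine Finset.sum_congr rfl fun i _ => ?_
            rw [mul_right_comm, hk' i, Finset.sum_mul]
            exact Finset.sum_congr rfl fun j _ => by ring
        _ = 0 := by rw [← Finset.sum_mul, hs, zero_mul])
  intro i
  have h0 : f i * d = 0 := by
    rw [hk' i]
    refine Finset.sum_eq_zero fun j hj => ?_
    have := Fintype.linearIndependent_iff.1 hi (fun i => k i j) (congrArg Subtype.val (hzero j hj)) i
    rw [this, ZeroMemClass.coe_zero, zero_mul]
  exact (mul_eq_zero.1 h0).resolve_right hd

theorem linearIndependent_map_iff {Ω' : Type*} [Field Ω'] (f : Ω →+* Ω') {ι : Type*} [Fintype ι]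
    {a : ι → Ω} : LinearIndependent (A.map f) (f ∘ a) ↔ LinearIndependent A a := by
  simp_rw [Fintype.linearIndependent_iff, Subfield.smul_def, smul_eq_mul, Function.comp_apply]
  constructor
  · intro h g hg i
    have := h (fun i => ⟨f (g i), Subfield.mem_map.2 ⟨_, (g i).2, rfl⟩⟩) (by
      simp_rw [← map_mul, ← map_sum, hg, map_zero]) i
    exact Subtype.ext ((map_eq_zero f).1 (congrArg Subtype.val this))
  · intro h g hg i
    choose y hy hfy using fun i => Subfield.mem_map.1 (g i).2
    have := h (fun i => ⟨y i, hy i⟩) (f.injective (by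
      simp_rw [map_sum, map_mul, hfy, hg, map_zero])) i
    refine Subtype.ext ?_
    rw [← hfy i, show y i = 0 from congrArg Subtype.val this, map_zero]
    rfl

theorem linearlyDisjoint_map_iff {Ω' : Type*} [Field Ω'] (f : Ω →+* Ω') :
    LinearlyDisjoint (A.map f) (B.map f) (C.map f) ↔ LinearlyDisjoint A B C := by
  constructor
  · intro h n a ha hi
    exact (linearIndependent_map_iff f).1 (h n (f ∘ a) (fun k => Subfield.mem_map.2 ⟨_, ha k, rfl⟩)
      ((linearIndependent_map_iff f).2 hi))
  · intro h n a ha hi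
    choose y hy hfy using fun k => Subfield.mem_map.1 (ha k)
    obtain rfl : f ∘ y = a := funext hfy
    exact (linearIndependent_map_iff f).2 (h n y hy ((linearIndependent_map_iff f).1 hi))

end LinearDisjointness

open scoped TensorProduct

/-! ### Tensor products over relatively algebraically closed perfect fields -/

section Regular

/-- Nullstellensatz: a finitely generated domain over a field `k` has a point with values in an
algebraically closed extension of `k` outside the zero set of a nonzero element. -/
theorem exists_algHom_apply_ne_zero {k R Ω : Type*} [Field k] [CommRing R] [IsDomain R]
    [Algebra k R] [Algebra.FiniteType k R] [Field Ω] [IsAlgClosed Ω] [Algebra k Ω] {f : R}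
    (hf : f ≠ 0) : ∃ φ : R →ₐ[k] Ω, φ f ≠ 0 := by
  -- Inverting f makes its value nonzero at every point; the residue field of a maximal ideal is
  -- finite over k, so it embeds in Ω.
  let R' := Localization.Away f
  have : Nontrivial R' := 
    (IsLocalization.injective R' (powers_le_nonZeroDivisors_of_noZeroDivisors hf)).nontrivial
  have hft : Algebra.FiniteType R R' := IsLocalization.finiteType_of_monoid_fg (.powers f) R'
  have : Algebra.FiniteType k R' := Algebra.FiniteType.trans (S := R) inferInstance hft
  obtain ⟨m, hm⟩ := Ideal.exists_maximal R'
  let _ := Ideal.Quotient.field m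
  have : Algebra.FiniteType k (R' ⧸ m) := inferInstance
  have : Module.Finite k (R' ⧸ m) := finite_of_finite_type_of_isJacobsonRing _ _
  let ψ : (R' ⧸ m) →ₐ[k] Ω := IsAlgClosed.lift
  refine ⟨(ψ.comp (Ideal.Quotient.mkₐ k m)).comp (IsScalarTower.toAlgHom k R R'), ?_⟩
  have hu : IsUnit (algebraMap R R' f) := IsLocalization.Away.algebraMap_isUnit f
  exact (hu.map (ψ.comp (Ideal.Quotient.mkₐ k m))).ne_zero

variable {Ω : Type*} [Field Ω]

/-- The minimal polynomial over F is a monic factor of the one over T, so its coefficients are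
integral over T; lying in F, they lie in T. -/
theorem natDegree_minpoly_eq_of_relAlgClosed {T F : Subfield Ω} (h : T ≤ F)
    (hrel : ∀ x ∈ F, x ∈ algClosure T → x ∈ T) {θ : Ω} (hθ : θ ∈ algClosure T) :
    (minpoly T θ).natDegree ≤ (minpoly F θ).natDegree := by
  let _ := (Subfield.inclusion h).toAlgebra
  have : IsScalarTower T F Ω := IsScalarTower.of_algebraMap_eq fun _ => rfl
  have hT : IsIntegral T θ := (mem_algClosure.1 hθ).isIntegral
  have hF : IsIntegral F θ := hT.tower_top
  have hc (n : ℕ) : ((minpoly F θ).coeff n : Ω) ∈ T := by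
    refine hrel _ (SetLike.coe_mem _) (mem_algClosure.2 ?_)
    have := Polynomial.isIntegral_coeff_of_dvd (minpoly T θ) (minpoly F θ) (minpoly.monic hT)
      (minpoly.monic hF) (minpoly.dvd_map_of_isScalarTower T F θ) n
    exact (this.map (IsScalarTower.toAlgHom T F Ω)).isAlgebraic
  obtain ⟨r, hr⟩ : ∃ r : Polynomial T, r.map (algebraMap T F) = minpoly F θ := by
    rw [← Polynomial.mem_lifts, Polynomial.lifts_iff_coeff_lifts]
    exact fun n => ⟨⟨_, hc n⟩, rfl⟩
  have h0 : r ≠ 0 := by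
    rintro rfl
    exact minpoly.ne_zero hF (by rw [← hr, Polynomial.map_zero])
  rw [← hr, Polynomial.natDegree_map]
  refine Polynomial.natDegree_le_of_dvd (minpoly.dvd T θ ?_) h0
  rw [← Polynomial.aeval_map_algebraMap F, hr, minpoly.aeval]

/-- As T is perfect, the finitely many algebraic coefficients are polynomials in one primitive
element θ. Its degree does not drop over F, so a relation becomes a polynomial over F in θ of too
small a degree, which must vanish coefficient by coefficient. -/
theorem linearlyDisjoint_algClosure {T F : Subfield Ω} [PerfectField T] (h : T ≤ F)
    (hrel : ∀ x ∈ F, x ∈ algClosure T → x ∈ T) : LinearlyDisjoint T F (algClosure T) := by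
  rw [linearlyDisjoint_iff_sum]
  intro n a c ha hc hi hs
  let N := IntermediateField.adjoin T (Set.range c)
  have hN : FiniteDimensional T N := IntermediateField.finiteDimensional_adjoin <| by
    rintro _ ⟨k, rfl⟩
    exact (mem_algClosure.1 (hc k)).isIntegral
  obtain ⟨θ, hθ⟩ := Field.exists_primitive_element T N
  have hθT : IsIntegral T (θ : Ω) :=
    (Algebra.IsIntegral.isIntegral (R := T) θ).map N.val
  have hmem (k : Fin n) : ∃ P : Polynomial T, Polynomial.aeval (θ : Ω) P = c k ∧
      P.degree < (minpoly T (θ : Ω)).degree := by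
    have hk : (⟨c k, IntermediateField.subset_adjoin T _ ⟨k, rfl⟩⟩ : N) ∈
        IntermediateField.adjoin T {θ} := hθ ▸ IntermediateField.mem_top
    rw [← IntermediateField.mem_toSubalgebra, IntermediateField.adjoin_simple_toSubalgebra_of_isAlgebraic
      (Algebra.IsAlgebraic.isAlgebraic θ), Algebra.adjoin_singleton_eq_range_aeval] at hk
    obtain ⟨P, hP⟩ := hk
    have hP' : Polynomial.aeval (θ : Ω) P = c k := by
      exact (Polynomial.aeval_algHom_apply N.val θ P).trans (congrArg N.val hP)
    refine ⟨P %ₘ minpoly T (θ : Ω), ?_, Polynomial.degree_modByMonic_lt _ (minpoly.monic hθT)⟩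
    rw [Polynomial.aeval_modByMonic_eq_self_of_root (minpoly.aeval T _), hP']
  choose P hP hdeg using hmem
  let _ := (Subfield.inclusion h).toAlgebra
  have : IsScalarTower T F Ω := IsScalarTower.of_algebraMap_eq fun _ => rfl
  let Q : Polynomial F := ∑ k, Polynomial.C ⟨a k, ha k⟩ * (P k).map (algebraMap T F)
  have hQ : Polynomial.aeval (θ : Ω) Q = 0 := by
    simp only [Q, map_sum, map_mul, Polynomial.aeval_C, Polynomial.aeval_map_algebraMap, hP]
    rw [← hs]
    exact Finset.sum_congr rfl fun k _ => mul_comm _ _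
  have hQdeg : Q.degree < (minpoly F (θ : Ω)).degree := by
    have h1 : (minpoly T (θ : Ω)).degree ≤ (minpoly F (θ : Ω)).degree := by
      rw [Polynomial.degree_eq_natDegree (minpoly.ne_zero hθT),
        Polynomial.degree_eq_natDegree (minpoly.ne_zero hθT.tower_top)]
      exact_mod_cast natDegree_minpoly_eq_of_relAlgClosed h hrel
        (mem_algClosure.2 hθT.isAlgebraic)
    refine lt_of_lt_of_le ?_ h1
    refine (Polynomial.degree_sum_le _ _).trans_lt ((Finset.sup_lt_iff ?_).2 fun k _ => ?_)
    · exact bot_lt_iff_ne_bot.2 (by simpa using minpoly.ne_zero hθT)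
    · refine lt_of_le_of_lt ?_ (hdeg k)
      rw [← Polynomial.degree_map (P k) (algebraMap T F), ← Polynomial.smul_eq_C_mul]
      exact Polynomial.degree_smul_le _ _
  have hQ0 : Q = 0 := by
    by_contra h0
    exact absurd (minpoly.degree_le_of_ne_zero F _ h0 hQ) (not_le.2 hQdeg)
  have hP0 (k : Fin n) : P k = 0 := by
    ext j
    have hj : ∑ k, ((P k).coeff j : Ω) * a k = 0 := by
      have := congrArg (fun q : Polynomial F => ((q.coeff j : F) : Ω)) hQ0
      simp only [Q, Polynomial.finsetSum_coeff, Polynomial.coeff_C_mul, Polynomial.coeff_map,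
        Polynomial.coeff_zero] at this
      rw [← ZeroMemClass.coe_zero F, ← this, AddSubmonoidClass.coe_finsetSum]
      exact Finset.sum_congr rfl fun k _ => mul_comm _ _
    exact congrArg Subtype.val (Fintype.linearIndependent_iff.1 hi (fun k => (P k).coeff j)
      (by simpa [Subfield.smul_def] using hj) k)
  intro k
  rw [← hP k, hP0 k, map_zero]

/-- If `T` is perfect and relatively algebraically closed in `F`, then `S ⊗[T] F` is a domain for
every field extension `S` of `T`. -/
theorem isDomain_tensorProduct (T S F : Type*) [Field T] [Field S] [Field F] [Algebra T S]
    [Algebra T F] [PerfectField T]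
    (hrel : ∀ x : F, IsAlgebraic T x → x ∈ (algebraMap T F).range) : IsDomain (S ⊗[T] F) := by
  classical
  have hnt : Nontrivial (S ⊗[T] F) :=
    (Algebra.TensorProduct.includeLeft_injective (R := T) (A := S) (B := F) (S := T)
      (algebraMap T F).injective).nontrivial
  refine @NoZeroDivisors.to_isDomain _ _ hnt ⟨fun {x y} hxy => ?_⟩
  by_contra! hne
  let Ω := AlgebraicClosure F
  let v := Module.Basis.ofVectorSpace T F
  let b := Algebra.TensorProduct.basis S v
  obtain ⟨i, hi⟩ : ∃ i, b.repr x i ≠ 0 := by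
    by_contra! h
    exact hne.1 (b.repr.map_eq_zero_iff.1 (Finsupp.ext h))
  obtain ⟨j, hj⟩ : ∃ j, b.repr y j ≠ 0 := by
    by_contra! h
    exact hne.2 (b.repr.map_eq_zero_iff.1 (Finsupp.ext h))
  -- Only the finitely many coordinates of x and y matter. They generate an algebra R of finite type
  -- over T, which has points algebraic over T.
  let s : Finset S := (b.repr x).support.image (b.repr x) ∪ (b.repr y).support.image (b.repr y)
  let R := Algebra.adjoin T (s : Set S)
  have hR : Algebra.FiniteType T R :=
    (Subalgebra.fg_iff_finiteType R).1 (Subalgebra.fg_adjoin_finset s)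
  have hx (k) : b.repr x k ∈ R := by
    by_cases h : b.repr x k = 0
    · rw [h]; exact zero_mem _
    · exact Algebra.subset_adjoin (Finset.mem_coe.2 (Finset.mem_union_left _
        (Finset.mem_image_of_mem _ (Finsupp.mem_support_iff.2 h))))
  have hy (k) : b.repr y k ∈ R := by
    by_cases h : b.repr y k = 0
    · rw [h]; exact zero_mem _
    · exact Algebra.subset_adjoin (Finset.mem_coe.2 (Finset.mem_union_right _
        (Finset.mem_image_of_mem _ (Finsupp.mem_support_iff.2 h))))
  let f : R ⊗[T] F →ₐ[T] S ⊗[T] F := Algebra.TensorProduct.map R.val (AlgHom.id T F)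
  have hf : Function.Injective f :=
    Module.Flat.rTensor_preserves_injective_linearMap R.val.toLinearMap Subtype.val_injective
  have hrep (z : S ⊗[T] F) (hz : ∀ k, b.repr z k ∈ R) :
      f (∑ k ∈ (b.repr z).support, (⟨_, hz k⟩ : R) ⊗ₜ v k) = z := by
    rw [map_sum]
    conv_rhs => rw [← b.linearCombination_repr z, Finsupp.linearCombination_apply, Finsupp.sum]
    refine Finset.sum_congr rfl fun k _ => ?_
    simp [f, b, TensorProduct.smul_tmul']
  -- The point is chosen so that a nonzero coordinate of x and a nonzero coordinate of y both keep
  -- nonzero values.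
  obtain ⟨φ₀, hφ₀⟩ := exists_algHom_apply_ne_zero (k := T) (Ω := AlgebraicClosure T) (R := R)
    (f := ⟨_, hx i⟩ * ⟨_, hy j⟩) (mul_ne_zero (fun h => hi (congrArg Subtype.val h))
      (fun h => hj (congrArg Subtype.val h)))
  let φ : R →ₐ[T] Ω := (IsAlgClosed.lift : AlgebraicClosure T →ₐ[T] Ω).comp φ₀
  have hφ : φ ⟨_, hx i⟩ * φ ⟨_, hy j⟩ ≠ 0 := by
    rw [← map_mul]
    exact (map_ne_zero (IsAlgClosed.lift : AlgebraicClosure T →ₐ[T] Ω)).2 hφ₀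
  let g : R ⊗[T] F →ₐ[T] Ω := Algebra.TensorProduct.productMap φ (IsScalarTower.toAlgHom T F Ω)
  let T' : Subfield Ω := (algebraMap T Ω).fieldRange
  let F' : Subfield Ω := (algebraMap F Ω).fieldRange
  have hTF : T' ≤ F' := by
    rintro _ ⟨t, rfl⟩
    exact ⟨algebraMap T F t, (IsScalarTower.algebraMap_apply T F Ω t).symm⟩
  let eT : T ≃+* T' := RingEquiv.ofBijective (algebraMap T Ω).rangeRestrictField
    ⟨(algebraMap T Ω).rangeRestrictField.injective,
      fun ⟨_, t, h⟩ => ⟨t, Subtype.ext h⟩⟩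
  have hT' : PerfectField T' := PerfectField.of_ringEquiv eT
  have hld : LinearlyDisjoint T' F' (algClosure T') := by
    refine linearlyDisjoint_algClosure hTF ?_
    rintro _ ⟨x, rfl⟩ hx
    have h1 : IsAlgebraic T (algebraMap F Ω x) :=
      (mem_algClosure.1 hx).of_ringHom_of_comp_eq eT.toRingHom (RingHom.id Ω) eT.surjective
        Function.injective_id rfl
    obtain ⟨t, ht⟩ := hrel x ((isAlgebraic_algebraMap_iff (algebraMap F Ω).injective).1 h1)
    exact ⟨t, by rw [← ht, ← IsScalarTower.algebraMap_apply]⟩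
  -- The coordinates of z take values algebraic over T, over which the basis v of F stays
  -- independent. So if the specialization of z in the field Ω is zero, then every specialized
  -- coordinate is zero.
  have key (z : S ⊗[T] F) (hz : ∀ k, b.repr z k ∈ R)
      (h0 : g (∑ k ∈ (b.repr z).support, (⟨_, hz k⟩ : R) ⊗ₜ v k) = 0) (k) :
      φ ⟨_, hz k⟩ = 0 := by
    by_cases hk : k ∈ (b.repr z).support
    swap
    · rw [show (⟨_, hz k⟩ : R) = 0 from Subtype.ext (Finsupp.notMem_support_iff.1 hk), map_zero]
    have hv : LinearIndependent T' (fun k => algebraMap F Ω (v k)) := by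
      rw [linearIndependent_iff']
      intro s c hc k hk
      choose t ht using fun k => (c k).2
      have h1 : ∑ k ∈ s, t k • v k = 0 := by
        refine (algebraMap F Ω).injective ?_
        rw [map_sum, map_zero, ← hc]
        refine Finset.sum_congr rfl fun k _ => ?_
        rw [Algebra.smul_def, map_mul, ← IsScalarTower.algebraMap_apply, ht, Subfield.smul_def,
          smul_eq_mul]
      refine Subtype.ext ?_
      rw [← ht k, linearIndependent_iff'.1 v.linearIndependent s t h1 k hk, map_zero]
      rfl
    have hmem (r : R) : φ r ∈ algClosure T' := by
      have h1 : IsAlgebraic T (φ r) := 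
        (Algebra.IsAlgebraic.isAlgebraic (R := T) (φ₀ r)).algHom IsAlgClosed.lift
      exact mem_algClosure.2 (h1.ringHom_of_comp_eq eT.toRingHom (RingHom.id Ω)
        eT.injective rfl)
    have := linearIndependent_iff'.1 (hld.linearIndependent (fun k => ⟨v k, rfl⟩) hv)
      (b.repr z).support (fun k => ⟨φ ⟨_, hz k⟩, hmem _⟩) (by
        simpa [g, Subfield.smul_def] using h0) k hk
    exact congrArg Subtype.val this
  have hxy' : (∑ k ∈ (b.repr x).support, (⟨_, hx k⟩ : R) ⊗ₜ[T] v k) *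
      (∑ k ∈ (b.repr y).support, (⟨_, hy k⟩ : R) ⊗ₜ v k) = 0 := by
    refine hf ?_
    rw [map_mul, hrep, hrep, hxy, map_zero]
  rcases mul_eq_zero.1 ((map_mul g _ _).symm.trans ((congrArg g hxy').trans (map_zero g)))
    with h | h
  · exact hφ (by rw [key x hx h i, zero_mul])
  · exact hφ (by rw [key y hy h j, mul_zero])

/-- A pure tensor is the product of a ⊗ 1 and 1 ⊗ b, algebraic over the images of F₀ and S₀
respectively; in a domain, sums and products of algebraic elements are algebraic. -/
theorem isAlgebraic_range_tensorProduct_map (T F₀ F S₀ S : Type*) [Field T] [Field F₀] [Field F]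
    [Field S₀] [Field S] [Algebra T F₀] [Algebra T F] [Algebra T S₀] [Algebra T S] [Algebra F₀ F]
    [Algebra S₀ S] [IsScalarTower T F₀ F] [IsScalarTower T S₀ S] [Algebra.IsAlgebraic F₀ F]
    [Algebra.IsAlgebraic S₀ S] [IsDomain (F ⊗[T] S)] (z : F ⊗[T] S) :
    IsAlgebraic (Algebra.TensorProduct.map (IsScalarTower.toAlgHom T F₀ F)
      (IsScalarTower.toAlgHom T S₀ S)).range z := by
  set i := Algebra.TensorProduct.map (IsScalarTower.toAlgHom T F₀ F) (IsScalarTower.toAlgHom T S₀ S)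
  have hA : IsDomain i.range := Subalgebra.isDomain i.range
  induction z using TensorProduct.induction_on with
  | zero => exact isAlgebraic_zero
  | tmul a b =>
    rw [← mul_one a, ← one_mul b, ← Algebra.TensorProduct.tmul_mul_tmul]
    refine IsAlgebraic.mul ?_ ?_
    · let f : F₀ →ₐ[T] i.range :=
        i.rangeRestrict.comp (Algebra.TensorProduct.includeLeft (A := F₀) (S := T))
      let g : F →ₐ[T] F ⊗[T] S := Algebra.TensorProduct.includeLeft
      exact (Algebra.IsAlgebraic.isAlgebraic (R := F₀) a).ringHom_of_comp_eq f g
        (RingHom.injective f.toRingHom) (RingHom.ext fun x => by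
          change i (x ⊗ₜ 1) = algebraMap F₀ F x ⊗ₜ 1
          simp [i])
    · let f : S₀ →ₐ[T] i.range :=
        i.rangeRestrict.comp Algebra.TensorProduct.includeRight
      let g : S →ₐ[T] F ⊗[T] S := Algebra.TensorProduct.includeRight
      exact (Algebra.IsAlgebraic.isAlgebraic (R := S₀) b).ringHom_of_comp_eq f g
        (RingHom.injective f.toRingHom) (RingHom.ext fun x => by
          change i (1 ⊗ₜ x) = 1 ⊗ₜ algebraMap S₀ S x
          simp [i])
  | add x y hx hy => exact hx.add hy

/-- Let `T` be perfect and relatively algebraically closed in `F`. If algebraic extensions `F` and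
`S` of `F₀` and `S₀` are given such that `F₀` and `S₀` are linearly disjoint over `T`, then so are
`F` and `S`. -/
theorem LinearlyDisjoint.of_algClosure {T F₀ F S₀ S : Subfield Ω} [PerfectField T]
    (h : LinearlyDisjoint T F₀ S₀) (hF₀ : T ≤ F₀) (hF : F₀ ≤ F) (hS₀ : T ≤ S₀) (hS : S₀ ≤ S)
    (hrel : ∀ x ∈ F, x ∈ algClosure T → x ∈ T)
    (hFa : F ≤ algClosure F₀) (hSa : S ≤ algClosure S₀) : LinearlyDisjoint T F S := by
  let F' := Subfield.extendScalars (hF₀.trans hF)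
  let S' := Subfield.extendScalars (hS₀.trans hS)
  let F₀' := Subfield.extendScalars hF₀
  let S₀' := Subfield.extendScalars hS₀
  have hdom : IsDomain (F' ⊗[T] S') := by
    have : IsDomain (S' ⊗[T] F') := isDomain_tensorProduct T S' F' fun x hx =>
      ⟨⟨x, hrel x x.2 (mem_algClosure.2 (hx.algHom F'.val))⟩, rfl⟩
    exact (Algebra.TensorProduct.comm T F' S').toMulEquiv.isDomain
  let m : F' ⊗[T] S' →ₐ[T] Ω := F'.toSubalgebra.mulMap S'.toSubalgebra
  let i : F₀' ⊗[T] S₀' →ₐ[T] F' ⊗[T] S' := Algebra.TensorProduct.map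
    (IntermediateField.inclusion (show F₀' ≤ F' from hF))
    (IntermediateField.inclusion (show S₀' ≤ S' from hS))
  have hmi : Function.Injective (m.comp i) := by
    have h1 := Subalgebra.linearDisjoint_iff_injective.1 (IntermediateField.linearDisjoint_iff'.1
      ((linearlyDisjoint_iff_extendScalars hF₀ hS₀).1 h))
    have h2 : m.comp i = F₀'.toSubalgebra.mulMap S₀'.toSubalgebra := by
      refine Algebra.TensorProduct.ext' fun a b => ?_
      simp [m, i]
      rfl
    rw [h2]
    exact h1
  rw [linearlyDisjoint_iff_extendScalars (hF₀.trans hF) (hS₀.trans hS),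
    IntermediateField.linearDisjoint_iff', Subalgebra.linearDisjoint_iff_injective]
  let _ : Algebra F₀' F' := (IntermediateField.inclusion (show F₀' ≤ F' from hF)).toAlgebra
  let _ : Algebra S₀' S' := (IntermediateField.inclusion (show S₀' ≤ S' from hS)).toAlgebra
  have _ : IsScalarTower T F₀' F' := IsScalarTower.of_algebraMap_eq fun _ => rfl
  have _ : IsScalarTower T S₀' S' := IsScalarTower.of_algebraMap_eq fun _ => rfl
  have _ : Algebra.IsAlgebraic F₀' F' := ⟨fun a =>
    IsAlgebraic.of_ringHom_of_comp_eq (R := F₀') (S := F₀) (A := F') (B := Ω)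
      (RingHom.id F₀ : F₀' →+* F₀) F'.val (mem_algClosure.1 (hFa a.2))
      Function.surjective_id Subtype.val_injective rfl⟩
  have _ : Algebra.IsAlgebraic S₀' S' := ⟨fun a =>
    IsAlgebraic.of_ringHom_of_comp_eq (R := S₀') (S := S₀) (A := S') (B := Ω)
      (RingHom.id S₀ : S₀' →+* S₀) S'.val (mem_algClosure.1 (hSa a.2))
      Function.surjective_id Subtype.val_injective rfl⟩
  have halg := isAlgebraic_range_tensorProduct_map T F₀' F' S₀' S'
  refine (injective_iff_map_eq_zero m).2 fun z hz => ?_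
  by_contra h0
  -- A nonzero element of the kernel of multiplication, being algebraic over the image of F₀ ⊗ S₀,
  -- divides a nonzero element of that image. This one is also in the kernel, against injectivity on
  -- F₀ ⊗ S₀.
  obtain ⟨r, hr, w, hw⟩ := (halg z).exists_nonzero_dvd (mem_nonZeroDivisors_of_ne_zero h0)
  obtain ⟨y, hy⟩ := r.2
  have hy' : i y = z * w := hy.trans hw
  have hy0 : y = 0 := hmi (by
    rw [map_zero, AlgHom.comp_apply, hy', map_mul, hz, zero_mul])
  refine hr (Subtype.ext ?_)
  rw [← hy, hy0]
  exact map_zero i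

end Regular

/-! ### Adjoining sets to subfields -/

section Adjoin

variable {Ω : Type*} [Field Ω]

/-- The subfield generated by a subfield and a set. -/
def adj (K : Subfield Ω) (s : Set Ω) : Subfield Ω := K ⊔ Subfield.closure s

theorem le_adj (K : Subfield Ω) (s : Set Ω) : K ≤ adj K s := le_sup_left

theorem subset_adj (K : Subfield Ω) (s : Set Ω) : s ⊆ adj K s := fun _ hx =>
  (le_sup_right : _ ≤ adj K s) (Subfield.subset_closure hx)

theorem adj_le_iff {K L : Subfield Ω} {s : Set Ω} : adj K s ≤ L ↔ K ≤ L ∧ s ⊆ L := by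
  rw [adj, sup_le_iff, Subfield.closure_le]

theorem adj_le {K L : Subfield Ω} {s : Set Ω} (h : K ≤ L) (hs : s ⊆ L) : adj K s ≤ L :=
  adj_le_iff.2 ⟨h, hs⟩

theorem adj_mono {K L : Subfield Ω} {s t : Set Ω} (h : K ≤ L) (hs : s ⊆ t) : adj K s ≤ adj L t :=
  adj_le (h.trans (le_adj _ _)) (hs.trans (subset_adj _ _))

theorem map_adj {Ω' : Type*} [Field Ω'] (f : Ω →+* Ω') (K : Subfield Ω) (s : Set Ω) :
    (adj K s).map f = adj (K.map f) (f '' s) := by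
  rw [adj, Subfield.map_sup, RingHom.map_field_closure, adj]

theorem adj_eq_adjoin (K : Subfield Ω) (s : Set Ω) :
    adj K s = (IntermediateField.adjoin K s).toSubfield := by
  rw [IntermediateField.adjoin_toSubfield, Subfield.closure_union, adj]
  have : Set.range (algebraMap K Ω) = K := Subtype.range_coe
  rw [this, Subfield.closure_eq]

theorem adj_adj (K : Subfield Ω) (s t : Set Ω) : adj (adj K s) t = adj K (s ∪ t) := by
  rw [adj, adj, adj, sup_assoc, Subfield.closure_union]

/-- An element of `adj K s` already lies in `adj K t` for some finite `t ⊆ s`. -/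
theorem exists_finite_mem_adj {K : Subfield Ω} {s : Set Ω} {x : Ω} (hx : x ∈ adj K s) :
    ∃ t ⊆ s, t.Finite ∧ x ∈ adj K t := by
  rw [adj_eq_adjoin] at hx
  obtain ⟨t, ht, h⟩ := IntermediateField.exists_finset_of_mem_adjoin hx
  exact ⟨t, ht, t.finite_toSet, by rw [adj_eq_adjoin]; exact h⟩

theorem exists_finite_mem_algClosure_adj {K : Subfield Ω} {s : Set Ω} {x : Ω}
    (hx : x ∈ algClosure (adj K s)) : ∃ t ⊆ s, t.Finite ∧ x ∈ algClosure (adj K t) := by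
  obtain ⟨p, h0, h1, h2⟩ := mem_algClosure_iff_polynomial.1 hx
  choose t ht hf hc using fun n => exists_finite_mem_adj (h1 n)
  refine ⟨⋃ n ∈ p.support, t n, Set.iUnion₂_subset fun n _ => ht n,
    p.support.finite_toSet.biUnion fun n _ => hf n,
    mem_algClosure_iff_polynomial.2 ⟨p, h0, fun n => ?_, h2⟩⟩
  by_cases hn : n ∈ p.support
  · exact adj_mono le_rfl (Set.subset_biUnion_of_mem (u := t) hn) (hc n)
  · rw [Polynomial.notMem_support_iff.1 hn]
    exact zero_mem _

theorem exists_finite_mem_sepClosure_adj {K : Subfield Ω} {s : Set Ω} {x : Ω}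
    (hx : x ∈ sepClosure (adj K s)) : ∃ t ⊆ s, t.Finite ∧ x ∈ sepClosure (adj K t) := by
  obtain ⟨p, h1, h2, h0⟩ := mem_sepClosure_iff_polynomial.1 hx
  choose t ht hf hc using fun n => exists_finite_mem_adj (h1 n)
  refine ⟨⋃ n ∈ p.support, t n, Set.iUnion₂_subset fun n _ => ht n,
    p.support.finite_toSet.biUnion fun n _ => hf n,
    mem_sepClosure_iff_polynomial.2 ⟨p, fun n => ?_, h2, h0⟩⟩
  by_cases hn : n ∈ p.support
  · exact adj_mono le_rfl (Set.subset_biUnion_of_mem (u := t) hn) (hc n)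
  · rw [Polynomial.notMem_support_iff.1 hn]
    exact zero_mem _

end Adjoin

/-! ### Algebraic independence over subfields -/

section AlgIndep

variable {Ω : Type*} [Field Ω]

/-- The set `s` is algebraically independent over the subfield `K`. -/
def AlgIndep (K : Subfield Ω) (s : Set Ω) : Prop := AlgebraicIndepOn K id s

/-- The matroid of algebraic independence over a subfield. -/
abbrev algMatroid (K : Subfield Ω) : Matroid Ω := AlgebraicIndependent.matroid K Ω

theorem isAlgebraic_adj_iff {K : Subfield Ω} {s : Set Ω} {x : Ω} :
    IsAlgebraic (adj K s) x ↔ IsAlgebraic (Algebra.adjoin K s) x := by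
  have h : IsAlgebraic (adj K s) x ↔ IsAlgebraic (IntermediateField.adjoin K s) x := by
    rw [adj_eq_adjoin]
    rfl
  rw [h]
  open scoped IntermediateField.algebraAdjoinAdjoin in
  exact (IsFractionRing.isAlgebraic_iff (Algebra.adjoin K s)
    (IntermediateField.adjoin K s) Ω).symm

theorem mem_algClosure_adj_iff {K : Subfield Ω} {s : Set Ω} {x : Ω} :
    x ∈ algClosure (adj K s) ↔ x ∈ (algMatroid K).closure s := by
  rw [AlgebraicIndependent.matroid_closure_eq, mem_algClosure, isAlgebraic_adj_iff]
  rfl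

theorem coe_algClosure_adj (K : Subfield Ω) (s : Set Ω) :
    (algClosure (adj K s) : Set Ω) = (algMatroid K).closure s :=
  Set.ext fun _ => mem_algClosure_adj_iff

theorem algIndep_insert_iff {K : Subfield Ω} {s : Set Ω} {x : Ω} (hx : x ∉ s) :
    AlgIndep K (insert x s) ↔ AlgIndep K s ∧ x ∉ algClosure (adj K s) := by
  rw [AlgIndep, AlgebraicIndepOn.insert_iff hx, mem_algClosure, isAlgebraic_adj_iff, Set.image_id]
  rfl

theorem AlgIndep.subset {K : Subfield Ω} {s t : Set Ω} (h : AlgIndep K t) (hs : s ⊆ t) :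
    AlgIndep K s := h.mono hs

theorem algebraicIndependent_map {Ω' : Type*} [Field Ω'] (f : Ω →+* Ω') {K : Subfield Ω}
    {ι : Type*} {x : ι → Ω} :
    AlgebraicIndependent (K.map f) (f ∘ x) ↔ AlgebraicIndependent K x :=
  algebraicIndependent_ringHom_iff_of_comp_eq (K.equivMapOfInjective f f.injective) f
    f.injective rfl

theorem algIndep_map {Ω' : Type*} [Field Ω'] (f : Ω →+* Ω') {K : Subfield Ω} {s : Set Ω} :
    AlgIndep (K.map f) (f '' s) ↔ AlgIndep K s := by
  have h1 : AlgIndep K s ↔ AlgebraicIndependent K ((↑) : s → Ω) := Iff.rfl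
  rw [h1, ← algebraicIndependent_map f]
  exact (algebraicIndependent_image f.injective.injOn (R := K.map f)).symm

/-- Exchange: `n` independent elements that are algebraic over at most `n` elements have the same
algebraic closure. -/
theorem AlgIndep.exchange {K : Subfield Ω} {u v : Set Ω} (hu : AlgIndep K u) (hv : v.Finite)
    (huv : u ⊆ algClosure (adj K v)) (hc : v.encard ≤ u.encard) :
    AlgIndep K v ∧ v ⊆ algClosure (adj K u) := by
  set M := algMatroid K
  rw [coe_algClosure_adj] at huv ⊢
  have hu' : M.Indep u := hu
  have h1 : u.encard ≤ M.eRk v := by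
    rw [← hu'.eRk_eq_encard, ← M.eRk_closure_eq v]
    exact M.eRk_mono huv
  have hfin : M.IsRkFinite v := M.isRkFinite_of_finite hv
  refine ⟨hfin.indep_of_encard_le_eRk (hc.trans h1), ?_⟩
  have hfu : M.IsRkFinite u := by
    rw [← Matroid.eRk_lt_top_iff, hu'.eRk_eq_encard]
    exact h1.trans_lt hfin.eRk_lt_top
  have h2 := hfu.closure_eq_closure_of_subset_of_eRk_ge_eRk (Y := M.closure v) huv (by
    rw [M.eRk_closure_eq, hu'.eRk_eq_encard]
    exact (M.eRk_le_encard v).trans hc)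
  rw [h2]
  exact (M.subset_closure v).trans (M.subset_closure _)

/-- A subfield that is algebraic over finitely many elements has a finite transcendence basis. -/
theorem exists_finite_algIndep {F : Subfield Ω} {D : Set Ω} {w : Set Ω} (hw : w.Finite)
    (h : D ⊆ algClosure (adj F w)) :
    ∃ s ⊆ D, s.Finite ∧ AlgIndep F s ∧ D ⊆ algClosure (adj F s) := by
  set M := algMatroid F
  obtain ⟨s, hs⟩ := M.exists_isBasis D
  have hsD : D ⊆ algClosure (adj F s) := by
    rw [coe_algClosure_adj]
    exact hs.subset_closure
  refine ⟨s, hs.subset, ?_, hs.indep, hsD⟩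
  rw [← Set.encard_lt_top_iff, ← hs.indep.eRk_eq_encard]
  rw [coe_algClosure_adj] at h
  calc M.eRk s ≤ M.eRk (M.closure w) := M.eRk_mono (hs.subset.trans h)
    _ = M.eRk w := M.eRk_closure_eq w
    _ < ⊤ := (M.isRkFinite_of_finite hw).eRk_lt_top

theorem AlgIndep.finite {F : Subfield Ω} {w s : Set Ω} (hw : w.Finite)
    (h : s ⊆ algClosure (adj F w)) (hs : AlgIndep F s) : s.Finite := by
  set M := algMatroid F
  have hs' : M.Indep s := hs
  rw [← Set.encard_lt_top_iff, ← hs'.eRk_eq_encard]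
  rw [coe_algClosure_adj] at h
  calc M.eRk s ≤ M.eRk (M.closure w) := M.eRk_mono h
    _ = M.eRk w := M.eRk_closure_eq w
    _ < ⊤ := (M.isRkFinite_of_finite hw).eRk_lt_top

/-- Algebraic independence of s is linear independence of the monomials in s, and these lie in B. -/
theorem LinearlyDisjoint.algIndep {A B C : Subfield Ω} (h : LinearlyDisjoint A B C) {s : Set Ω}
    (hs : s ⊆ B) (hi : AlgIndep A s) : AlgIndep C s := by
  have key (K : Subfield Ω) : AlgIndep K s ↔
      LinearIndependent K (fun m : s →₀ ℕ => m.prod fun i e => (i : Ω) ^ e) := by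
    have h1 : AlgIndep K s ↔
        Function.Injective (MvPolynomial.aeval ((↑) : s → Ω) : MvPolynomial s K →ₐ[K] Ω) := Iff.rfl
    rw [h1]
    have h2 : (fun m : s →₀ ℕ => m.prod fun i e => (i : Ω) ^ e) =
        (MvPolynomial.aeval ((↑) : s → Ω) : MvPolynomial s K →ₐ[K] Ω).toLinearMap ∘
          (MvPolynomial.basisMonomials s K) := by
      ext m
      simp [MvPolynomial.aeval_monomial]
    rw [h2]
    refine ⟨fun hinj => (MvPolynomial.basisMonomials s K).linearIndependent.map'
      _ (LinearMap.ker_eq_bot.2 hinj), fun hli => ?_⟩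
    exact LinearMap.injective_of_linearIndependent
      (MvPolynomial.basisMonomials s K).span_eq hli
  rw [key] at hi ⊢
  refine h.linearIndependent (fun m => prod_mem fun i _ => pow_mem (hs i.2) _) hi

/-- A subfield generated by algebraically independent elements is linearly disjoint from the
base. -/
theorem AlgIndep.linearlyDisjoint {T F : Subfield Ω} (hTF : T ≤ F) {u : Set Ω}
    (hu : AlgIndep F u) : LinearlyDisjoint T F (adj T u) := by
  classical
  rw [linearlyDisjoint_iff_sum]
  intro n a c ha hc hi hs
  rw [adj_eq_adjoin] at hc
  choose r s hrs using fun k => (IntermediateField.mem_adjoin_iff T (c k)).1 (hc k)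
  let φ : MvPolynomial u T →ₐ[T] Ω := MvPolynomial.aeval Subtype.val
  by_contra! hne
  obtain ⟨k₀, hk₀⟩ := hne
  -- A denominator that vanishes at u is replaced by 1 and its numerator by 0, in accordance with
  -- division by zero.
  let s' : Fin n → MvPolynomial u T := fun k => if φ (s k) = 0 then 1 else s k
  have hs' (k) : φ (s' k) ≠ 0 := by
    simp only [s']
    split_ifs with h0
    · simp
    · exact h0
  let r' : Fin n → MvPolynomial u T := fun k => if φ (s k) = 0 then 0 else r k
  have hc' (k) : c k * φ (s' k) = φ (r' k) := by
    simp only [s', r', hrs k]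
    split_ifs with h0
    · change φ (r k) / φ (s k) * _ = _
      rw [h0]
      simp
    · exact div_mul_cancel₀ _ h0
  let P : Fin n → MvPolynomial u T := fun k => r' k * ∏ j ∈ Finset.univ.erase k, s' j
  have hP (k) : φ (P k) = c k * ∏ j, φ (s' j) := by
    rw [map_mul, map_prod, ← hc' k, mul_assoc,
      Finset.mul_prod_erase _ (fun j => φ (s' j)) (Finset.mem_univ k)]
  let ι : T →+* F := Subfield.inclusion hTF
  -- With denominators cleared, the relation says that Q over F vanishes at u, so Q = 0. Each of its
  -- coefficients is a T-linear relation among the a k.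
  let Q : MvPolynomial u F := ∑ k, MvPolynomial.C ⟨a k, ha k⟩ * (P k).map ι
  have hQ : MvPolynomial.aeval Subtype.val Q = (0 : Ω) := by
    have : ∀ k, MvPolynomial.aeval Subtype.val ((P k).map ι) = φ (P k) := fun k => by
      simp only [φ, MvPolynomial.aeval_def, MvPolynomial.eval₂_map]
      rfl
    simp only [Q, map_sum, map_mul, MvPolynomial.aeval_C, this, hP]
    calc ∑ k, a k * (c k * ∏ j, φ (s' j)) = (∑ k, c k * a k) * ∏ j, φ (s' j) := by
          rw [Finset.sum_mul]
          exact Finset.sum_congr rfl fun k _ => by ring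
      _ = 0 := by rw [hs, zero_mul]
  have hQ0 : Q = 0 := AlgebraicIndependent.eq_zero_of_aeval_eq_zero hu Q hQ
  have hPk : P k₀ = 0 := by
    ext m
    have hm : ∑ k, (P k).coeff m • a k = 0 := by
      have := congrArg (fun q => ((q.coeff m : F) : Ω)) hQ0
      simp only [Q, MvPolynomial.coeff_sum, MvPolynomial.coeff_C_mul, MvPolynomial.coeff_map,
        AddSubmonoidClass.coe_finsetSum, Subfield.coe_mul, MvPolynomial.coeff_zero] at this
      simp_rw [Subfield.smul_def, smul_eq_mul, mul_comm _ (a _)]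
      exact this
    simpa using Fintype.linearIndependent_iff.1 hi _ hm k₀
  have := hP k₀
  rw [hPk, map_zero] at this
  exact mul_ne_zero hk₀ (Finset.prod_ne_zero_iff.2 fun j _ => hs' j) this.symm

/-- A sequence in which no element is algebraic over the preceding ones is algebraically
independent. -/
theorem algebraicIndependent_of_notMem_lt {F : Subfield Ω} {a : ℕ → Ω}
    (h : ∀ n, a n ∉ algClosure (adj F (a '' {j | j < n}))) : AlgebraicIndependent F a := by
  refine algebraicIndependent_of_finite_type fun t ht => ?_
  lift t to Finset ℕ using ht
  induction t using Finset.induction_on_max with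
  | empty =>
    have : IsEmpty ((∅ : Finset ℕ) : Set ℕ) := by simp
    exact algebraicIndependent_empty_type_iff.2 (algebraMap F Ω).injective
  | insert m s hm ih =>
    rw [Finset.coe_insert]
    refine AlgebraicIndepOn.insert ih fun halg => h m ?_
    refine algClosure_mono (adj_mono le_rfl (Set.image_mono fun j hj => hm j hj))
      (mem_algClosure.2 (isAlgebraic_adj_iff.2 halg))

/-- A sequence in which no element is algebraic over the following ones is algebraically
independent. -/
theorem algebraicIndependent_of_notMem_gt {F : Subfield Ω} {a : ℕ → Ω}
    (h : ∀ n, a n ∉ algClosure (adj F (a '' {j | n < j}))) : AlgebraicIndependent F a := by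
  refine algebraicIndependent_of_finite_type fun t ht => ?_
  lift t to Finset ℕ using ht
  induction t using Finset.induction_on_min with
  | empty =>
    have : IsEmpty ((∅ : Finset ℕ) : Set ℕ) := by simp
    exact algebraicIndependent_empty_type_iff.2 (algebraMap F Ω).injective
  | insert m s hm ih =>
    rw [Finset.coe_insert]
    refine AlgebraicIndepOn.insert ih fun halg => h m ?_
    refine algClosure_mono (adj_mono le_rfl (Set.image_mono fun j hj => hm j hj))
      (mem_algClosure.2 (isAlgebraic_adj_iff.2 halg))

theorem not_algebraicIndependent_of_finite {F : Subfield Ω} {a : ℕ → Ω} {w : Set Ω}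
    (hw : w.Finite) (h : ∀ n, a n ∈ algClosure (adj F w)) : ¬ AlgebraicIndependent F a := by
  intro hi
  have h1 : AlgIndep F (Set.range a) := hi.to_subtype_range
  exact Set.infinite_range_of_injective hi.injective
    (h1.finite hw (Set.range_subset_iff.2 h))

/-- Let `S` be a finite set whose elements are algebraic over the translates `σ ^ n s`, `1 ≤ n`.
Then all translates are algebraic over finitely many elements. -/
theorem exists_finite_of_mem_algClosure_translates (f : Ω →+* Ω) {F : Subfield Ω}
    (hF : F.map f ≤ F) {S : Set Ω} (hS : S.Finite)
    (h : S ⊆ algClosure (adj F {y | ∃ n, ∃ s ∈ S, f^[n + 1] s = y})) :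
    ∃ w : Set Ω, w.Finite ∧ ∀ n, ∀ s ∈ S, f^[n] s ∈ algClosure (adj F w) := by
  classical
  set M := algMatroid F
  let C : ℕ → Set Ω := fun N => {y | ∃ n < N, ∃ s ∈ S, f^[n] s = y}
  have hCfin (N) : (C N).Finite := by
    have : C N = ⋃ n ∈ Set.Iio N, (f^[n]) '' S := by
      ext y
      simp [C]
    rw [this]
    exact (Set.finite_Iio N).biUnion fun n _ => hS.image _
  have hCmono {N N'} (hN : N ≤ N') : C N ⊆ C N' := fun y ⟨n, hn, s, hs, e⟩ =>
    ⟨n, hn.trans_le hN, s, hs, e⟩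
  -- Finitely many translates witness the algebraicity of the finite set S, so their exponents are
  -- bounded.
  obtain ⟨N, hN⟩ : ∃ N, S ⊆ algClosure (adj F (f '' C N)) := by
    have h1 : ∀ s ∈ S, ∃ N, s ∈ algClosure (adj F (f '' C N)) := by
      intro s hs
      obtain ⟨t, ht, htf, hst⟩ := exists_finite_mem_algClosure_adj (h hs)
      choose n s' hs' e using fun y : t => ht y.2
      have := htf.to_subtype
      obtain ⟨N, hN⟩ := (Set.finite_range n).bddAbove
      refine ⟨N + 1, algClosure_mono (adj_mono le_rfl fun y hy => ?_) hst⟩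
      refine ⟨f^[n ⟨y, hy⟩] (s' ⟨y, hy⟩), ⟨n ⟨y, hy⟩, Nat.lt_succ_of_le (hN ⟨_, rfl⟩), _,
        hs' _, rfl⟩, ?_⟩
      rw [← Function.iterate_succ_apply' f, e ⟨y, hy⟩]
    choose! N hN using h1
    obtain ⟨B, hB⟩ := (hS.image N).bddAbove
    exact ⟨B, fun s hs => algClosure_mono (adj_mono le_rfl
      (Set.image_mono (hCmono (hB ⟨s, hs, rfl⟩)))) (hN s hs)⟩
  have hsucc (n) (hn : N ≤ n) : C (n + 1) ⊆ M.closure (f '' C n) := by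
    rintro y ⟨k, hk, s, hs, rfl⟩
    rw [← mem_algClosure_adj_iff]
    rcases k with _ | k
    · exact algClosure_mono (adj_mono le_rfl (Set.image_mono (hCmono hn))) (hN hs)
    · refine le_algClosure _ (subset_adj _ _ ⟨f^[k] s, ⟨k, by omega, s, hs, rfl⟩, ?_⟩)
      rw [← Function.iterate_succ_apply' f]
  -- As f maps F into itself, the image of a basis of X still spans f '' X over F; thus f does not
  -- increase transcendence degree.
  have hrk (X : Set Ω) : M.eRk (f '' X) ≤ M.eRk X := by
    obtain ⟨I, hI⟩ := M.exists_isBasis X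
    have h1 : f '' X ⊆ M.closure (f '' I) := by
      rintro _ ⟨x, hx, rfl⟩
      have := hI.subset_closure hx
      rw [← mem_algClosure_adj_iff] at this ⊢
      have := map_mem_algClosure f this
      rw [map_adj] at this
      exact algClosure_mono (adj_mono hF le_rfl) this
    calc M.eRk (f '' X) ≤ M.eRk (M.closure (f '' I)) := M.eRk_mono h1
      _ = M.eRk (f '' I) := M.eRk_closure_eq _
      _ ≤ (f '' I).encard := M.eRk_le_encard _
      _ ≤ I.encard := Set.encard_image_le _ _
      _ = M.eRk X := hI.encard_eq_eRk
  have hle (n) : M.eRk (C (N + n)) ≤ M.eRk (C N) := by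
    induction n with
    | zero => exact le_rfl
    | succ n ih =>
      calc M.eRk (C (N + n + 1)) ≤ M.eRk (M.closure (f '' C (N + n))) :=
            M.eRk_mono (hsucc _ (Nat.le_add_right _ _))
        _ = M.eRk (f '' C (N + n)) := M.eRk_closure_eq _
        _ ≤ M.eRk (C (N + n)) := hrk _
        _ ≤ M.eRk (C N) := ih
  -- The sets C (N + n) increase without gaining rank, and this rank is finite, so all have the same
  -- algebraic closure as C N.
  refine ⟨C N, hCfin N, fun n s hs => ?_⟩
  have h1 := (M.isRkFinite_of_finite (hCfin N)).closure_eq_closure_of_subset_of_eRk_ge_eRk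
    (hCmono (Nat.le_add_right N (n + 1))) (hle (n + 1))
  rw [mem_algClosure_adj_iff]
  change _ ∈ M.closure (C N)
  rw [h1]
  exact M.subset_closure _ (Set.subset_univ _) ⟨n, by omega, s, hs, rfl⟩

end AlgIndep

/-! ### Subfields of a difference field -/

section Twists

variable {Ω : Type u} [Field Ω]

theorem linearIndependent_subfield_iff {K : Subfield Ω} {ι : Type*} [Fintype ι] {a : ι → Ω} :
    LinearIndependent K a ↔ ∀ g : ι → Ω, (∀ i, g i ∈ K) → ∑ i, g i * a i = 0 → ∀ i, g i = 0 := by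
  rw [Fintype.linearIndependent_iff]
  refine ⟨fun h g hg hs i => congrArg Subtype.val (h (fun i => ⟨g i, hg i⟩) ?_ i),
    fun h g hs i => Subtype.ext (h (fun i => g i) (fun i => (g i).2) ?_ i)⟩
  · simpa [Subfield.smul_def] using hs
  · simpa [Subfield.smul_def] using hs

theorem map_subfield_mono {Ω' : Type*} [Field Ω'] {f : Ω →+* Ω'} {D E : Subfield Ω} (h : D ≤ E) :
    D.map f ≤ E.map f := (Subfield.gc_map_comap f).monotone_l h

/-! ### Powers under Frobenius and Mac Lane's criterion -/

section Frobenius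

variable (p : ℕ) [ExpChar Ω p]

/-- The subfield of `p ^ n`-th powers of elements of `D`. -/
def frob (n : ℕ) (D : Subfield Ω) : Subfield Ω := D.map (iterateFrobenius Ω p n)

variable {p}

theorem mem_frob {n : ℕ} {D : Subfield Ω} {x : Ω} : x ∈ frob p n D ↔ ∃ y ∈ D, y ^ p ^ n = x := by
  simp [frob, Subfield.mem_map, iterateFrobenius_def]

theorem pow_mem_frob {n : ℕ} {D : Subfield Ω} {x : Ω} (hx : x ∈ D) : x ^ p ^ n ∈ frob p n D :=
  mem_frob.2 ⟨x, hx, rfl⟩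

theorem frob_le (n : ℕ) (D : Subfield Ω) : frob p n D ≤ D := fun x hx => by
  obtain ⟨y, hy, rfl⟩ := mem_frob.1 hx
  exact pow_mem hy _

theorem frob_mono (n : ℕ) {D E : Subfield Ω} (h : D ≤ E) : frob p n D ≤ frob p n E := fun x hx => by
  obtain ⟨y, hy, rfl⟩ := mem_frob.1 hx
  exact pow_mem_frob (h hy)

variable (p) in
theorem pow_expChar_pow_injective (n : ℕ) : Function.Injective fun x : Ω => x ^ p ^ n := by
  have := (iterateFrobenius Ω p n).injective
  simpa [iterateFrobenius_def, funext_iff, Function.Injective] using this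

theorem sum_pow_expChar_pow {ι : Type*} [Fintype ι] (n : ℕ) (f g : ι → Ω) :
    (∑ i, f i * g i) ^ p ^ n = ∑ i, f i ^ p ^ n * g i ^ p ^ n := by
  simp only [← iterateFrobenius_def, map_sum, map_mul]

theorem le_insepClosure (K : Subfield Ω) : K ≤ insepClosure K := fun x hx =>
  (mem_insepClosure (ringExpChar Ω)).2 ⟨0, by simpa using hx⟩

theorem insepClosure_le_algClosure (K : Subfield Ω) : insepClosure K ≤ algClosure K := fun x hx => by
  obtain ⟨n, hn⟩ := (mem_insepClosure (ringExpChar Ω)).1 hx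
  have : 0 < ringExpChar Ω ^ n := expChar_pow_pos Ω _ n
  exact mem_algClosure.2 ((isAlgebraic_algebraMap (⟨_, hn⟩ : K)).of_pow this)

theorem insepClosure_mono {K L : Subfield Ω} (h : K ≤ L) : insepClosure K ≤ insepClosure L :=
  fun x hx => by
  obtain ⟨n, hn⟩ := (mem_insepClosure (ringExpChar Ω)).1 hx
  exact (mem_insepClosure (ringExpChar Ω)).2 ⟨n, h hn⟩

/-- An element which is both separable and purely inseparable over `K` lies in `K`. -/
theorem mem_of_mem_sepClosure_of_pow_mem {K : Subfield Ω} {x : Ω} (hx : x ∈ sepClosure K) {n : ℕ}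
    (hn : x ^ p ^ n ∈ K) : x ∈ K := by
  have : ExpChar K p := expChar_subfield p K
  have h1 : x ∈ perfectClosure K Ω := (mem_perfectClosure_iff_pow_mem p).2 ⟨n, ⟨_, hn⟩, rfl⟩
  have h2 : x ∈ separableClosure K Ω := mem_separableClosure_iff.2 (mem_sepClosure.1 hx)
  have h3 : x ∈ separableClosure K Ω ⊓ perfectClosure K Ω := ⟨h2, h1⟩
  rw [separableClosure_inf_perfectClosure] at h3
  obtain ⟨y, rfl⟩ := IntermediateField.mem_bot.1 h3
  exact y.2

/-- Separable extensions preserve linear independence over the subfield of `p ^ n`-th powers. -/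
theorem linearlyDisjoint_frob_of_le_sepClosure {K E : Subfield Ω} (hK : K ≤ E)
    (hE : E ≤ sepClosure K) (n : ℕ) : LinearlyDisjoint (frob p n K) K (frob p n E) := by
  refine LinearlyDisjoint.symm ?_ (frob_mono n hK) (frob_le n K)
  have : ExpChar K p := expChar_subfield p K
  intro m a ha hi
  choose b hb hba using fun k => mem_frob.1 (ha k)
  have h1 : LinearIndependent K b := by
    rw [linearIndependent_subfield_iff] at hi ⊢
    intro g hg hs i
    have h2 := congrArg (· ^ p ^ n) hs
    simp only [sum_pow_expChar_pow, hba] at h2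
    rw [zero_pow (expChar_pow_pos Ω p n).ne'] at h2
    have h3 := hi _ (fun i => pow_mem_frob (hg i)) h2 i
    exact pow_eq_zero_iff (expChar_pow_pos Ω p n).ne' |>.1 h3
  have := h1.map_pow_expChar_pow_of_isSeparable' p n fun i => mem_sepClosure.1 (hE (hb i))
  simpa only [hba] using this

/-- Mac Lane's criterion for algebraic extensions. -/
theorem le_sepClosure_of_linearlyDisjoint {K D : Subfield Ω} (hK : K ≤ D)
    (hD : D ≤ algClosure K) (h : LinearlyDisjoint (frob p 1 K) K (frob p 1 D)) :
    D ≤ sepClosure K := by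
  have : ExpChar K p := expChar_subfield p K
  intro x hx
  rw [mem_sepClosure]
  have halg : IsIntegral K x := (mem_algClosure.1 (hD hx)).isIntegral
  have hirr := minpoly.irreducible halg
  obtain hp | ⟨hp⟩ := ‹ExpChar K p›
  · exact hirr.separable
  rcases Polynomial.separable_or p hirr with h1 | ⟨-, g, hg, he⟩
  · exact h1
  exfalso
  -- For an inseparable x the minimal polynomial is g(X^p) with g of smaller degree. The powers of x
  -- up to deg g are independent over K, so their p-th powers are independent over K^p, hence over K
  -- by disjointness. This contradicts g(x^p) = 0.
  have hdeg : (minpoly K x).natDegree = g.natDegree * p := by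
    rw [← he, Polynomial.natDegree_expand]
  have hlt : g.natDegree + 1 ≤ (minpoly K x).natDegree := by
    have := hg.natDegree_pos
    have := hp.two_le
    rw [hdeg]
    nlinarith
  have h1 : LinearIndependent K fun i : Fin (g.natDegree + 1) => x ^ (i : ℕ) :=
    (linearIndependent_pow x).comp (Fin.castLE hlt) (Fin.castLE_injective hlt)
  have h2 : LinearIndependent (frob p 1 K) fun i : Fin (g.natDegree + 1) =>
      (x ^ (i : ℕ)) ^ p ^ 1 := by
    rw [linearIndependent_subfield_iff] at h1 ⊢
    intro c hc hs i
    choose b hb hbc using fun k => mem_frob.1 (hc k)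
    simp only [← hbc, ← sum_pow_expChar_pow] at hs ⊢
    rw [h1 b hb (pow_expChar_pow_injective p 1 (hs.trans ?_)) i]
    · exact zero_pow (by have := hp.pos; positivity)
    · exact (zero_pow (by have := hp.pos; positivity)).symm
  have h3 := (h.symm (frob_le 1 K) (frob_mono 1 hK)) _ _
    (fun i => pow_mem_frob (pow_mem hx _)) h2
  have h4 := Fintype.linearIndependent_iff.1 h3 (fun i => g.coeff i) (by
    have h5 : Polynomial.aeval (x ^ p) g = 0 := by
      rw [← Polynomial.expand_aeval, he, minpoly.aeval]
    rw [Polynomial.aeval_eq_sum_range, Finset.sum_range] at h5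
    rw [← h5]
    refine Finset.sum_congr rfl fun i _ => ?_
    rw [pow_one, ← pow_mul, ← pow_mul, mul_comm]) (Fin.last _)
  exact hg.ne_zero (Polynomial.leadingCoeff_eq_zero.1 h4)

end Frobenius

theorem pow_expChar_pow_eq_zero {x : Ω} {n : ℕ} (h : x ^ (ringExpChar Ω) ^ n = 0) : x = 0 :=
  (pow_eq_zero_iff (expChar_pow_pos Ω _ n).ne').1 h

theorem zero_pow_expChar_pow (n : ℕ) : (0 : Ω) ^ (ringExpChar Ω) ^ n = 0 :=
  zero_pow (expChar_pow_pos Ω _ n).ne'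

variable [DifferenceField Ω]

/-- The subfield of all `p ^ n`-th roots of elements of `σ D`. -/
def tw (D : Subfield Ω) : Subfield Ω := insepClosure (D.map σ)

/-- A subfield `D` is closed under twists if `σ x` has all `p ^ n`-th roots in `D`, for `x ∈ D`. -/
def TwistClosed (D : Subfield Ω) : Prop :=
  ∀ x ∈ D, ∀ n : ℕ, ∃ y ∈ D, y ^ ringExpChar Ω ^ n = σ x

/-- The difference subfield `D` is transformally separable over `K`. -/
def TransSep (K D : Subfield Ω) : Prop := LinearlyDisjoint (K.map σ) K (D.map σ)

/-- A subfield which is a model of FE. -/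
structure ModelSubfield (D : Subfield Ω) : Prop where
  twistClosed : TwistClosed D
  primary : ∀ x ∈ D, x ∈ sepClosure (D.map σ) → x ∈ D.map σ

theorem TransSep.mono {K D D' : Subfield Ω} (h : TransSep K D) (hD : D' ≤ D) : TransSep K D' :=
  LinearlyDisjoint.mono h le_rfl (map_subfield_mono hD)

/-- The characteristic exponent. -/
local notation "𝔭" => ringExpChar Ω

theorem mem_tw {D : Subfield Ω} {x : Ω} : x ∈ tw D ↔ ∃ n, ∃ d ∈ D, x ^ 𝔭 ^ n = σ d := by
  rw [tw, mem_insepClosure 𝔭]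
  simp only [Subfield.mem_map]
  exact exists_congr fun n => exists_congr fun d => and_congr_right fun _ => eq_comm

theorem map_le_tw (D : Subfield Ω) : D.map σ ≤ tw D := le_insepClosure _

theorem tw_mono {D E : Subfield Ω} (h : D ≤ E) : tw D ≤ tw E :=
  insepClosure_mono (map_subfield_mono h)

theorem tw_le_algClosure (D : Subfield Ω) : tw D ≤ algClosure (D.map σ) :=
  insepClosure_le_algClosure _

theorem TwistClosed.tw_le {D : Subfield Ω} (h : TwistClosed D) : tw D ≤ D := fun x hx => by
  obtain ⟨n, d, hd, hx⟩ := mem_tw.1 hx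
  obtain ⟨y, hy, hyd⟩ := h d hd n
  rwa [pow_expChar_pow_injective 𝔭 n (hx.trans hyd.symm)]

theorem TwistClosed.map_le {D : Subfield Ω} (h : TwistClosed D) : D.map σ ≤ D :=
  (map_le_tw D).trans h.tw_le

/-- If x^(p^m) = σ d, the p^(n+m)-th root of σ d in D is the p^n-th root of x. So `tw D` is perfect.
-/
theorem TwistClosed.exists_root {D : Subfield Ω} (h : TwistClosed D) {x : Ω} (hx : x ∈ tw D)
    (n : ℕ) : ∃ y ∈ tw D, y ^ 𝔭 ^ n = x := by
  obtain ⟨m, d, hd, hx⟩ := mem_tw.1 hx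
  obtain ⟨y, hy, hyd⟩ := h d hd (n + m)
  refine ⟨y, mem_tw.2 ⟨n + m, d, hd, hyd⟩, pow_expChar_pow_injective 𝔭 m ?_⟩
  change (y ^ 𝔭 ^ n) ^ 𝔭 ^ m = x ^ 𝔭 ^ m
  rw [hx, ← hyd, ← pow_mul, pow_add]

theorem TwistClosed.perfectField {D : Subfield Ω} (h : TwistClosed D) : PerfectField (tw D) := by
  have : ExpChar (tw D) 𝔭 := expChar_subfield 𝔭 _
  have : PerfectRing (tw D) 𝔭 := PerfectRing.ofSurjective _ _ fun x => by
    obtain ⟨y, hy, hyx⟩ := h.exists_root x.2 1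
    exact ⟨⟨y, hy⟩, Subtype.ext (by simpa [frobenius_def] using hyx)⟩
  exact PerfectRing.toPerfectField _ 𝔭

theorem TwistClosed.tw_le_frob {D : Subfield Ω} (h : TwistClosed D) (n : ℕ) :
    tw D ≤ frob 𝔭 n (tw D) := fun _ hx => mem_frob.2 (h.exists_root hx n)

/-- Some p^n-th power of x is separable over σ(D), hence lies in it by primarity. The perfect field
`tw D` is thus relatively algebraically closed in D, as the tensor product arguments require. -/
theorem ModelSubfield.mem_tw_of_mem_algClosure {D : Subfield Ω} (h : ModelSubfield D) {x : Ω}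
    (hx : x ∈ D) (ha : x ∈ algClosure (tw D)) : x ∈ tw D := by
  obtain ⟨n, hn⟩ := exists_pow_mem_sepClosure 𝔭 (algClosure_le (tw_le_algClosure D) ha)
  obtain ⟨d, hd, hdx⟩ := Subfield.mem_map.1 (h.primary _ (pow_mem hx _) hn)
  exact mem_tw.2 ⟨n, d, hd, hdx.symm⟩

theorem exists_common_exponent {ι : Type*} [Finite ι] {D : Subfield Ω}
    {c : ι → Ω} (hc : ∀ i, c i ∈ tw D) :
    ∃ n, ∃ d : ι → Ω, ∀ i, d i ∈ D ∧ c i ^ 𝔭 ^ n = σ (d i) := by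
  have := Fintype.ofFinite ι
  choose n d hd hcd using fun i => mem_tw.1 (hc i)
  refine ⟨∑ i, n i, fun i => d i ^ 𝔭 ^ (∑ i, n i - n i), fun i => ⟨pow_mem (hd i) _, ?_⟩⟩
  rw [map_pow, ← hcd, ← pow_mul, ← pow_add, Nat.add_sub_cancel' (Finset.single_le_sum
    (fun _ _ => Nat.zero_le _) (Finset.mem_univ i))]

theorem sigma_eq_zero_iff {x : Ω} : σ x = 0 ↔ x = 0 := map_eq_zero σ

/-- Transformal separability contains Mac Lane's condition. Let b k be the p^n-th root of σ (a k),
which is in F. Applying σ to a relation between the a k with coefficients d k ^ p^n and extracting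
p^n-th roots gives ∑ σ (d k) * b k = 0. -/
theorem TransSep.linearlyDisjoint_frob {F D : Subfield Ω} (h : TransSep F D) (hF : TwistClosed F) (n : ℕ) :
    LinearlyDisjoint (frob 𝔭 n F) F (frob 𝔭 n D) := by
  rw [linearlyDisjoint_iff_sum]
  intro m a c ha hc hi hs
  choose d hd hdc using fun k => mem_frob.1 (hc k)
  choose b hb hba using fun k => hF (a k) (ha k) n
  have h1 : LinearIndependent (F.map σ) b := by
    rw [linearIndependent_subfield_iff] at hi ⊢
    intro g hg hs' i
    choose f hf hfg using fun k => Subfield.mem_map.1 (hg k)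
    have h2 := congrArg (· ^ 𝔭 ^ n) hs'
    simp only [sum_pow_expChar_pow, zero_pow_expChar_pow, hba, ← hfg, ← map_pow, ← map_mul,
      ← map_sum, sigma_eq_zero_iff] at h2
    rw [← hfg, pow_expChar_pow_eq_zero (hi _ (fun i => pow_mem_frob (hf i)) h2 i), map_zero]
  intro k
  rw [TransSep, linearlyDisjoint_iff_sum] at h
  have h3 := h m b (fun k => σ (d k)) hb (fun k => Subfield.mem_map.2 ⟨_, hd k, rfl⟩) h1
    (pow_expChar_pow_injective 𝔭 n (by
      simp only [sum_pow_expChar_pow, zero_pow_expChar_pow, hba]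
      simp only [← map_pow, hdc, ← map_mul, ← map_sum, hs, map_zero])) k
  rw [← hdc, sigma_eq_zero_iff.1 h3, zero_pow_expChar_pow]

/-- A common power p^n moves the coefficients from `tw D` into σ(D). Independence of the a k over
`tw F` gives independence of their powers over σ(F), because elements of σ(F) have p^n-th roots in
`tw F`. -/
theorem TransSep.linearlyDisjoint_tw {F D : Subfield Ω} (h : TransSep F D) (hF : TwistClosed F) :
    LinearlyDisjoint (tw F) F (tw D) := by
  rw [linearlyDisjoint_iff_sum]
  intro m a c ha hc hi hs
  obtain ⟨n, d, hd⟩ := exists_common_exponent hc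
  have h1 : LinearIndependent (F.map σ) fun k => a k ^ 𝔭 ^ n := by
    rw [linearIndependent_subfield_iff] at hi ⊢
    intro g hg hs' i
    choose f hf hfg using fun k => Subfield.mem_map.1 (hg k)
    choose b hb hbf using fun k => hF (f k) (hf k) n
    simp only [← hfg, ← hbf, ← sum_pow_expChar_pow] at hs' ⊢
    rw [hi b (fun k => mem_tw.2 ⟨n, f k, hf k, hbf k⟩) (pow_expChar_pow_eq_zero hs') i,
      zero_pow_expChar_pow]
  intro k
  rw [TransSep, linearlyDisjoint_iff_sum] at h
  have h3 := h m (fun k => a k ^ 𝔭 ^ n) (fun k => σ (d k)) (fun k => pow_mem (ha k) _)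
    (fun k => Subfield.mem_map.2 ⟨_, (hd k).1, rfl⟩) h1 (by
      simp only [← (hd _).2, ← sum_pow_expChar_pow, hs, zero_pow_expChar_pow]) k
  rw [← (hd k).2] at h3
  exact pow_expChar_pow_eq_zero h3

/-- A criterion for transformal separability. -/
theorem transSep_of_frob_of_tw {D E : Subfield Ω} (hDE : D ≤ E) (hD : TwistClosed D)
    (h : ∀ n, LinearlyDisjoint (frob 𝔭 n D) D (frob 𝔭 n E))
    (h' : LinearlyDisjoint (tw D) D (tw E)) : TransSep D E := by
  -- The Frobenius hypothesis read through σ: the p^n-th powers of the t k are σ (d k), so a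
  -- relation among the t k over σ(E) becomes, after p^n-th powers, the image under σ of one among
  -- the d k.
  have h1 : LinearlyDisjoint (D.map σ) (tw D) (E.map σ) := by
    rw [linearlyDisjoint_iff_sum]
    intro m t c ht hc hi hs
    choose e he hec using fun k => Subfield.mem_map.1 (hc k)
    obtain ⟨n, d, hd⟩ := exists_common_exponent ht
    have h2 : LinearIndependent (frob 𝔭 n D) d := by
      rw [linearIndependent_subfield_iff] at hi ⊢
      intro g hg hs' i
      choose f hf hfg using fun k => mem_frob.1 (hg k)
      have h3 := hi (fun k => σ (f k)) (fun k => Subfield.mem_map.2 ⟨_, hf k, rfl⟩)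
        (pow_expChar_pow_eq_zero (n := n) (by
          simp only [sum_pow_expChar_pow, (hd _).2]
          simp only [← map_pow, hfg, ← map_mul, ← map_sum, hs', map_zero])) i
      rw [← hfg, sigma_eq_zero_iff.1 h3, zero_pow_expChar_pow]
    have h4 := linearlyDisjoint_iff_sum.1 (h n) m d (fun k => e k ^ 𝔭 ^ n) (fun k => (hd k).1)
      (fun k => pow_mem_frob (he k)) h2 (by
        rw [← sigma_eq_zero_iff, map_sum]
        simp only [map_mul, ← (hd _).2, map_pow, hec, ← sum_pow_expChar_pow, hs,
          zero_pow_expChar_pow])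
    intro k
    rw [← hec, pow_expChar_pow_eq_zero (h4 k), map_zero]
  -- The two disjointness statements are chained along σ(D) ≤ `tw D` ≤ D.
  have h5 : LinearlyDisjoint (D.map σ) (E.map σ) D := by
    refine LinearlyDisjoint.trans (B' := tw D)
      (h1.symm (map_le_tw D) (map_subfield_mono hDE)) ?_
    exact (h'.symm hD.tw_le (tw_mono hDE)).mono (sup_le (map_le_tw E) (tw_mono hDE)) le_rfl
  exact h5.symm (map_subfield_mono hDE) hD.map_le

/-- A criterion for transformal separability of extensions that are separable over `D ⊔ tw E`. -/
theorem transSep_of_le_sepClosure {D E : Subfield Ω} (hDE : D ≤ E) (hD : TwistClosed D)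
    (hE : TwistClosed E) (h : LinearlyDisjoint (tw D) D (tw E))
    (hsep : E ≤ sepClosure (D ⊔ tw E)) : TransSep D E := by
  refine transSep_of_frob_of_tw hDE hD (fun n => ?_) h
  have hK : D ⊔ tw E ≤ E := sup_le hDE hE.tw_le
  have h1 := linearlyDisjoint_frob_of_le_sepClosure (p := 𝔭) hK hsep n
  -- Since `tw D` is perfect it is contained in D^(p^n), so the hypothesis on `tw E` can be base
  -- changed to D^(p^n).
  have h2 : LinearlyDisjoint (frob 𝔭 n D) (tw E ⊔ frob 𝔭 n D) D :=
    LinearlyDisjoint.sup (h.symm hD.tw_le (tw_mono hDE)) (tw_mono hDE)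
      ((hD.tw_le_frob n).trans (frob_mono n hD.tw_le)) (frob_le n D)
  have h3 : frob 𝔭 n (D ⊔ tw E) ≤ tw E ⊔ frob 𝔭 n D := by
    rw [frob, Subfield.map_sup]
    exact sup_le le_sup_right ((frob_le n _).trans le_sup_left)
  -- From D to the powers of `D ⊔ tw E` disjointness comes from h2; from there to the powers of E it
  -- comes from separability.
  refine LinearlyDisjoint.trans (B' := frob 𝔭 n (D ⊔ tw E))
    ((h2.symm le_sup_right (frob_le n D)).mono le_rfl h3) (h1.mono ?_ le_rfl)
  exact sup_le le_sup_left (frob_le n _)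

theorem TransSep.sup_linearlyDisjoint_frob {F D : Subfield Ω} (h : TransSep F D)
    (hF : TwistClosed F) {K : Subfield Ω} (hFK : F ≤ K) (hKD : K ≤ D) (n : ℕ) :
    LinearlyDisjoint (frob 𝔭 n K) (F ⊔ frob 𝔭 n K) (frob 𝔭 n D) :=
  (h.linearlyDisjoint_frob hF n).sup (frob_le n F) (frob_mono n hFK) (frob_mono n hKD)

/-- An extension of finite transcendence degree which is transformally separable over `F` is
separable over `F ⊔ tw D`. -/
theorem TransSep.le_sepClosure {F D : Subfield Ω} (h : TransSep F D) (hFD : F ≤ D)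
    (hF : TwistClosed F) (hD : TwistClosed D) {w : Set Ω} (hw : w.Finite)
    (hDw : D ≤ algClosure (adj F w)) : D ≤ sepClosure (F ⊔ tw D) := by
  obtain ⟨u, huD, hu, hui, hDu⟩ := exists_finite_algIndep hw hDw
  -- A priori σ(u) is independent over σ(F); transformal separability raises this to F.
  have hσu : AlgIndep F (σ '' u) := by
    refine LinearlyDisjoint.algIndep (B := D.map σ) ?_ ?_ ((algIndep_map σ).2 hui)
    · exact LinearlyDisjoint.symm h hF.map_le (map_subfield_mono hFD)
    · rintro _ ⟨x, hx, rfl⟩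
      exact Subfield.mem_map.2 ⟨x, huD hx, rfl⟩
  -- σ(u) is independent over F, lies in D and has as many elements as u, so it is again a
  -- transcendence basis. Therefore D is algebraic over `F ⊔ tw D`.
  have hex := hσu.exchange hu (fun x hx => ?_)
    (Function.Injective.encard_image σ.injective u).ge
  swap
  · obtain ⟨y, hy, rfl⟩ := hx
    exact hDu (hD.map_le (Subfield.mem_map.2 ⟨y, huD hy, rfl⟩))
  have hK : F ⊔ tw D ≤ D := sup_le hFD hD.tw_le
  have hσuK : adj F (σ '' u) ≤ F ⊔ tw D := by
    refine adj_le le_sup_left ?_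
    rintro _ ⟨x, hx, rfl⟩
    exact le_sup_right (a := F) (map_le_tw D (Subfield.mem_map.2 ⟨x, huD hx, rfl⟩))
  have hDa : D ≤ algClosure (F ⊔ tw D) := by
    have h1 : D ≤ algClosure (adj F (σ '' u)) := fun x hx =>
      algClosure_le (adj_le ((le_adj _ _).trans (le_algClosure _)) hex.2) (hDu hx)
    exact h1.trans (algClosure_mono hσuK)
  refine le_sepClosure_of_linearlyDisjoint (p := 𝔭) hK hDa ?_
  -- Write K for `F ⊔ tw D`. Since `tw D` is perfect, K ≤ F·K^p, and disjointness of F·K^p from D^p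
  -- over K^p is Mac Lane's condition for D/K.
  refine (h.sup_linearlyDisjoint_frob hF le_sup_left hK 1).mono (sup_le le_sup_left ?_) le_rfl
  exact (hD.tw_le_frob 1).trans ((frob_mono 1 le_sup_right).trans le_sup_right)

/-- A converse: if `D` has finite transcendence degree over the model `F` and is separable over
`F ⊔ tw D`, then it is transformally separable. -/
theorem ModelSubfield.transSep_of_le_sepClosure {F D : Subfield Ω} (hF : ModelSubfield F)
    (hFD : F ≤ D) (hD : TwistClosed D) {w : Set Ω} (hw : w.Finite)
    (hDw : D ≤ algClosure (adj F w)) (hsep : D ≤ sepClosure (F ⊔ tw D)) : TransSep F D := by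
  obtain ⟨u, huD, hu, hui, hDu⟩ := exists_finite_algIndep hw hDw
  have hσD : tw D ≤ algClosure (adj (F.map σ) (σ '' u)) := by
    refine (tw_le_algClosure D).trans (algClosure_le ?_)
    rintro _ ⟨x, hx, rfl⟩
    have := map_mem_algClosure σ (hDu hx)
    rwa [map_adj] at this
  -- u is algebraic over `F ⊔ tw D`, hence over F(σ(u)). As σ(u) has no more elements than u,
  -- exchange forces it to be independent.
  have hσu : AlgIndep F (σ '' u) := by
    refine (hui.exchange (hu.image σ) (fun x hx => ?_) (Set.encard_image_le _ _)).1
    refine algClosure_le ?_ (sepClosure_le_algClosure _ (hsep (huD hx)))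
    refine sup_le ((le_adj _ _).trans (le_algClosure _)) (hσD.trans ?_)
    exact algClosure_mono (adj_mono hF.twistClosed.map_le le_rfl)
  have hT := hF.twistClosed.perfectField
  have h1 : LinearlyDisjoint (tw F) F (adj (tw F) (σ '' u)) :=
    AlgIndep.linearlyDisjoint hF.twistClosed.tw_le hσu
  -- `tw D` is algebraic over (`tw F`)(σ(u)), from which F is disjoint; primarity of F extends the
  -- disjointness.
  have h2 : LinearlyDisjoint (tw F) F (tw D) := by
    refine LinearlyDisjoint.of_algClosure h1 hF.twistClosed.tw_le le_rfl (le_adj _ _)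
      (adj_le (tw_mono hFD) ?_) (fun x hx ha => hF.mem_tw_of_mem_algClosure hx ha)
      (le_algClosure _) (hσD.trans (algClosure_mono (adj_mono (map_le_tw F) le_rfl)))
    rintro _ ⟨x, hx, rfl⟩
    exact map_le_tw D (Subfield.mem_map.2 ⟨x, huD hx, rfl⟩)
  exact FE.transSep_of_le_sepClosure hFD hF.twistClosed hD h2 hsep

/-- An element of M is separable over F·M^(p^n), and its p^n-th power lies there, so M ≤ F·M^(p^n).
This yields the Frobenius condition over M. The condition on `tw E` passes from `F ⊔ tw M` to its
algebraic extension M, because `tw M` is perfect and relatively algebraically closed in M. -/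
theorem TransSep.of_le_sepClosure {F M E : Subfield Ω} (h : TransSep F E) (hF : ModelSubfield F)
    (hM : ModelSubfield M) (hFM : F ≤ M) (hME : M ≤ E)
    (hsep : M ≤ sepClosure (F ⊔ tw M)) : TransSep M E := by
  have hK : F ⊔ tw M ≤ M := sup_le hFM hM.twistClosed.tw_le
  have hT := hM.twistClosed.perfectField
  refine transSep_of_frob_of_tw hME hM.twistClosed (fun n => ?_) ?_
  · refine (h.sup_linearlyDisjoint_frob hF.twistClosed hFM hME n).mono (fun x hx => ?_) le_rfl
    refine mem_of_mem_sepClosure_of_pow_mem (p := 𝔭) (n := n) (sepClosure_mono ?_ (hsep hx))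
      (le_sup_right (a := F) (pow_mem_frob hx))
    refine sup_le_sup_left ?_ F
    exact (hM.twistClosed.tw_le_frob n).trans (frob_mono n hM.twistClosed.tw_le)
  · have h1 := (h.linearlyDisjoint_tw hF.twistClosed).sup hF.twistClosed.tw_le (tw_mono hFM)
      (tw_mono hME)
    exact LinearlyDisjoint.of_algClosure h1 le_sup_right hK (tw_mono hME) le_rfl
      (fun x hx ha => hM.mem_tw_of_mem_algClosure hx ha)
      (hsep.trans (sepClosure_le_algClosure _)) (le_algClosure _)

theorem TransSep.trans {F M E : Subfield Ω} (h : TransSep F M) (h' : TransSep M E) (hFM : F ≤ M)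
    (hM : M.map σ ≤ M) : TransSep F E :=
  LinearlyDisjoint.trans h (LinearlyDisjoint.mono h' (sup_le hFM hM) le_rfl)

end Twists

/-! ### Twisted generation and the closure under simple roots -/

section SimpleRoots

variable {Ω : Type u} [Field Ω] [DifferenceField Ω]

/-- The characteristic exponent. -/
local notation "𝔭" => ringExpChar Ω

/-- The elements `s ^ (σ ^ (n + 1) / p ^ m)` with `s ∈ S`. -/
def twistRoots (S : Set Ω) : Set Ω := {y | ∃ s ∈ S, ∃ n m : ℕ, y ^ 𝔭 ^ m = σ^[n + 1] s}

/-- The subfield generated by `F`, the elements of `S` and their twists. -/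
def twAdj (F : Subfield Ω) (S : Set Ω) : Subfield Ω := adj F (S ∪ twistRoots S)

theorem twistRoots_mono {S T : Set Ω} (h : S ⊆ T) : twistRoots S ⊆ twistRoots T :=
  fun _ ⟨s, hs, n, m, e⟩ => ⟨s, h hs, n, m, e⟩

theorem le_twAdj (F : Subfield Ω) (S : Set Ω) : F ≤ twAdj F S := le_adj _ _

theorem subset_twAdj (F : Subfield Ω) (S : Set Ω) : S ⊆ twAdj F S :=
  Set.subset_union_left.trans (subset_adj _ _)

theorem adj_twistRoots_le_twAdj (F : Subfield Ω) (S : Set Ω) : adj F (twistRoots S) ≤ twAdj F S :=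
  adj_mono le_rfl Set.subset_union_right

theorem twAdj_eq_adj_adj (F : Subfield Ω) (S : Set Ω) :
    twAdj F S = adj (adj F (twistRoots S)) S := by
  rw [adj_adj, Set.union_comm, twAdj]

theorem iterate_mem {D : Subfield Ω} (hD : D.map σ ≤ D) {x : Ω} (hx : x ∈ D) (n : ℕ) :
    σ^[n] x ∈ D := by
  induction n with
  | zero => exact hx
  | succ n ih =>
    rw [Function.iterate_succ_apply']
    exact hD (Subfield.mem_map.2 ⟨_, ih, rfl⟩)

theorem iterate_succ_mem_map {D : Subfield Ω} (hD : D.map σ ≤ D) {x : Ω} (hx : x ∈ D) (n : ℕ) :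
    σ^[n + 1] x ∈ D.map σ := by
  rw [Function.iterate_succ_apply']
  exact Subfield.mem_map.2 ⟨_, iterate_mem hD hx n, rfl⟩

theorem twistRoots_subset_tw {D : Subfield Ω} (hD : D.map σ ≤ D) {S : Set Ω} (hS : S ⊆ D) :
    twistRoots S ⊆ tw D := by
  rintro y ⟨s, hs, n, m, e⟩
  refine (mem_insepClosure 𝔭).2 ⟨m, ?_⟩
  rw [e]
  exact iterate_succ_mem_map hD (hS hs) n

theorem TwistClosed.twAdj_le {F D : Subfield Ω} (hD : TwistClosed D) (hF : F ≤ D) {S : Set Ω}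
    (hS : S ⊆ D) : twAdj F S ≤ D :=
  adj_le hF (Set.union_subset hS ((twistRoots_subset_tw hD.map_le hS).trans hD.tw_le))

/-- It suffices to treat generators. σ raises the degree in σ to at least one, so all roots of the
image are twists; the elements of S themselves are not needed. -/
theorem exists_root_of_mem_twAdj (hΩ : TwistClosed (⊤ : Subfield Ω)) {F : Subfield Ω}
    (hF : TwistClosed F) {S : Set Ω} {x : Ω} (hx : x ∈ twAdj F S) (n : ℕ) :
    ∃ y ∈ adj F (twistRoots S), y ^ 𝔭 ^ n = σ x := by
  have h1 : twAdj F S ≤ (frob 𝔭 n (adj F (twistRoots S))).comap σ := by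
    have key (x : Ω) (s : Ω) (hs : s ∈ S) (k m : ℕ) (e : x ^ 𝔭 ^ m = σ^[k] s) :
        ∃ y ∈ adj F (twistRoots S), y ^ 𝔭 ^ n = σ x := by
      obtain ⟨y, -, hy⟩ := hΩ x trivial n
      refine ⟨y, subset_adj _ _ ⟨s, hs, k, n + m, ?_⟩, hy⟩
      rw [pow_add, pow_mul, hy, ← map_pow, e, ← Function.iterate_succ_apply' (σ : Ω →+* Ω)]
    refine adj_le (fun x hx => ?_) ?_
    · obtain ⟨y, hy, e⟩ := hF x hx n
      exact mem_frob.2 ⟨y, le_adj _ _ hy, e⟩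
    · rintro x (hx | ⟨s, hs, k, m, e⟩)
      · exact mem_frob.2 (key x x hx 0 0 (by simp))
      · exact mem_frob.2 (key x s hs (k + 1) m e)
  exact mem_frob.1 (h1 hx)

theorem twistClosed_twAdj (hΩ : TwistClosed (⊤ : Subfield Ω)) {F : Subfield Ω}
    (hF : TwistClosed F) (S : Set Ω) : TwistClosed (twAdj F S) := fun _ hx n => by
  obtain ⟨y, hy, e⟩ := exists_root_of_mem_twAdj hΩ hF hx n
  exact ⟨y, adj_twistRoots_le_twAdj F S hy, e⟩

theorem tw_twAdj_le (hΩ : TwistClosed (⊤ : Subfield Ω)) {F : Subfield Ω} (hF : TwistClosed F)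
    (S : Set Ω) : tw (twAdj F S) ≤ adj F (twistRoots S) := fun x hx => by
  obtain ⟨n, d, hd, hx⟩ := mem_tw.1 hx
  obtain ⟨y, hy, e⟩ := exists_root_of_mem_twAdj hΩ hF hd n
  rwa [pow_expChar_pow_injective 𝔭 n (hx.trans e.symm)]

/-- This identifies separability over one's own twists with separability over `F ⊔ tw D`, the form
in the criteria for transformal separability. -/
theorem adj_twistRoots_eq (hΩ : TwistClosed (⊤ : Subfield Ω)) {F : Subfield Ω}
    (hF : TwistClosed F) (S : Set Ω) : adj F (twistRoots S) = F ⊔ tw (twAdj F S) := by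
  refine le_antisymm (adj_le le_sup_left ?_) (sup_le (le_adj _ _) (tw_twAdj_le hΩ hF S))
  exact (twistRoots_subset_tw (twistClosed_twAdj hΩ hF S).map_le (subset_twAdj F S)).trans
    (le_sup_right (a := F) (b := tw _))

theorem twistRoots_subset_algClosure (F : Subfield Ω) (S : Set Ω) :
    twistRoots S ⊆ algClosure (adj F {y | ∃ n, ∃ s ∈ S, σ^[n + 1] s = y}) := by
  rintro y ⟨s, hs, n, m, e⟩
  refine insepClosure_le_algClosure _ ((mem_insepClosure 𝔭).2 ⟨m, ?_⟩)
  rw [e]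
  exact subset_adj _ _ ⟨n, s, hs, rfl⟩

/-- A set of elements that are algebraic over their twists generates a difference field of finite
transcendence degree. -/
theorem exists_finite_twAdj_le_algClosure {F : Subfield Ω} (hF : F.map σ ≤ F) {S : Set Ω}
    (hS : S.Finite) (h : S ⊆ algClosure (adj F (twistRoots S))) :
    ∃ w : Set Ω, w.Finite ∧ twAdj F S ≤ algClosure (adj F w) := by
  obtain ⟨w, hw, hwS⟩ := exists_finite_of_mem_algClosure_translates σ hF hS
    (h.trans (algClosure_le (adj_le ((le_adj _ _).trans (le_algClosure _))
      (twistRoots_subset_algClosure F S))))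
  refine ⟨w, hw, adj_le ((le_adj _ _).trans (le_algClosure _)) (Set.union_subset
    (fun s hs => hwS 0 s hs) ((twistRoots_subset_algClosure F S).trans (algClosure_le
      (adj_le ((le_adj _ _).trans (le_algClosure _)) ?_))))⟩
  rintro _ ⟨n, s, hs, rfl⟩
  exact hwS (n + 1) s hs

/-- The elements of `Ω` that are separable over their twists: the simple roots of twisted
difference polynomials over `F`. -/
def simpleRoots (F : Subfield Ω) : Set Ω := {a | a ∈ sepClosure (adj F (twistRoots {a}))}

theorem mem_simpleRoots {F : Subfield Ω} {a : Ω} :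
    a ∈ simpleRoots F ↔ a ∈ sepClosure (adj F (twistRoots {a})) := by
  rw [simpleRoots, Set.mem_ofPred_eq]

theorem subset_simpleRoots (F : Subfield Ω) : (F : Set Ω) ⊆ simpleRoots F := fun _ hx =>
  mem_simpleRoots.2 (le_sepClosure _ (le_adj _ _ hx))

theorem mem_simpleRoots_of_transSep (hΩ : TwistClosed (⊤ : Subfield Ω)) {F : Subfield Ω}
    (hF : TwistClosed F) {a : Ω} (h : TransSep F (twAdj F {a})) {w : Set Ω} (hw : w.Finite)
    (haw : twAdj F {a} ≤ algClosure (adj F w)) : a ∈ simpleRoots F := by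
  have := h.le_sepClosure (le_twAdj F {a}) hF (twistClosed_twAdj hΩ hF {a}) hw haw
  rw [← adj_twistRoots_eq hΩ hF] at this
  exact mem_simpleRoots.2 (this (subset_twAdj F {a} rfl))

/-- A finite set of elements that are separable over their twists generates a transformally
separable extension of finite transcendence degree, consisting of simple roots. -/
theorem ModelSubfield.twAdj_finite (hΩ : TwistClosed (⊤ : Subfield Ω)) {F : Subfield Ω}
    (hF : ModelSubfield F) {S : Set Ω} (hS : S.Finite)
    (h : S ⊆ sepClosure (adj F (twistRoots S))) :
    TransSep F (twAdj F S) ∧ (∃ w : Set Ω, w.Finite ∧ twAdj F S ≤ algClosure (adj F w)) ∧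
      (twAdj F S : Set Ω) ⊆ simpleRoots F := by
  obtain ⟨w, hw, hSw⟩ := exists_finite_twAdj_le_algClosure hF.twistClosed.map_le hS
    (h.trans (sepClosure_le_algClosure _))
  have h1 : TransSep F (twAdj F S) := by
    refine hF.transSep_of_le_sepClosure (le_twAdj F S) (twistClosed_twAdj hΩ hF.twistClosed S)
      hw hSw ?_
    rw [← adj_twistRoots_eq hΩ hF.twistClosed]
    exact adj_le ((le_adj _ _).trans (le_sepClosure _)) (Set.union_subset h
      ((subset_adj _ _).trans (le_sepClosure _)))
  refine ⟨h1, ⟨w, hw, hSw⟩, fun a ha => ?_⟩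
  have h2 : twAdj F {a} ≤ twAdj F S :=
    (twistClosed_twAdj hΩ hF.twistClosed S).twAdj_le (le_twAdj F S) (by simpa using ha)
  exact mem_simpleRoots_of_transSep hΩ hF.twistClosed (h1.mono h2) hw (h2.trans hSw)

theorem ModelSubfield.twAdj_of_subset_simpleRoots (hΩ : TwistClosed (⊤ : Subfield Ω))
    {F : Subfield Ω} (hF : ModelSubfield F) {S : Set Ω} (hS : S.Finite) (h : S ⊆ simpleRoots F) :
    TransSep F (twAdj F S) ∧ (∃ w : Set Ω, w.Finite ∧ twAdj F S ≤ algClosure (adj F w)) ∧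
      (twAdj F S : Set Ω) ⊆ simpleRoots F :=
  hF.twAdj_finite hΩ hS fun _ ha => sepClosure_mono
    (adj_mono le_rfl (twistRoots_mono (Set.singleton_subset_iff.2 ha))) (mem_simpleRoots.1 (h ha))

/-- The subfield of simple roots. -/
def ModelSubfield.simpleClosure (hΩ : TwistClosed (⊤ : Subfield Ω)) {F : Subfield Ω}
    (hF : ModelSubfield F) : Subfield Ω :=
  -- Sums, products and inverses of a and b lie in the field generated by {a, b} and its twists,
  -- which consists of simple roots.
  have key {a b c : Ω} (ha : a ∈ simpleRoots F) (hb : b ∈ simpleRoots F)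
      (hc : c ∈ twAdj F {a, b}) : c ∈ simpleRoots F :=
    (hF.twAdj_of_subset_simpleRoots hΩ (Set.toFinite {a, b})
      (Set.insert_subset ha (Set.singleton_subset_iff.2 hb))).2.2 hc
  have h1 (a b : Ω) : a ∈ twAdj F {a, b} := subset_twAdj F _ (by simp)
  have h2 (a b : Ω) : b ∈ twAdj F {a, b} := subset_twAdj F _ (by simp)
  have h3 : (F : Set Ω) ⊆ simpleRoots F := subset_simpleRoots F
  { carrier := simpleRoots F
    zero_mem' := h3 F.zero_mem
    one_mem' := h3 F.one_mem
    add_mem' := fun {a b} ha hb => key ha hb (add_mem (h1 a b) (h2 a b))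
    mul_mem' := fun {a b} ha hb => key ha hb (mul_mem (h1 a b) (h2 a b))
    neg_mem' := fun ha => key ha ha (neg_mem (h1 _ _))
    inv_mem' := fun _ ha => key ha ha (inv_mem (h1 _ _)) }

theorem ModelSubfield.mem_simpleClosure (hΩ : TwistClosed (⊤ : Subfield Ω)) {F : Subfield Ω}
    (hF : ModelSubfield F) {x : Ω} :
    x ∈ hF.simpleClosure hΩ ↔ x ∈ simpleRoots F := Iff.rfl

theorem ModelSubfield.le_simpleClosure (hΩ : TwistClosed (⊤ : Subfield Ω)) {F : Subfield Ω}
    (hF : ModelSubfield F) : F ≤ hF.simpleClosure hΩ := subset_simpleRoots F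

theorem ModelSubfield.twistClosed_simpleClosure (hΩ : TwistClosed (⊤ : Subfield Ω))
    {F : Subfield Ω} (hF : ModelSubfield F) : TwistClosed (hF.simpleClosure hΩ) := by
  intro x hx n
  have h := hF.twAdj_of_subset_simpleRoots hΩ (Set.finite_singleton x)
    (Set.singleton_subset_iff.2 hx)
  obtain ⟨y, hy, e⟩ := twistClosed_twAdj hΩ hF.twistClosed {x} x (subset_twAdj F _ rfl) n
  exact ⟨y, h.2.2 hy, e⟩

/-- An element y separable over finitely many simple roots S is separable over the twists of S. So S
∪ {y} is separable over its own twists and, by `twAdj_finite`, generates simple roots only. -/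
theorem ModelSubfield.sepClosure_simpleClosure (hΩ : TwistClosed (⊤ : Subfield Ω))
    {F : Subfield Ω} (hF : ModelSubfield F) :
    sepClosure (hF.simpleClosure hΩ) ≤ hF.simpleClosure hΩ := by
  intro y hy
  have hM : hF.simpleClosure hΩ = adj F (simpleRoots F) := by
    refine le_antisymm (fun x hx => subset_adj _ _ hx) (adj_le (hF.le_simpleClosure hΩ) le_rfl)
  rw [hM] at hy
  obtain ⟨S, hS, hSf, hy⟩ := exists_finite_mem_sepClosure_adj hy
  have h1 (x) (hx : x ∈ S) : x ∈ sepClosure (adj F (twistRoots (insert y S))) :=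
    sepClosure_mono (adj_mono le_rfl (twistRoots_mono (by
      rintro _ rfl
      exact Set.mem_insert_of_mem _ hx))) (mem_simpleRoots.1 (hS hx))
  refine (hF.twAdj_finite hΩ (hSf.insert y) (Set.insert_subset ?_ h1)).2.2
    (subset_twAdj F _ (Set.mem_insert _ _))
  exact sepClosure_le (adj_le ((le_adj _ _).trans (le_sepClosure _)) h1) hy

/-- The simple roots form a model. -/
theorem ModelSubfield.modelSubfield_simpleClosure (hΩ : ModelSubfield (⊤ : Subfield Ω))
    {F : Subfield Ω} (hF : ModelSubfield F) :
    ModelSubfield (hF.simpleClosure hΩ.twistClosed) where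
  twistClosed := hF.twistClosed_simpleClosure _
  primary x _ hs := by
    -- Primarity of Ω writes the element as σ y; pulling back along σ, y is separable over the
    -- simple roots, hence one of them.
    obtain ⟨y, -, rfl⟩ := Subfield.mem_map.1
      (hΩ.primary x trivial (sepClosure_mono (map_subfield_mono le_top) hs))
    exact Subfield.mem_map.2 ⟨y, hF.sepClosure_simpleClosure _ (mem_sepClosure_of_map σ hs), rfl⟩

theorem ModelSubfield.transSep_simpleClosure (hΩ : TwistClosed (⊤ : Subfield Ω))
    {F : Subfield Ω} (hF : ModelSubfield F) : TransSep F (hF.simpleClosure hΩ) := by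
  rw [TransSep, linearlyDisjoint_iff_sum]
  intro n a c ha hc
  choose d hd hdc using fun k => Subfield.mem_map.1 (hc k)
  have h := (hF.twAdj_of_subset_simpleRoots hΩ (Set.finite_range d)
    (Set.range_subset_iff.2 hd)).1
  rw [TransSep, linearlyDisjoint_iff_sum] at h
  exact h n a c ha fun k => Subfield.mem_map.2 ⟨_, subset_twAdj F _ ⟨k, rfl⟩, hdc k⟩

/-- The element `a` is transformally algebraic over the subfield `F`. -/
def TransAlg (F : Subfield Ω) (a : Ω) : Prop := ¬ AlgebraicIndependent F fun n => σ^[n] a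

theorem transAlg_of_le_algClosure {F D : Subfield Ω} (hD : D.map σ ≤ D) {w : Set Ω}
    (hw : w.Finite) (h : D ≤ algClosure (adj F w)) {a : Ω} (ha : a ∈ D) : TransAlg F a :=
  not_algebraicIndependent_of_finite hw fun n => h (iterate_mem hD ha n)

theorem ModelSubfield.transAlg_of_mem_simpleClosure (hΩ : TwistClosed (⊤ : Subfield Ω))
    {F : Subfield Ω} (hF : ModelSubfield F) {a : Ω} (ha : a ∈ hF.simpleClosure hΩ) :
    TransAlg F a := by
  obtain ⟨-, ⟨w, hw, h⟩, -⟩ := hF.twAdj_of_subset_simpleRoots hΩ (Set.finite_singleton a)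
    (Set.singleton_subset_iff.2 ha)
  exact transAlg_of_le_algClosure (twistClosed_twAdj hΩ hF.twistClosed _).map_le hw h
    (subset_twAdj F _ rfl)

/-- The difference field generated by a transformally algebraic element has finite transcendence
degree. -/
theorem TransAlg.exists_finite {F : Subfield Ω} (hF : F.map σ ≤ F) {a : Ω} (ha : TransAlg F a) :
    ∃ w : Set Ω, w.Finite ∧ twAdj F {a} ≤ algClosure (adj F w) := by
  -- Some translate is algebraic over the preceding ones. The algebraic closure of F and these is
  -- then stable under σ, so it contains all translates.
  obtain ⟨n, hn⟩ : ∃ n, σ^[n] a ∈ algClosure (adj F ((fun n => σ^[n] a) '' {j | j < n})) := by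
    by_contra! h
    exact ha (algebraicIndependent_of_notMem_lt h)
  set w : Set Ω := (fun n => σ^[n] a) '' {j | j < n}
  have hFw : F ≤ algClosure (adj F w) := (le_adj _ _).trans (le_algClosure _)
  have key : ∀ k, σ^[k] a ∈ algClosure (adj F w) ∧
      w ⊆ algClosure (adj F w) := fun k => by
    have hww : w ⊆ algClosure (adj F w) := (subset_adj _ _).trans (le_algClosure _)
    refine ⟨?_, hww⟩
    have hstable : ∀ x ∈ algClosure (adj F w), σ x ∈ algClosure (adj F w) := fun x hx => by
      have h1 := map_mem_algClosure σ hx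
      rw [map_adj] at h1
      refine algClosure_le (adj_le (hF.trans hFw) ?_) h1
      rintro _ ⟨_, ⟨j, hj, rfl⟩, rfl⟩
      rw [← Function.iterate_succ_apply' (σ : Ω →+* Ω)]
      rcases (Nat.succ_le_of_lt hj).eq_or_lt with e | e
      · rw [e]
        exact hn
      · exact hww ⟨j + 1, e, rfl⟩
    induction k with
    | zero =>
      -- For n = 0 the set w is empty, and the hypothesis already says that a is algebraic over F.
      rcases n.eq_zero_or_pos with e | e
      · rw [e] at hn
        exact hn
      · exact hww ⟨0, e, rfl⟩
    | succ k ih =>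
      rw [Function.iterate_succ_apply']
      exact hstable _ ih
  refine ⟨w, (Set.finite_lt_nat n).image _, adj_le hFw (Set.union_subset ?_
    ((twistRoots_subset_algClosure F {a}).trans (algClosure_le (adj_le hFw ?_))))⟩
  · rintro _ rfl
    exact (key 0).1
  · rintro _ ⟨k, _, rfl, rfl⟩
    exact (key (k + 1)).1

/-- Transformally algebraic elements of transformally separable extensions are simple roots. -/
theorem TransSep.mem_simpleRoots (hΩ : TwistClosed (⊤ : Subfield Ω)) {F N : Subfield Ω}
    (h : TransSep F N) (hF : TwistClosed F) (hN : TwistClosed N) (hFN : F ≤ N) {a : Ω}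
    (haN : a ∈ N) (ha : TransAlg F a) : a ∈ simpleRoots F := by
  obtain ⟨w, hw, haw⟩ := ha.exists_finite hF.map_le
  exact mem_simpleRoots_of_transSep hΩ hF
    (h.mono (hN.twAdj_le hFN (Set.singleton_subset_iff.2 haN))) hw haw

/-- An extension consisting of simple roots is separable over its twists. -/
theorem le_sepClosure_of_subset_simpleRoots {F M : Subfield Ω} (hM : M.map σ ≤ M)
    (h : (M : Set Ω) ⊆ simpleRoots F) : M ≤ sepClosure (F ⊔ tw M) := fun _ ha =>
  sepClosure_mono (adj_le le_sup_left ((twistRoots_subset_tw hM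
    (Set.singleton_subset_iff.2 ha)).trans (le_sup_right (a := F) (b := tw M)))) (mem_simpleRoots.1 (h ha))

end SimpleRoots

/-! ### Subfields attached to difference field extensions -/

section Bridge

theorem ringExpChar_eq_of_ringHom {K L : Type*} [Field K] [Field L] (f : K →+* L) :
    ringExpChar K = ringExpChar L := by
  have : ExpChar K (ringExpChar L) := RingHom.expChar f f.injective _
  exact ringExpChar.eq K _

variable {Ω : Type u} [Field Ω] [DifferenceField Ω]

section

variable {K : Type*} [Field K] [DifferenceField K] {f : K →+* Ω} (hf : IsDifferenceHom f)

include hf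

theorem IsDifferenceHom.map_sigma_range :
    (σ : K →+* K).fieldRange.map f = f.fieldRange.map σ := by
  ext x
  simp only [Subfield.mem_map, RingHom.mem_fieldRange]
  constructor
  · rintro ⟨_, ⟨y, rfl⟩, rfl⟩
    exact ⟨f y, ⟨y, rfl⟩, (hf y).symm⟩
  · rintro ⟨_, ⟨y, rfl⟩, rfl⟩
    exact ⟨σ y, ⟨y, rfl⟩, hf y⟩

theorem IsDifferenceHom.map_fieldRange_le : f.fieldRange.map σ ≤ f.fieldRange := by
  rw [← hf.map_sigma_range]
  rintro _ ⟨y, -, rfl⟩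
  exact ⟨y, rfl⟩

theorem IsDifferenceHom.iterate (n : ℕ) (x : K) : f (σ^[n] x) = σ^[n] (f x) := by
  induction n with
  | zero => rfl
  | succ n ih => rw [Function.iterate_succ_apply', Function.iterate_succ_apply', hf, ih]

/-- p^n-th roots are unique, so a pointwise choice of roots of σ x is automatically a ring
endomorphism. -/
theorem isClosedUnderTwists_iff : IsClosedUnderTwists K ↔ TwistClosed f.fieldRange := by
  have hp := ringExpChar_eq_of_ringHom f
  constructor
  · rintro h _ ⟨x, rfl⟩ n
    obtain ⟨τ, hτ⟩ := h n
    refine ⟨f (τ x), ⟨τ x, rfl⟩, ?_⟩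
    rw [← map_pow, ← hp, ← map_pow, hτ, hf]
  · intro h n
    have h1 (x : K) : ∃ y : K, y ^ ringExpChar K ^ n = σ x := by
      obtain ⟨_, ⟨y, rfl⟩, hy⟩ := h (f x) ⟨x, rfl⟩ n
      refine ⟨y, f.injective ?_⟩
      rw [map_pow, hp, hy, hf]
    choose τ hτ using h1
    have inj := pow_expChar_pow_injective (Ω := K) (ringExpChar K) n
    refine ⟨{ toFun := τ, map_one' := inj ?_, map_mul' := fun x y => inj ?_, map_zero' := inj ?_,
              map_add' := fun x y => inj ?_ }, fun x => inj ?_⟩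
    · simp [hτ]
    · simp [hτ, mul_pow]
    · change τ 0 ^ _ = 0 ^ _
      rw [hτ, map_zero, zero_pow_expChar_pow]
    · simp [hτ, add_pow_expChar_pow]
    · change τ _ ^ _ = _
      rw [hτ, map_pow]

/-- Being a model is intrinsic and can be tested on the image in any larger difference field. This
allows several models to be compared inside one Ω. -/
theorem isModel_iff : IsModel K ↔ ModelSubfield f.fieldRange := by
  have h1 (x : K) : IsSeparable (σ : K →+* K).fieldRange x ↔
      f x ∈ sepClosure (f.fieldRange.map σ) := by
    rw [← hf.map_sigma_range, ← mem_sepClosure]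
    exact ⟨map_mem_sepClosure f, mem_sepClosure_of_map f⟩
  have h2 (x : K) : x ∈ (σ : K →+* K).fieldRange ↔ f x ∈ f.fieldRange.map σ := by
    rw [← hf.map_sigma_range, Subfield.mem_map]
    exact ⟨fun h => ⟨x, h, rfl⟩, fun ⟨y, hy, e⟩ => f.injective e ▸ hy⟩
  constructor
  · intro h
    refine ⟨(isClosedUnderTwists_iff hf).1 h.1, ?_⟩
    rintro _ ⟨x, rfl⟩ hx
    exact (h2 x).1 (h.2 x ((h1 x).2 hx))
  · intro h
    exact ⟨(isClosedUnderTwists_iff hf).2 h.1,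
      fun x hx => (h2 x).2 (h.2 _ ⟨x, rfl⟩ ((h1 x).1 hx))⟩

end

theorem isDifferenceHom_id : IsDifferenceHom (RingHom.id Ω) := fun _ => rfl

omit [DifferenceField Ω] in
theorem fieldRange_id : (RingHom.id Ω).fieldRange = ⊤ := by
  ext x
  simp

theorem isModel_iff_top : IsModel Ω ↔ ModelSubfield (⊤ : Subfield Ω) := by
  rw [isModel_iff (isDifferenceHom_id (Ω := Ω)), fieldRange_id]

section

variable {K L : Type*} [Field K] [DifferenceField K] [Field L] [DifferenceField L] [Algebra K L]
  [IsDifferenceExtension K L] {f : L →+* Ω} (hf : IsDifferenceHom f)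

theorem isDifferenceHom_algebraMap (K L : Type*) [Field K] [DifferenceField K] [Field L]
    [DifferenceField L] [Algebra K L] [IsDifferenceExtension K L] :
    IsDifferenceHom (algebraMap K L) := IsDifferenceExtension.isDifferenceHom

theorem IsDifferenceHom.comp {A B C : Type*} [Field A] [DifferenceField A] [Field B]
    [DifferenceField B] [Field C] [DifferenceField C] {g : B →+* C} {f : A →+* B}
    (hg : IsDifferenceHom g) (hf : IsDifferenceHom f) : IsDifferenceHom (g.comp f) := fun x => by
  rw [RingHom.comp_apply, hf, hg, RingHom.comp_apply]

theorem fieldRange_comp {A B C : Type*} [Field A] [Field B] [Field C] (g : B →+* C) (f : A →+* B) :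
    (g.comp f).fieldRange = f.fieldRange.map g := by
  ext x
  simp [Subfield.mem_map, RingHom.mem_fieldRange]

include hf

theorem isTransformallySeparable_iff : IsTransformallySeparable K L ↔
    TransSep (f.comp (algebraMap K L)).fieldRange f.fieldRange := by
  rw [IsTransformallySeparable, ← linearlyDisjoint_map_iff f, ← fieldRange_comp,
    ← fieldRange_comp, ← RingHom.comp_assoc, TransSep, hf.map_sigma_range, fieldRange_comp,
    (hf.comp (isDifferenceHom_algebraMap K L)).map_sigma_range]

omit [DifferenceField K] [IsDifferenceExtension K L] in
theorem isTransformallyAlgebraicElement_iff {a : L} : IsTransformallyAlgebraicElement K a ↔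
    TransAlg (f.comp (algebraMap K L)).fieldRange (f a) := by
  have h1 : IsTransformallyAlgebraicElement K a ↔
      ¬ AlgebraicIndependent K fun n => σ^[n] a := by
    rw [algebraicIndependent_iff, IsTransformallyAlgebraicElement]
    push Not
    exact exists_congr fun _ => and_comm
  rw [h1, TransAlg, not_iff_not]
  have h2 : (fun n => σ^[n] (f a)) = f ∘ fun n => σ^[n] a := funext fun n => (hf.iterate n a).symm
  rw [h2]
  exact (algebraicIndependent_ringHom_iff_of_comp_eq
    (RingEquiv.ofBijective (f.comp (algebraMap K L)).rangeRestrictField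
      (f.comp (algebraMap K L)).rangeRestrictField_bijective) f f.injective rfl).symm

end

theorem isTransformallySeparable_iff_top {K : Type*} [Field K] [DifferenceField K] [Algebra K Ω]
    [IsDifferenceExtension K Ω] :
    IsTransformallySeparable K Ω ↔ TransSep (algebraMap K Ω).fieldRange ⊤ := by
  have := isTransformallySeparable_iff (K := K) (isDifferenceHom_id (Ω := Ω))
  rwa [RingHom.id_comp, fieldRange_id] at this

theorem isTransformallyAlgebraicElement_iff_transAlg {K : Type*} [Field K] [DifferenceField K]
    [Algebra K Ω] [IsDifferenceExtension K Ω] {a : Ω} :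
    IsTransformallyAlgebraicElement K a ↔ TransAlg (algebraMap K Ω).fieldRange a := by
  have := isTransformallyAlgebraicElement_iff (K := K) (isDifferenceHom_id (Ω := Ω)) (a := a)
  rwa [RingHom.id_comp] at this

end Bridge

/-! ### Values of twisted difference polynomials -/

section TwistedPolynomials

section FracPow

variable {E : Type*} [Field E] {p : ℕ} [ExpChar E p]

/-- All `p ^ m`-th roots of `y` exist. -/
def HasRoots (p : ℕ) (y : E) : Prop := ∀ m : ℕ, ∃ z : E, z ^ p ^ m = y

/-- The choice in `fracPow` needs a single element good for all representations k / p^m of r. A root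
for one representation works, since the others can be checked after a further power of Frobenius. -/
theorem fracPow_spec {y : E} (hy : HasRoots p y) (r : natInvPow p) {m k : ℕ}
    (h : (r : ℚ) * (p : ℚ) ^ m = k) : fracPow p y r ^ p ^ m = y ^ k := by
  have hex : ∃ z : E, ∀ m k : ℕ, (r : ℚ) * (p : ℚ) ^ m = k → z ^ p ^ m = y ^ k := by
    obtain ⟨m₀, k₀, h₀⟩ := r.2
    obtain ⟨z, hz⟩ := hy m₀
    refine ⟨z ^ k₀, fun m k h => pow_expChar_pow_injective p m₀ ?_⟩
    have h1 : k₀ * p ^ m = k * p ^ m₀ := by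
      have : (k₀ : ℚ) * (p : ℚ) ^ m = k * (p : ℚ) ^ m₀ := by
        rw [← h, ← h₀]
        ring
      exact_mod_cast this
    change ((z ^ k₀) ^ p ^ m) ^ p ^ m₀ = (y ^ k) ^ p ^ m₀
    rw [← pow_mul z, h1, ← pow_mul y, ← hz, ← pow_mul, ← pow_mul, mul_comm]
  exact Classical.epsilon_spec hex m k h

theorem fracPow_zero {y : E} (hy : HasRoots p y) : fracPow p y 0 = 1 := by
  have := fracPow_spec hy 0 (m := 0) (k := 0) (by simp)
  simpa using this

theorem fracPow_add {y : E} (hy : HasRoots p y) (r s : natInvPow p) :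
    fracPow p y (r + s) = fracPow p y r * fracPow p y s := by
  obtain ⟨m, k, h⟩ := r.2
  obtain ⟨m', k', h'⟩ := s.2
  refine pow_expChar_pow_injective p (m + m') ?_
  change _ ^ _ = _ ^ _
  rw [mul_pow, fracPow_spec hy (r + s) (m := m + m') (k := k * p ^ m' + k' * p ^ m),
    fracPow_spec hy r (m := m + m') (k := k * p ^ m'),
    fracPow_spec hy s (m := m + m') (k := k' * p ^ m), pow_add]
  · push_cast
    rw [← h']
    ring
  · push_cast
    rw [← h]
    ring
  · push_cast
    rw [← h, ← h']
    ring

variable [DifferenceField E]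

/-- The value of the part of positive degree in `σ` of a monomial. -/
def tailValue (a : E) (μ : ℕ →₀ natInvPow p) : E :=
  μ.prod fun k r => fracPow p (σ^[k + 1] a) r

omit [ExpChar E p] in
theorem monomialValue_eq (a : E) (l : ℕ) (μ : ℕ →₀ natInvPow p) :
    monomialValue a ((l, μ) : TwistedExponent p) = a ^ l * tailValue a μ := rfl

omit [ExpChar E p] in
theorem tailValue_zero (a : E) : tailValue a (0 : ℕ →₀ natInvPow p) = 1 := Finsupp.prod_zero_index

theorem tailValue_add {a : E} (ha : ∀ k, HasRoots p (σ^[k + 1] a)) (μ ν : ℕ →₀ natInvPow p) :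
    tailValue a (μ + ν) = tailValue a μ * tailValue a ν :=
  Finsupp.prod_add_index' (fun k => fracPow_zero (ha k)) fun k => fracPow_add (ha k)

theorem tailValue_single {a : E} (ha : ∀ k, HasRoots p (σ^[k + 1] a)) (k : ℕ) (r : natInvPow p) :
    tailValue a (Finsupp.single k r) = fracPow p (σ^[k + 1] a) r :=
  Finsupp.prod_single_index (fracPow_zero (ha k))

end FracPow

namespace TwistedPolynomial

variable {K : Type*} [Field K]

theorem derivative_single (ν : TwistedExponent (ringExpChar K)) (c : K) :
    derivative (AddMonoidAlgebra.single ν c) =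
      AddMonoidAlgebra.single (ν.1 - 1, ν.2) (c * (ν.1 : K)) := by
  rw [derivative, AddMonoidAlgebra.coeff_single, Finsupp.sum_single_index]
  simp

theorem derivative_add (f g : TwistedPolynomial K) :
    derivative (f + g) = derivative f + derivative g := by
  rw [derivative, AddMonoidAlgebra.coeff_add, Finsupp.sum_add_index']
  · rfl
  · simp
  · simp [add_mul, AddMonoidAlgebra.single_add]

theorem derivative_zero : derivative (0 : TwistedPolynomial K) = 0 := rfl

variable {E : Type*} [Field E] [DifferenceField E] [Algebra K E]

theorem value_single (ν : TwistedExponent (ringExpChar K)) (c : K) (a : E) :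
    value (AddMonoidAlgebra.single ν c) a = algebraMap K E c * monomialValue a ν := by
  rw [value, AddMonoidAlgebra.coeff_single, Finsupp.sum_single_index]
  simp

theorem value_add (f g : TwistedPolynomial K) (a : E) :
    value (f + g) a = value f a + value g a := by
  rw [value, AddMonoidAlgebra.coeff_add, Finsupp.sum_add_index']
  · rfl
  · simp
  · simp [add_mul]

theorem value_zero (a : E) : value (0 : TwistedPolynomial K) a = 0 := rfl

theorem value_sum {ι : Type*} (s : Finset ι) (f : ι → TwistedPolynomial K) (a : E) :
    value (∑ i ∈ s, f i) a = ∑ i ∈ s, value (f i) a :=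
  map_sum (AddMonoidHom.mk' (fun f => value f a) fun f g => value_add f g a) f s

theorem derivative_sum {ι : Type*} (s : Finset ι) (f : ι → TwistedPolynomial K) :
    derivative (∑ i ∈ s, f i) = ∑ i ∈ s, derivative (f i) :=
  map_sum (AddMonoidHom.mk' derivative (derivative_add (K := K))) f s

/-- The polynomial over `E` obtained from a twisted difference polynomial by substituting `a` for
the variable in the parts of positive degree in `σ`. -/
theorem exists_polynomial (a : E) (A : Subfield E) (hK : ∀ c, algebraMap K E c ∈ A)
    (hA : ∀ μ : ℕ →₀ natInvPow (ringExpChar K), tailValue a μ ∈ A) (f : TwistedPolynomial K) :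
    ∃ P : Polynomial E, (∀ n, P.coeff n ∈ A) ∧ P.eval a = f.value a ∧
      P.derivative.eval a = f.derivative.value a := by
  induction f using AddMonoidAlgebra.induction_linear with
  | zero => exact ⟨0, fun n => by simp, by simp [value_zero], by simp [derivative_zero, value_zero]⟩
  | add f g hf hg =>
    obtain ⟨P, h1, h2, h3⟩ := hf
    obtain ⟨Q, k1, k2, k3⟩ := hg
    exact ⟨P + Q, fun n => by simpa using add_mem (h1 n) (k1 n), by simp [h2, k2, value_add],
      by simp [h3, k3, value_add, derivative_add]⟩
  | single ν c =>
    refine ⟨Polynomial.monomial ν.1 (algebraMap K E c * tailValue a ν.2), fun n => ?_, ?_, ?_⟩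
    · rw [Polynomial.coeff_monomial]
      split_ifs
      · exact mul_mem (hK c) (hA _)
      · exact zero_mem _
    · rw [value_single, Polynomial.eval_monomial, show ν = (ν.1, ν.2) from rfl, monomialValue_eq]
      ring
    · rw [derivative_single, value_single, Polynomial.derivative_monomial,
        Polynomial.eval_monomial, monomialValue_eq, map_mul, map_natCast]
      ring

/-- The twisted difference polynomial `x ^ n * q`, for `q` with exponents of positive degree
in `σ`. -/
def ofTail (n : ℕ) (q : AddMonoidAlgebra K (ℕ →₀ natInvPow (ringExpChar K))) :
    TwistedPolynomial K := q.coeff.sum fun μ c => AddMonoidAlgebra.single (n, μ) c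

theorem value_ofTail (n : ℕ) (q : AddMonoidAlgebra K (ℕ →₀ natInvPow (ringExpChar K))) (a : E) :
    value (ofTail n q) a = a ^ n * q.coeff.sum fun μ c => algebraMap K E c * tailValue a μ := by
  rw [ofTail, Finsupp.sum, value_sum, Finsupp.sum, Finset.mul_sum]
  refine Finset.sum_congr rfl fun μ _ => ?_
  rw [value_single, monomialValue_eq]
  ring

theorem value_derivative_ofTail (n : ℕ) (q : AddMonoidAlgebra K (ℕ →₀ natInvPow (ringExpChar K)))
    (a : E) : value (derivative (ofTail n q)) a =
      n * a ^ (n - 1) * q.coeff.sum fun μ c => algebraMap K E c * tailValue a μ := by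
  rw [ofTail, Finsupp.sum, derivative_sum, value_sum, Finsupp.sum, Finset.mul_sum]
  refine Finset.sum_congr rfl fun μ _ => ?_
  rw [derivative_single, value_single, monomialValue_eq, map_mul, map_natCast]
  ring

end TwistedPolynomial

variable {K E : Type u} [Field K] [Field E] [DifferenceField E] [Algebra K E]

/-- Evaluation of the twisted difference polynomials all of whose exponents have no constant term,
as an algebra homomorphism. -/
theorem exists_tail_of_mem_adjoin {a : E} (ha : ∀ k, HasRoots (ringExpChar K) (σ^[k + 1] a))
    {x : E} (hx : x ∈ Algebra.adjoin K (twistRoots {a})) :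
    ∃ q : AddMonoidAlgebra K (ℕ →₀ natInvPow (ringExpChar K)),
      q.coeff.sum (fun μ c => algebraMap K E c * tailValue a μ) = x := by
  have hp := ringExpChar_eq_of_ringHom (algebraMap K E)
  have : ExpChar E (ringExpChar K) := hp ▸ inferInstance
  let φ : AddMonoidAlgebra K (ℕ →₀ natInvPow (ringExpChar K)) →ₐ[K] E :=
    AddMonoidAlgebra.lift K E _
      { toFun := fun μ => tailValue a μ.toAdd
        map_one' := tailValue_zero a
        map_mul' := fun μ ν => tailValue_add ha _ _ }
  have h1 : Algebra.adjoin K (twistRoots {a}) ≤ φ.range := by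
    refine Algebra.adjoin_le ?_
    rintro y ⟨s, hs, n, m, e⟩
    obtain rfl : s = a := hs
    have hpos : ((ringExpChar K : ℕ) : ℚ) ≠ 0 := by
      exact_mod_cast (expChar_pos E (ringExpChar K)).ne'
    let r : natInvPow (ringExpChar K) := ⟨1 / (ringExpChar K : ℚ) ^ m, m, 1, by
      simp [hpos]⟩
    refine ⟨AddMonoidAlgebra.single (Finsupp.single n r) 1, ?_⟩
    change φ _ = y
    rw [AddMonoidAlgebra.lift_single, one_smul]
    change tailValue s (Finsupp.single n r) = y
    rw [tailValue_single ha]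
    refine pow_expChar_pow_injective (ringExpChar K) m ?_
    change _ ^ _ = _ ^ _
    rw [fracPow_spec (ha n) r (m := m) (k := 1) (by simp [r, hpos]), hp, e, pow_one]
  obtain ⟨q, hq⟩ := h1 hx
  exact ⟨q, hq⟩

omit [DifferenceField E] in
theorem mem_adj_fieldRange_iff {T : Set E} {x : E} : x ∈ adj (algebraMap K E).fieldRange T ↔
    ∃ r ∈ Algebra.adjoin K T, ∃ s ∈ Algebra.adjoin K T, x = r / s := by
  rw [← IntermediateField.mem_adjoin_iff_div]
  have : adj (algebraMap K E).fieldRange T = (IntermediateField.adjoin K T).toSubfield := by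
    rw [IntermediateField.adjoin_toSubfield, Subfield.closure_union, adj, ← RingHom.coe_fieldRange,
      Subfield.closure_eq]
  rw [this]
  rfl

omit [DifferenceField E] in
theorem exists_denominator_adjoin {T : Set E} {c : ℕ → E} (s : Finset ℕ)
    (hc : ∀ n, c n ∈ adj (algebraMap K E).fieldRange T) :
    ∃ d : E, d ∈ Algebra.adjoin K T ∧ d ≠ 0 ∧ ∀ n ∈ s, d * c n ∈ Algebra.adjoin K T := by
  classical
  induction s using Finset.induction_on with
  | empty => exact ⟨1, one_mem _, one_ne_zero, by simp⟩
  | insert k s _ ih =>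
    obtain ⟨d, hd, hd0, h⟩ := ih
    obtain ⟨x, hx, y, hy, e⟩ := mem_adj_fieldRange_iff.1 (hc k)
    by_cases hy0 : y = 0
    · refine ⟨d, hd, hd0, fun n hn => ?_⟩
      rcases Finset.mem_insert.1 hn with rfl | hn
      · rw [e, hy0, div_zero, mul_zero]
        exact zero_mem _
      · exact h n hn
    · refine ⟨d * y, mul_mem hd hy, mul_ne_zero hd0 hy0, fun n hn => ?_⟩
      rcases Finset.mem_insert.1 hn with rfl | hn
      · rw [e, mul_assoc, mul_div_cancel₀ _ hy0]
        exact mul_mem hd hx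
      · rw [mul_right_comm]
        exact mul_mem (h n hn) hy

/-- The simple roots of twisted difference polynomials are the elements that are separable over
their twists. -/
theorem exists_isSimpleRoot_iff (hE : TwistClosed (⊤ : Subfield E)) {a : E} :
    (∃ f : TwistedPolynomial K, IsSimpleRoot f a) ↔
      a ∈ simpleRoots (algebraMap K E).fieldRange := by
  have hp := ringExpChar_eq_of_ringHom (algebraMap K E)
  have hchar : ExpChar E (ringExpChar K) := hp ▸ inferInstance
  have ha (k : ℕ) : HasRoots (ringExpChar K) (σ^[k + 1] a) := fun m => by
    obtain ⟨y, -, hy⟩ := hE (σ^[k] a) trivial m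
    exact ⟨y, by rw [hp, hy, Function.iterate_succ_apply']⟩
  rw [mem_simpleRoots]
  constructor
  -- Freezing the twists of a turns f into an ordinary polynomial over the field they generate, with
  -- the same value and derivative at a.
  · rintro ⟨f, h1, h2⟩
    obtain ⟨P, hP, e1, e2⟩ := TwistedPolynomial.exists_polynomial a
      (adj (algebraMap K E).fieldRange (twistRoots {a})) (fun c => le_adj _ _ ⟨c, rfl⟩) (fun μ => by
        refine prod_mem fun k _ => ?_
        obtain ⟨m, l, h⟩ := (μ k).2
        obtain ⟨z, hz⟩ := ha k m
        have : fracPow (ringExpChar K) (σ^[k + 1] a) (μ k) = z ^ l := by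
          refine pow_expChar_pow_injective (ringExpChar K) m ?_
          change _ ^ _ = _ ^ _
          rw [fracPow_spec (ha k) (μ k) h, ← hz, ← pow_mul, ← pow_mul, mul_comm]
        change fracPow (ringExpChar K) (σ^[k + 1] a) (μ k) ∈ _
        rw [this]
        have hz' : z ∈ twistRoots {a} := ⟨a, rfl, k, m, by rw [← hp, hz]⟩
        exact pow_mem (subset_adj _ _ hz') _) f
    exact mem_sepClosure_iff_polynomial.2 ⟨P, hP, e1.trans h1, by rwa [e2]⟩
  · intro h
    obtain ⟨P, hP, h1, h2⟩ := mem_sepClosure_iff_polynomial.1 h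
    -- A common denominator d moves all coefficients of P into the algebra generated by the twists,
    -- where they are values of combinations of monomials of constant term zero. The value and the
    -- derivative are both multiplied by d ≠ 0.
    obtain ⟨d, -, hd0, hd⟩ := exists_denominator_adjoin P.support hP
    choose! q hq using fun n hn => exists_tail_of_mem_adjoin ha (hd n hn)
    refine ⟨∑ n ∈ P.support, TwistedPolynomial.ofTail n (q n), ?_, ?_⟩
    · rw [TwistedPolynomial.value_sum, ← mul_zero d, ← h1, Polynomial.eval_eq_sum,
        Polynomial.sum, Finset.mul_sum]
      refine Finset.sum_congr rfl fun n hn => ?_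
      rw [TwistedPolynomial.value_ofTail, hq n hn]
      ring
    · have : TwistedPolynomial.value (TwistedPolynomial.derivative
          (∑ n ∈ P.support, TwistedPolynomial.ofTail n (q n))) a = d * P.derivative.eval a := by
        rw [TwistedPolynomial.derivative_sum, TwistedPolynomial.value_sum,
          Polynomial.derivative_eval, Polynomial.sum, Finset.mul_sum]
        refine Finset.sum_congr rfl fun n hn => ?_
        rw [TwistedPolynomial.value_derivative_ofTail, hq n hn]
        ring
      rw [this]
      exact mul_ne_zero hd0 h2

end TwistedPolynomials

/-! ### The relative closure -/

section RelativeClosure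

variable {F E : Type u} [Field F] [DifferenceField F] [Field E] [DifferenceField E] [Algebra F E]
  [IsDifferenceExtension F E]

omit [DifferenceField F] [IsDifferenceExtension F E] in
theorem fieldRange_algebraMap_intermediate (M : IntermediateDifferenceField F E) :
    (algebraMap M.toIntermediateField E).fieldRange = M.toSubfield := by
  ext x
  simp only [RingHom.mem_fieldRange]
  exact ⟨fun ⟨y, hy⟩ => hy ▸ y.2, fun h => ⟨⟨x, h⟩, rfl⟩⟩

omit [DifferenceField F] [IsDifferenceExtension F E] in
theorem isDifferenceHom_intermediate (M : IntermediateDifferenceField F E) :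
    IsDifferenceHom (algebraMap M.toIntermediateField E) := fun _ => rfl

omit [DifferenceField F] [IsDifferenceExtension F E] in
theorem isModel_intermediate_iff (M : IntermediateDifferenceField F E) :
    IsModel M.toIntermediateField ↔ ModelSubfield M.toSubfield := by
  rw [isModel_iff (isDifferenceHom_intermediate M), fieldRange_algebraMap_intermediate]

theorem transSep_intermediate_iff (M : IntermediateDifferenceField F E) :
    IsTransformallySeparable F M.toIntermediateField ↔
      TransSep (algebraMap F E).fieldRange M.toSubfield := by
  rw [isTransformallySeparable_iff (isDifferenceHom_intermediate M),
    fieldRange_algebraMap_intermediate]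
  rfl

omit [DifferenceField F] [IsDifferenceExtension F E] in
theorem transSep_over_intermediate_iff (M : IntermediateDifferenceField F E) :
    IsTransformallySeparable M.toIntermediateField E ↔ TransSep M.toSubfield ⊤ := by
  rw [isTransformallySeparable_iff_top, fieldRange_algebraMap_intermediate]

omit [DifferenceField F] [IsDifferenceExtension F E] in
theorem transAlg_intermediate_iff (M : IntermediateDifferenceField F E) :
    IsTransformallyAlgebraic F M.toIntermediateField ↔
      ∀ a ∈ M.toSubfield, TransAlg (algebraMap F E).fieldRange a := by
  have h (a : M.toIntermediateField) := isTransformallyAlgebraicElement_iff (K := F)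
    (isDifferenceHom_intermediate M) (a := a)
  exact ⟨fun H a ha => (h ⟨a, ha⟩).1 (H ⟨a, ha⟩), fun H a => (h a).2 (H a a.2)⟩

theorem IsModel.modelSubfield_algebraMap (hF : IsModel F) :
    ModelSubfield (algebraMap F E).fieldRange :=
  (isModel_iff (isDifferenceHom_algebraMap F E)).1 hF

omit [DifferenceField F] [IsDifferenceExtension F E] in
theorem IntermediateDifferenceField.ext {M N : IntermediateDifferenceField F E}
    (h : ∀ x, x ∈ M.toIntermediateField ↔ x ∈ N.toIntermediateField) : M = N := by
  obtain ⟨M, hM⟩ := M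
  obtain ⟨N, hN⟩ := N
  obtain rfl : M = N := IntermediateField.ext h
  rfl

omit [DifferenceField F] [IsDifferenceExtension F E] in
/-- The intermediate difference field given by a subfield. -/
def IntermediateDifferenceField.ofSubfield (M : Subfield E) (hM : (algebraMap F E).fieldRange ≤ M)
    (hσ : M.map σ ≤ M) : IntermediateDifferenceField F E where
  toIntermediateField := M.toIntermediateField fun x => hM ⟨x, rfl⟩
  sigma_mem x hx := hσ (Subfield.mem_map.2 ⟨x, hx, rfl⟩)

/-- Each of the two closures is a test object for the other. -/
theorem IsRelativeClosure.unique {M N : IntermediateDifferenceField F E}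
    (hM : IsRelativeClosure M) (hN : IsRelativeClosure N) : M = N :=
  IntermediateDifferenceField.ext fun x =>
    ⟨fun hx => hN.lands M.toIntermediateField hM.isModel hM.separablyAlgebraic
      M.toIntermediateField.val (fun _ => rfl) ⟨x, hx⟩,
    fun hx => hM.lands N.toIntermediateField hN.isModel hN.separablyAlgebraic
      N.toIntermediateField.val (fun _ => rfl) ⟨x, hx⟩⟩

/-- The relative closure consists of the simple roots. -/
theorem exists_isRelativeClosure (hF : IsModel F) (hE : IsModel E) :
    ∃ M : IntermediateDifferenceField F E,
      (M.toIntermediateField : Set E) = {a | ∃ f : TwistedPolynomial F, IsSimpleRoot f a} ∧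
      IsModel M.toIntermediateField ∧ IsRelativeClosure M := by
  have hE' := isModel_iff_top.1 hE
  have hF' := hF.modelSubfield_algebraMap (E := E)
  have hM := hE'.modelSubfield_simpleClosure hF'
  let M := IntermediateDifferenceField.ofSubfield (F := F) (hF'.simpleClosure hE'.twistClosed)
    (hF'.le_simpleClosure _) hM.twistClosed.map_le
  have hmodel : IsModel M.toIntermediateField := (isModel_intermediate_iff M).2 hM
  refine ⟨M, ?_, hmodel, hmodel, ⟨(transSep_intermediate_iff M).2
      (ModelSubfield.transSep_simpleClosure hE'.twistClosed hF'),
    (transAlg_intermediate_iff M).2 fun a ha =>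
      ModelSubfield.transAlg_of_mem_simpleClosure hE'.twistClosed hF' ha⟩, ?_⟩
  · ext a
    rw [Set.mem_ofPred_eq, exists_isSimpleRoot_iff hE'.twistClosed]
    rfl
  · intro L _ _ _ _ hL hFL j hj x
    have h1 : (j : L →+* E).comp (algebraMap F L) = algebraMap F E := j.comp_algebraMap
    have h2 := (isTransformallySeparable_iff (K := F) hj).1 hFL.1
    have h3 := (isTransformallyAlgebraicElement_iff (K := F) hj).1 (hFL.2 x)
    rw [h1] at h2 h3
    refine h2.mem_simpleRoots hE'.twistClosed hF'.twistClosed ((isModel_iff hj).1 hL).twistClosed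
      ?_ ⟨x, rfl⟩ h3
    rintro _ ⟨y, rfl⟩
    exact ⟨algebraMap F L y, j.commutes y⟩

/-- One direction is transitivity. For the other, M consists of simple roots over F, so it is
separable over `F ⊔ tw M`. -/
theorem IsRelativeClosure.transformallySeparable_iff (hF : IsModel F) (hE : IsModel E)
    {M : IntermediateDifferenceField F E} (hM : IsRelativeClosure M) :
    IsTransformallySeparable M.toIntermediateField E ↔ IsTransformallySeparable F E := by
  have hE' := isModel_iff_top.1 hE
  have hF' := hF.modelSubfield_algebraMap (E := E)
  have hM' := (isModel_intermediate_iff M).1 hM.isModel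
  have hFM : (algebraMap F E).fieldRange ≤ M.toSubfield := by
    rintro _ ⟨x, rfl⟩
    exact M.algebraMap_mem x
  have hsep := (transSep_intermediate_iff M).1 hM.separablyAlgebraic.1
  rw [transSep_over_intermediate_iff, isTransformallySeparable_iff_top]
  refine ⟨fun h => hsep.trans h hFM hM'.twistClosed.map_le, fun h =>
    h.of_le_sepClosure hF' hM' hFM le_top
      (le_sepClosure_of_subset_simpleRoots hM'.twistClosed.map_le fun a ha => ?_)⟩
  exact hsep.mem_simpleRoots hE'.twistClosed hF'.twistClosed hM'.twistClosed hFM ha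
    ((transAlg_intermediate_iff M).1 hM.separablyAlgebraic.2 a ha)

end RelativeClosure

/-! ### Inversive hulls -/

section Hull

variable (K : Type u) [Field K] [DifferenceField K]

/-- The direct system `K → K → ⋯` with the powers of `σ` as transition maps. -/
def sigmaSystem (i j : ℕ) (_ : i ≤ j) : K →+* K := (σ : K →+* K) ^ (j - i)

theorem sigma_pow_apply {K : Type u} [Field K] [DifferenceField K] (n : ℕ) (x : K) :
    ((σ : K →+* K) ^ n) x = σ^[n] x := by
  rw [RingHom.coe_pow]

instance : DirectedSystem (fun _ : ℕ => K) (sigmaSystem K · · ·) where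
  map_self i x := by
    rw [sigmaSystem, sigma_pow_apply, Nat.sub_self]
    rfl
  map_map i j k hij hjk x := by
    rw [sigmaSystem, sigmaSystem, sigmaSystem, sigma_pow_apply, sigma_pow_apply, sigma_pow_apply,
      ← Function.iterate_add_apply]
    congr 2
    omega

/-- The inversive hull of a difference field. -/
def Hull : Type u := DirectLimit (fun _ : ℕ => K) (sigmaSystem K)

instance : Field (Hull K) := inferInstanceAs (Field (DirectLimit (fun _ : ℕ => K) (sigmaSystem K)))

namespace Hull

/-- The map sending `x` to `x ^ (σ ^ (-n))`. -/
def level (n : ℕ) : K →+* Hull K := DirectLimit.Ring.of (fun _ : ℕ => K) (sigmaSystem K) n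

variable {K}

theorem level_succ_sigma (n : ℕ) (x : K) : level K (n + 1) (σ x) = level K n x := by
  have := DirectLimit.Ring.of_f (G := fun _ : ℕ => K) (f := sigmaSystem K) (Nat.le_succ n) x
  rw [sigmaSystem, sigma_pow_apply, Nat.succ_sub (le_refl n), Nat.sub_self] at this
  exact this

theorem level_surjective (y : Hull K) : ∃ n x, level K n x = y := by
  obtain ⟨n, x, rfl⟩ := DirectLimit.exists_eq_mk _ y
  exact ⟨n, x, rfl⟩

instance : DifferenceField (Hull K) where
  sigma := DirectLimit.Ring.lift (fun _ : ℕ => K) (sigmaSystem K) (Hull K)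
    (fun i => (level K i).comp σ) fun i j hij x => by
      rw [RingHom.comp_apply, RingHom.comp_apply]
      have := DirectLimit.Ring.of_f (G := fun _ : ℕ => K) (f := sigmaSystem K) hij (σ x)
      rw [sigmaSystem, sigma_pow_apply] at this ⊢
      rw [← Function.iterate_succ_apply' (σ : K →+* K), Function.iterate_succ_apply]
      exact this

theorem sigma_level (n : ℕ) (x : K) : σ (level K n x) = level K n (σ x) := rfl

end Hull

/-- The embedding `i : K → K'` exhibits the inversive difference field `K'` as generated by `K`
under the inverse of `σ`. -/
structure IsHull {K K' : Type*} [Field K] [DifferenceField K] [Field K'] [DifferenceField K']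
    (i : K →+* K') : Prop where
  isDifferenceHom : IsDifferenceHom i
  isInversive : IsInversive K'
  exists_iterate : ∀ y : K', ∃ n x, σ^[n] y = i x

theorem Hull.isHull : IsHull (Hull.level K 0) where
  isDifferenceHom _ := rfl
  isInversive y := by
    obtain ⟨n, x, rfl⟩ := Hull.level_surjective y
    exact ⟨Hull.level K (n + 1) x, by rw [Hull.sigma_level, Hull.level_succ_sigma]⟩
  exists_iterate y := by
    obtain ⟨n, x, rfl⟩ := Hull.level_surjective y
    refine ⟨n, x, ?_⟩
    induction n generalizing x with
    | zero => rfl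
    | succ n ih =>
      rw [Function.iterate_succ_apply, Hull.sigma_level, Hull.level_succ_sigma, ih]

variable {K}

theorem iterate_sigma_injective (n : ℕ) : Function.Injective (σ^[n] : K → K) :=
  (σ : K →+* K).injective.iterate n

theorem IsInversive.iterate_surjective (h : IsInversive K) (n : ℕ) :
    Function.Surjective (σ^[n] : K → K) := Function.Surjective.iterate h n

theorem IsHull.hom_ext {K' L : Type*} [Field K'] [DifferenceField K'] [Field L]
    [DifferenceField L] {i : K →+* K'} (hi : IsHull i) {k k' : K' →+* L} (hk : IsDifferenceHom k)
    (hk' : IsDifferenceHom k') (h : ∀ x, k (i x) = k' (i x)) : k = k' := by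
  ext y
  obtain ⟨n, x, e⟩ := hi.exists_iterate y
  refine (σ : L →+* L).injective.iterate n ?_
  rw [← hk.iterate, ← hk'.iterate, e, h]

/-- The image of y is the unique solution of σ^n (k y) = j x, whenever σ^n y = i x. It does not
depend on n and x, and the ring laws are checked after a common power of σ. -/
theorem IsHull.exists_lift {K' L : Type*} [Field K'] [DifferenceField K'] [Field L]
    [DifferenceField L] {i : K →+* K'} (hi : IsHull i) (hL : IsInversive L) {j : K →+* L}
    (hj : IsDifferenceHom j) : ∃ k : K' →+* L, IsDifferenceHom k ∧ k.comp i = j := by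
  have hsurj (n : ℕ) : Function.Surjective (σ^[n] : L → L) := Function.Surjective.iterate hL n
  have hinj (n : ℕ) : Function.Injective (σ^[n] : L → L) := (σ : L →+* L).injective.iterate n
  choose n x hx using hi.exists_iterate
  choose k hk using fun y => hsurj (n y) (j (x y))
  have key (y : K') (m : ℕ) (z : K) (h : σ^[m] y = i z) : σ^[m] (k y) = j z := by
    refine hinj (n y) ?_
    rw [← Function.iterate_add_apply, add_comm, Function.iterate_add_apply, hk, ← hj.iterate,
      ← hj.iterate]
    congr 1
    refine i.injective ?_
    rw [hi.isDifferenceHom.iterate, hi.isDifferenceHom.iterate, ← h, ← hx,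
      ← Function.iterate_add_apply, add_comm, Function.iterate_add_apply]
  have hadd (y y' : K') (m m' : ℕ) (z z' : K) (h : σ^[m] y = i z) (h' : σ^[m'] y' = i z') :
      σ^[m + m'] y = i (σ^[m'] z) ∧ σ^[m + m'] y' = i (σ^[m] z') := by
    constructor
    · rw [add_comm, Function.iterate_add_apply, h, hi.isDifferenceHom.iterate]
    · rw [Function.iterate_add_apply, h', hi.isDifferenceHom.iterate]
  refine ⟨{ toFun := k, map_one' := ?_, map_mul' := fun y y' => ?_, map_zero' := ?_,
            map_add' := fun y y' => ?_ }, fun y => ?_, ?_⟩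
  · exact (key 1 0 1 (map_one i).symm).trans (map_one j)
  · obtain ⟨h1, h2⟩ := hadd y y' _ _ _ _ (hx y) (hx y')
    refine hinj (n y + n y') ?_
    rw [key (y * y') _ (σ^[n y'] (x y) * σ^[n y] (x y')) (by
      rw [map_mul, ← h1, ← h2, iterate_map_mul])]
    rw [iterate_map_mul, key y _ _ h1, key y' _ _ h2, map_mul]
  · exact (key 0 0 0 (map_zero i).symm).trans (map_zero j)
  · obtain ⟨h1, h2⟩ := hadd y y' _ _ _ _ (hx y) (hx y')
    refine hinj (n y + n y') ?_
    rw [key (y + y') _ (σ^[n y'] (x y) + σ^[n y] (x y')) (by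
      rw [map_add, ← h1, ← h2, iterate_map_add])]
    rw [iterate_map_add, key y _ _ h1, key y' _ _ h2, map_add]
  · change k (σ y) = σ (k y)
    refine hinj (n y) ?_
    rw [key (σ y) (n y) (σ (x y)) (by
      rw [← Function.iterate_succ_apply, Function.iterate_succ_apply', hx, hi.isDifferenceHom]),
      hj, ← Function.iterate_succ_apply, Function.iterate_succ_apply', hk]
  · ext z
    exact key (i z) 0 z rfl

theorem IsHull.isInversiveHull {K' : Type u} [Field K'] [DifferenceField K'] {i : K →+* K'}
    (hi : IsHull i) : IsInversiveHull i where
  isDifferenceHom := hi.isDifferenceHom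
  isInversive := hi.isInversive
  existsUnique L _ _ j hj hL := by
    obtain ⟨k, hk, e⟩ := hi.exists_lift hL hj
    refine ⟨k, ⟨hk, e⟩, fun k' ⟨hk', e'⟩ => hi.hom_ext hk' hk fun x => ?_⟩
    rw [← RingHom.comp_apply, e', ← RingHom.comp_apply, e]

/-- The explicit colimit maps to K' and conversely; uniqueness makes the composite K' → `Hull K` →
K' the identity, so K' inherits generation by K under the inverse of σ. -/
theorem IsInversiveHull.isHull {K' : Type u} [Field K'] [DifferenceField K'] {i : K →+* K'}
    (hi : IsInversiveHull i) : IsHull i := by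
  refine ⟨hi.isDifferenceHom, hi.isInversive, ?_⟩
  have hH := Hull.isHull K
  obtain ⟨k, hk, e⟩ := hH.exists_lift hi.isInversive hi.isDifferenceHom
  obtain ⟨l, ⟨hl, e'⟩, -⟩ := hi.existsUnique _ _ hH.isDifferenceHom hH.isInversive
  have h1 : k.comp l = RingHom.id K' := by
    refine (hi.existsUnique K' i hi.isDifferenceHom hi.isInversive).unique ⟨hk.comp hl, ?_⟩
      ⟨fun _ => rfl, rfl⟩
    rw [RingHom.comp_assoc, e', e]
  intro y
  obtain ⟨n, x, h⟩ := hH.exists_iterate (l y)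
  refine ⟨n, x, ?_⟩
  have h2 : y = k (l y) := (RingHom.congr_fun h1 y).symm
  rw [h2, ← hk.iterate, h, ← RingHom.comp_apply, e]

end Hull

/-! ### The inversive hull functor -/

section Subfields

variable {Ω : Type u} [Field Ω] [DifferenceField Ω]

/-- The characteristic exponent. -/
local notation "𝔭" => ringExpChar Ω

theorem TransAlg.mono {K L : Subfield Ω} (h : K ≤ L) {a : Ω} (ha : TransAlg K a) :
    TransAlg L a := fun hi => by
  let _ := (Subfield.inclusion h).toAlgebra
  have : IsScalarTower K L Ω := IsScalarTower.of_algebraMap_eq fun _ => rfl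
  exact ha (AlgebraicIndependent.restrictScalars (Subfield.inclusion h).injective hi)

theorem TransAlg.of_iterate {K : Subfield Ω} {a : Ω} {n : ℕ} (ha : TransAlg K (σ^[n] a)) :
    TransAlg K a := fun hi => by
  refine ha ?_
  have := hi.comp (fun m => m + n) (add_left_injective n)
  simpa only [Function.comp_def, Function.iterate_add_apply] using this

theorem modelSubfield_top_of_isInversive [PerfectField Ω] (h : IsInversive Ω) :
    ModelSubfield (⊤ : Subfield Ω) where
  twistClosed x _ n := by
    have := PerfectField.toPerfectRing (K := Ω) 𝔭
    obtain ⟨y, hy⟩ := (bijective_iterateFrobenius Ω 𝔭 n).2 (σ x)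
    exact ⟨y, trivial, by rwa [iterateFrobenius_def] at hy⟩
  primary x _ _ := by
    obtain ⟨y, rfl⟩ := h x
    exact Subfield.mem_map.2 ⟨y, trivial, rfl⟩

omit [DifferenceField Ω] in
-- If x were not in A, then x and 1 would be independent over A, while 1 * x - x * 1 = 0 is a
-- relation over C.
theorem mem_of_linearlyDisjoint {A B C : Subfield Ω} (h : LinearlyDisjoint A B C) {x : Ω}
    (hB : x ∈ B) (hC : x ∈ C) : x ∈ A := by
  by_contra hx
  have h1 : LinearIndependent A ![x, 1] := by
    rw [linearIndependent_subfield_iff]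
    intro g hg hs
    rw [Fin.sum_univ_two] at hs
    simp only [Matrix.cons_val_zero, Matrix.cons_val_one, mul_one] at hs
    have h0 : g 0 = 0 := by
      by_contra h0
      refine hx ?_
      have : x = -(g 1) / g 0 := by
        rw [eq_div_iff h0]
        linear_combination hs
      rw [this]
      exact div_mem (neg_mem (hg 1)) (hg 0)
    rw [h0, zero_mul, zero_add] at hs
    exact Fin.forall_fin_two.2 ⟨h0, hs⟩
  have h2 := linearIndependent_subfield_iff.1
    (h 2 ![x, 1] (Fin.forall_fin_two.2 ⟨hB, one_mem B⟩) h1) ![1, -x]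
    (Fin.forall_fin_two.2 ⟨one_mem C, neg_mem hC⟩)
    (by simp [Fin.sum_univ_two]) 0
  simp at h2

theorem TransSep.mem_of_sigma_mem {D E : Subfield Ω} (h : TransSep D E) {x : Ω} (hx : x ∈ E)
    (hs : σ x ∈ D) : x ∈ D := by
  obtain ⟨y, hy, e⟩ := Subfield.mem_map.1
    (mem_of_linearlyDisjoint h hs (Subfield.mem_map.2 ⟨x, hx, rfl⟩))
  rwa [← (σ : Ω →+* Ω).injective e]

/-- Inside an inversive perfect difference field, a transformally separably algebraic model is
contained in another one as soon as it is so up to powers of `σ`. -/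
theorem ModelSubfield.le_of_exists_iterate_mem (hΩ : TwistClosed (⊤ : Subfield Ω))
    {F N Y : Subfield Ω} (hF : ModelSubfield F) (hN : ModelSubfield N) (hY : ModelSubfield Y)
    (hFN : F ≤ N) (hFY : F ≤ Y) (hsN : TransSep F N) (hsY : TransSep F Y)
    (haN : ∀ a ∈ N, TransAlg F a) (haY : ∀ a ∈ Y, TransAlg F a)
    (h : ∀ a ∈ N, ∃ n, σ^[n] a ∈ Y) : N ≤ Y := by
  have hYM : (Y : Set Ω) ⊆ simpleRoots F := fun a ha =>
    hsY.mem_simpleRoots hΩ hF.twistClosed hY.twistClosed hFY ha (haY a ha)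
  have hNM : N ≤ hF.simpleClosure hΩ := fun a ha => (hF.mem_simpleClosure hΩ).2 <|
    hsN.mem_simpleRoots hΩ hF.twistClosed hN.twistClosed hFN ha (haN a ha)
  have hYZ : TransSep Y (hF.simpleClosure hΩ) :=
    (hF.transSep_simpleClosure hΩ).of_le_sepClosure hF hY hFY
      (fun a ha => (hF.mem_simpleClosure hΩ).2 (hYM ha))
      (le_sepClosure_of_subset_simpleRoots hY.twistClosed.map_le hYM)
  -- The simple roots are transformally separable over Y, so one application of σ can be undone at a
  -- time without leaving Y.
  have key (n : ℕ) (a : Ω) (ha : a ∈ hF.simpleClosure hΩ) (hn : σ^[n] a ∈ Y) : a ∈ Y := by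
    induction n generalizing a with
    | zero => exact hn
    | succ n ih =>
      exact hYZ.mem_of_sigma_mem ha (ih (σ a)
        ((hF.twistClosed_simpleClosure hΩ).map_le (Subfield.mem_map.2 ⟨a, ha, rfl⟩)) hn)
  exact fun a ha => (h a ha).elim fun n hn => key n a (hNM ha) hn

/-- In an inversive perfect difference field which is transformally algebraic over the inversive
hull of `F`, every element is up to a power of `σ` in the relative closure of `F`. -/
theorem ModelSubfield.exists_iterate_mem_simpleClosure (hΩ : TwistClosed (⊤ : Subfield Ω))
    {F F' : Subfield Ω} (hF : ModelSubfield F) (hF' : ∀ c ∈ F', ∃ n, σ^[n] c ∈ F) {a : Ω}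
    (ha : TransAlg F' a) : ∃ n, σ^[n] a ∈ hF.simpleClosure hΩ := by
  -- The later translates are used here, rather than the earlier ones: σ^k a will be algebraic over
  -- its own twists, as a simple root must be.
  obtain ⟨k, hk⟩ : ∃ k, σ^[k] a ∈ algClosure (adj F' ((fun n => σ^[n] a) '' {j | k < j})) := by
    by_contra! h
    exact ha (algebraicIndependent_of_notMem_gt h)
  -- F' is listed among the generators, so that only finitely many of its elements are involved and
  -- one power σ^N moves them all into F.
  have hadj : adj F' ((fun n => σ^[n] a) '' {j | k < j}) =
      adj ⊥ (F' ∪ (fun n => σ^[n] a) '' {j | k < j}) := by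
    rw [← adj_adj, adj, adj, adj, bot_sup_eq, Subfield.closure_eq]
  rw [hadj] at hk
  obtain ⟨t, ht, htf, hkt⟩ := exists_finite_mem_algClosure_adj hk
  obtain ⟨N, hN⟩ : ∃ N, ∀ c ∈ t, c ∈ F' → σ^[N] c ∈ F := by
    choose! n hn using hF'
    obtain ⟨N, hN⟩ := (htf.image n).bddAbove
    refine ⟨N, fun c hc hcF => ?_⟩
    obtain ⟨d, hd⟩ := Nat.exists_eq_add_of_le' (hN ⟨c, hc, rfl⟩)
    rw [hd, Function.iterate_add_apply]
    exact iterate_mem hF.twistClosed.map_le (hn c hcF) d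
  set b := σ^[N + k] a with hb
  have hba : b ∈ algClosure (adj F {y | ∃ n, σ^[n + 1] b = y}) := by
    have := map_mem_algClosure ((σ : Ω →+* Ω) ^ N) hkt
    rw [sigma_pow_apply, ← Function.iterate_add_apply, map_adj, Subfield.map_bot] at this
    refine algClosure_mono (adj_le bot_le ?_) this
    rintro _ ⟨c, hc, rfl⟩
    rw [sigma_pow_apply]
    rcases ht hc with hcF | ⟨j, hj, rfl⟩
    · exact le_adj _ _ (hN c hc hcF)
    · refine subset_adj _ _ ⟨j - k - 1, ?_⟩
      rw [hb, ← Function.iterate_add_apply]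
      change _ = σ^[N] (σ^[j] a)
      rw [← Function.iterate_add_apply]
      have : k < j := hj
      rw [show j - k - 1 + 1 + (N + k) = N + j by omega]
  obtain ⟨e, he⟩ := exists_pow_mem_sepClosure 𝔭 hba
  have hbe : b ^ 𝔭 ^ e ∈ simpleRoots F := by
    refine mem_simpleRoots.2 (sepClosure_mono (adj_mono le_rfl ?_) he)
    rintro _ ⟨n, rfl⟩
    exact ⟨_, rfl, n, e, by rw [iterate_map_pow]⟩
  -- Only b^(p^e) is known to be a simple root, but closure under twists provides the p^e-th root of
  -- its image under σ. This root is σ b, which accounts for the extra application of σ.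
  obtain ⟨y, hy, hye⟩ := hF.twistClosed_simpleClosure hΩ _ ((hF.mem_simpleClosure hΩ).2 hbe) e
  refine ⟨N + k + 1, ?_⟩
  rw [Function.iterate_succ_apply']
  rw [map_pow] at hye
  rwa [← pow_expChar_pow_injective 𝔭 e hye]

end Subfields

/-! ### Perfection and algebraicity of the hull -/

section Target

variable {F X F' X' : Type u} [Field F] [DifferenceField F] [Field X] [DifferenceField X]
  [Algebra F X] [IsDifferenceExtension F X] [Field F'] [DifferenceField F'] [Field X']
  [DifferenceField X'] [Algebra F' X'] [IsDifferenceExtension F' X']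

omit [Algebra F X] [IsDifferenceExtension F X] in
-- If σ^n y = j x and τ is the first twist, the p-th root of y is the inverse image of j (τ x) under
-- σ^(n+1).
theorem IsHull.perfectField {j : X →+* X'} (hj : IsHull j) (hX : IsClosedUnderTwists X) :
    PerfectField X' := by
  have : PerfectRing X' (ringExpChar X') := PerfectRing.ofSurjective _ _ fun y => by
    obtain ⟨n, x, e⟩ := hj.exists_iterate y
    obtain ⟨τ, hτ⟩ := hX 1
    obtain ⟨w, hw⟩ := hj.isInversive.iterate_surjective (n + 1) (j (τ x))
    refine ⟨w, iterate_sigma_injective (n + 1) ?_⟩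
    rw [frobenius_def, iterate_map_pow, hw, Function.iterate_succ_apply', e,
      ← hj.isDifferenceHom, ← hτ, ← ringExpChar_eq_of_ringHom j, pow_one, map_pow, map_pow]
  exact PerfectRing.toPerfectField X' (ringExpChar X')

omit [DifferenceField F] [IsDifferenceExtension F X] in
theorem IsHull.isTransformallyAlgebraic {i : F →+* F'} {j : X →+* X'} (hj : IsHull j)
    (h : ∀ c, algebraMap F' X' (i c) = j (algebraMap F X c)) (hX : IsTransformallyAlgebraic F X) :
    IsTransformallyAlgebraic F' X' := fun y => by
  obtain ⟨n, x, e⟩ := hj.exists_iterate y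
  rw [isTransformallyAlgebraicElement_iff_transAlg]
  have := (isTransformallyAlgebraicElement_iff hj.isDifferenceHom).1 (hX x)
  rw [← e] at this
  refine this.of_iterate.mono ?_
  rintro _ ⟨c, rfl⟩
  exact ⟨i c, h c⟩

end Target

/-! ### The hull functor and the equivalence of categories -/

section Functor

variable {F F' : Type u} [Field F] [DifferenceField F] [Field F'] [DifferenceField F']
  {i : F →+* F'} (hi : IsHull i)

/-- The inversive hull of an extension of `F`, as an extension of the inversive hull of `F`. -/
def hullExtension (X : DifferenceExtension F) : DifferenceExtension F' :=
  have h := hi.exists_lift (Hull.isHull X.carrier).isInversive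
    ((Hull.isHull X.carrier).isDifferenceHom.comp (isDifferenceHom_algebraMap F X.carrier))
  { carrier := Hull X.carrier
    algebra := h.choose.toAlgebra
    isDifferenceExtension :=
      letI := h.choose.toAlgebra
      ⟨h.choose_spec.1⟩ }

/-- The embedding of an extension of `F` in its inversive hull. -/
def toHull (X : DifferenceExtension F) : X.carrier →+* (hullExtension hi X).carrier :=
  Hull.level X.carrier 0

theorem isHull_toHull (X : DifferenceExtension F) : IsHull (toHull hi X) := Hull.isHull X.carrier

theorem algebraMap_hullExtension (X : DifferenceExtension F) (c : F) :
    algebraMap F' (hullExtension hi X).carrier (i c) = toHull hi X (algebraMap F X.carrier c) :=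
  RingHom.congr_fun (hi.exists_lift (Hull.isHull X.carrier).isInversive
    ((Hull.isHull X.carrier).isDifferenceHom.comp
      (isDifferenceHom_algebraMap F X.carrier))).choose_spec.2 c

/-- Compatibility over F suffices: two difference homomorphisms out of F' agree once they agree on
F. -/
theorem existsUnique_hom_of_isHull (hi : IsHull i) {X : DifferenceExtension F} {X' Y' : DifferenceExtension F'}
    {j : X.carrier →+* X'.carrier} (hj : IsHull j)
    (hji : ∀ c, algebraMap F' X'.carrier (i c) = j (algebraMap F X.carrier c))
    (hY' : IsInversive Y'.carrier) {k : X.carrier →+* Y'.carrier} (hk : IsDifferenceHom k)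
    (hki : ∀ c, algebraMap F' Y'.carrier (i c) = k (algebraMap F X.carrier c)) :
    ∃! f : X' ⟶ Y', ∀ x, f.1 (j x) = k x := by
  obtain ⟨l, hl, e⟩ := hj.exists_lift hY' hk
  have h : l.comp (algebraMap F' X'.carrier) = algebraMap F' Y'.carrier := by
    refine hi.hom_ext (hl.comp (isDifferenceHom_algebraMap _ _)) (isDifferenceHom_algebraMap _ _)
      fun c => ?_
    rw [RingHom.comp_apply, hji, hki, ← e, RingHom.comp_apply]
  refine ⟨⟨{ l with commutes' := RingHom.congr_fun h }, hl⟩, RingHom.congr_fun e, fun f hf => ?_⟩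
  have := hj.hom_ext (k := (f.1 : X'.carrier →+* Y'.carrier)) f.2 hl fun x => by
    rw [← RingHom.comp_apply l, e]
    exact hf x
  exact Subtype.ext (AlgHom.ext fun x => RingHom.congr_fun this x)

/-- The map induced on inversive hulls. -/
theorem existsUnique_hullMap {X Y : DifferenceExtension F} (f : X ⟶ Y) :
    ∃! g : hullExtension hi X ⟶ hullExtension hi Y, ∀ x, g.1 (toHull hi X x) =
      toHull hi Y (f.1 x) :=
  existsUnique_hom_of_isHull hi (isHull_toHull hi X) (algebraMap_hullExtension hi X)
    (isHull_toHull hi Y).isInversive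
    (k := (toHull hi Y).comp (f.1 : X.carrier →+* Y.carrier))
    ((isHull_toHull hi Y).isDifferenceHom.comp f.2) fun c => by
      rw [algebraMap_hullExtension, RingHom.comp_apply]
      exact congrArg _ (f.1.commutes c).symm

/-- The inversive hull functor. -/
def hullFunctor : DifferenceExtension F ⥤ DifferenceExtension F' where
  obj := hullExtension hi
  map f := (existsUnique_hullMap hi f).choose
  map_id X := ((existsUnique_hullMap hi (𝟙 X)).choose_spec.2 (𝟙 _) fun _ => rfl).symm
  map_comp f g := by
    refine ((existsUnique_hullMap hi (f ≫ g)).choose_spec.2 (_ ≫ _) fun x => ?_).symm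
    exact (congrArg _ ((existsUnique_hullMap hi f).choose_spec.1 x)).trans
      ((existsUnique_hullMap hi g).choose_spec.1 (f.1 x))

theorem hullFunctor_map_apply {X Y : DifferenceExtension F} (f : X ⟶ Y) (x : X.carrier) :
    ((hullFunctor hi).map f).1 (toHull hi X x) = toHull hi Y (f.1 x) :=
  (existsUnique_hullMap hi f).choose_spec.1 x

theorem perfectInversiveAlgebraic_hullExtension {X : DifferenceExtension F}
    (hX : separablyAlgebraicModels F X) : perfectInversiveAlgebraic F' (hullExtension hi X) :=
  ⟨(isHull_toHull hi X).perfectField hX.1.isClosedUnderTwists, (isHull_toHull hi X).isInversive,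
    (isHull_toHull hi X).isTransformallyAlgebraic (algebraMap_hullExtension hi X) hX.2.2⟩

/-- The inversive hull functor on models transformally separably algebraic over `F`. -/
def modelHullFunctor : (separablyAlgebraicModels F).FullSubcategory ⥤
    (perfectInversiveAlgebraic F').FullSubcategory :=
  (perfectInversiveAlgebraic F').lift ((separablyAlgebraicModels F).ι ⋙ hullFunctor hi)
    fun X => perfectInversiveAlgebraic_hullExtension hi X.property

instance : (modelHullFunctor hi).Faithful where
  map_injective {X Y f g} h := by
    refine ObjectProperty.hom_ext _ (Subtype.ext (AlgHom.ext fun x => ?_))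
    refine (toHull hi Y.obj).injective ?_
    rw [← hullFunctor_map_apply, ← hullFunctor_map_apply]
    exact congrArg (fun k : (modelHullFunctor hi).obj X ⟶ (modelHullFunctor hi).obj Y =>
      k.hom.1 (toHull hi X.obj x)) h

section

variable {Ω : Type u} [Field Ω] [DifferenceField Ω] {L : Type u} [Field L] [DifferenceField L]
  [Algebra F L] [IsDifferenceExtension F L]

omit [DifferenceField F] [IsDifferenceExtension F L] in
theorem transAlg_of_mem_fieldRange {f : L →+* Ω} (hf : IsDifferenceHom f)
    (h : IsTransformallyAlgebraic F L) {a : Ω} (ha : a ∈ f.fieldRange) :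
    TransAlg (f.comp (algebraMap F L)).fieldRange a := by
  obtain ⟨x, rfl⟩ := ha
  exact (isTransformallyAlgebraicElement_iff hf).1 (h x)

/-- Embeddings of two models in an inversive hull of the second one. -/
theorem IsHull.fieldRange_le {L' : Type u} [Field L'] [DifferenceField L'] [Algebra F L']
    [IsDifferenceExtension F L'] (hF : IsModel F) (hL : IsModel L)
    (hL' : IsModel L') (h : IsTransformallySeparablyAlgebraic F L)
    (h' : IsTransformallySeparablyAlgebraic F L') {f : L →+* Ω} (hf : IsDifferenceHom f)
    {f' : L' →+* Ω} (hf' : IsHull f')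
    (e : f.comp (algebraMap F L) = f'.comp (algebraMap F L')) : f.fieldRange ≤ f'.fieldRange := by
  have := hf'.perfectField hL'.isClosedUnderTwists
  have hΩ := modelSubfield_top_of_isInversive hf'.isInversive
  have hle {M : Type u} [Field M] [Algebra F M] (g : M →+* Ω) :
      (g.comp (algebraMap F M)).fieldRange ≤ g.fieldRange := by
    rintro _ ⟨c, rfl⟩
    exact ⟨_, rfl⟩
  have hd := hf.comp (isDifferenceHom_algebraMap F L)
  refine ((isModel_iff hd).1 hF).le_of_exists_iterate_mem hΩ.twistClosed ((isModel_iff hf).1 hL)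
    ((isModel_iff hf'.isDifferenceHom).1 hL') (hle f) (e ▸ hle f')
    ((isTransformallySeparable_iff hf).1 h.1)
    (e ▸ (isTransformallySeparable_iff hf'.isDifferenceHom).1 h'.1)
    (fun a ha => transAlg_of_mem_fieldRange hf h.2 ha)
    (fun a ha => e ▸ transAlg_of_mem_fieldRange hf'.isDifferenceHom h'.2 ha) fun a _ => ?_
  obtain ⟨n, x, hx⟩ := hf'.exists_iterate a
  exact ⟨n, x, hx.symm⟩

end

/-- A morphism of hulls places X and Y in the hull of Y. There the image of X is contained in that
of Y, so the morphism restricts to an embedding of X in Y. -/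
theorem full_modelHullFunctor (hF : IsModel F) : (modelHullFunctor hi).Full where
  map_surjective {X Y} g := by
    have hX := isHull_toHull hi X.obj
    have hY := isHull_toHull hi Y.obj
    let g' : (hullExtension hi X.obj).carrier →ₐ[F'] (hullExtension hi Y.obj).carrier := g.hom.1
    have hg' : IsDifferenceHom (g' : (hullExtension hi X.obj).carrier →+*
        (hullExtension hi Y.obj).carrier) := g.hom.2
    have hf := hg'.comp hX.isDifferenceHom
    have h1 (c : F) : g' (toHull hi X.obj (algebraMap F _ c)) =
        toHull hi Y.obj (algebraMap F _ c) := by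
      rw [← algebraMap_hullExtension, ← algebraMap_hullExtension, g'.commutes]
    have hle := hY.fieldRange_le hF X.property.1 Y.property.1 X.property.2 Y.property.2 hf
      (RingHom.ext h1)
    choose f hfY using fun x => hle ⟨x, rfl⟩
    have hfY (x) : toHull hi Y.obj (f x) = g' (toHull hi X.obj x) := hfY x
    have inj := (toHull hi Y.obj).injective
    let F0 : X.obj.carrier →ₐ[F] Y.obj.carrier :=
      { toFun := f
        map_one' := inj (by rw [hfY]; simp only [map_one])
        map_zero' := inj (by rw [hfY]; simp only [map_zero])
        map_add' := fun x y => inj (by rw [hfY]; simp only [map_add, hfY])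
        map_mul' := fun x y => inj (by rw [hfY]; simp only [map_mul, hfY])
        commutes' := fun c => inj (by rw [hfY, h1]) }
    have hF0 : IsDifferenceHom (F0 : X.obj.carrier →+* Y.obj.carrier) := fun x => inj <| by
      rw [hY.isDifferenceHom]
      exact ((hfY (σ x)).trans (hf x)).trans (congrArg σ (hfY x).symm)
    let f0 : X.obj ⟶ Y.obj := ⟨F0, hF0⟩
    refine ⟨ObjectProperty.homMk f0, ObjectProperty.hom_ext _ ?_⟩
    exact ((existsUnique_hullMap hi f0).choose_spec.2 g.hom fun x => (hfY x).symm).symm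

theorem nonempty_iso_of_isHull (hi : IsHull i) {X : DifferenceExtension F} {X' Y' : DifferenceExtension F'}
    {j : X.carrier →+* X'.carrier} (hj : IsHull j)
    (hji : ∀ c, algebraMap F' X'.carrier (i c) = j (algebraMap F X.carrier c))
    {k : X.carrier →+* Y'.carrier} (hk : IsHull k)
    (hki : ∀ c, algebraMap F' Y'.carrier (i c) = k (algebraMap F X.carrier c)) :
    Nonempty (X' ≅ Y') := by
  obtain ⟨f, hf, -⟩ := existsUnique_hom_of_isHull hi hj hji hk.isInversive hk.isDifferenceHom hki
  obtain ⟨g, hg, -⟩ := existsUnique_hom_of_isHull hi hk hki hj.isInversive hj.isDifferenceHom hji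
  refine ⟨f, g, ?_, ?_⟩
  · refine (existsUnique_hom_of_isHull hi hj hji hj.isInversive hj.isDifferenceHom hji).unique
      (fun x => ?_) fun x => rfl
    exact (congrArg g.1 (hf x)).trans (hg x)
  · refine (existsUnique_hom_of_isHull hi hk hki hk.isInversive hk.isDifferenceHom hki).unique
      (fun x => ?_) fun x => rfl
    exact (congrArg f.1 (hg x)).trans (hf x)

/-- The preimage of Z is the field of simple roots of F in Z; Z is its hull because every element
enters it under a power of σ. -/
theorem essSurj_modelHullFunctor (hF : IsModel F) : (modelHullFunctor hi).EssSurj where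
  mem_essImage Z := by
    obtain ⟨hp, hinv, halg⟩ := Z.property
    have hΩ := modelSubfield_top_of_isInversive hinv
    let _ : Algebra F Z.obj.carrier := ((algebraMap F' Z.obj.carrier).comp i).toAlgebra
    have hd : IsDifferenceHom (algebraMap F Z.obj.carrier) :=
      (isDifferenceHom_algebraMap F' Z.obj.carrier).comp hi.isDifferenceHom
    have : IsDifferenceExtension F Z.obj.carrier := ⟨hd⟩
    have hFm := (isModel_iff hd).1 hF
    have hM := hΩ.modelSubfield_simpleClosure hFm
    let M := IntermediateDifferenceField.ofSubfield (F := F) (hFm.simpleClosure hΩ.twistClosed)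
      (hFm.le_simpleClosure hΩ.twistClosed) hM.twistClosed.map_le
    have hMZ : IsHull (algebraMap M.toIntermediateField Z.obj.carrier) :=
      { isDifferenceHom := isDifferenceHom_intermediate M
        isInversive := hinv
        exists_iterate := fun y => by
          obtain ⟨n, hn⟩ := hFm.exists_iterate_mem_simpleClosure hΩ.twistClosed
            (F' := (algebraMap F' Z.obj.carrier).fieldRange) (by
              rintro _ ⟨c, rfl⟩
              obtain ⟨n, x, e⟩ := hi.exists_iterate c
              refine ⟨n, x, ?_⟩
              rw [← (isDifferenceHom_algebraMap F' Z.obj.carrier).iterate, e]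
              rfl)
            (isTransformallyAlgebraicElement_iff_transAlg.1 (halg y))
          exact ⟨n, ⟨_, hn⟩, rfl⟩ }
    let X : (separablyAlgebraicModels F).FullSubcategory :=
      ⟨{ carrier := M.toIntermediateField }, (isModel_intermediate_iff M).2 hM,
        (transSep_intermediate_iff M).2 (hFm.transSep_simpleClosure hΩ.twistClosed),
        (transAlg_intermediate_iff M).2 fun a ha =>
          hFm.transAlg_of_mem_simpleClosure hΩ.twistClosed ha⟩
    obtain ⟨e⟩ := nonempty_iso_of_isHull hi (X := X.obj) (isHull_toHull hi X.obj)
      (algebraMap_hullExtension hi X.obj) (Y' := Z.obj) hMZ fun _ => rfl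
    exact ⟨X, ⟨ObjectProperty.isoMk _ e⟩⟩

theorem exists_isInversiveHull (F : Type u) [Field F] [DifferenceField F] :
    ∃ (F' : Type u) (_ : Field F') (_ : DifferenceField F') (i : F →+* F'), IsInversiveHull i :=
  ⟨Hull F, _, _, _, (Hull.isHull F).isInversiveHull⟩

theorem exists_equivalence_of_isInversiveHull (hF : IsModel F) (hi : IsInversiveHull i) :
    ∃ (Φ : (separablyAlgebraicModels F).FullSubcategory ≌
          (perfectInversiveAlgebraic F').FullSubcategory)
      (η : ∀ X : (separablyAlgebraicModels F).FullSubcategory,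
        X.obj.carrier →+* (Φ.functor.obj X).obj.carrier),
      (∀ X, IsInversiveHull (η X)) ∧
      (∀ X (c : F), η X (algebraMap F X.obj.carrier c) =
        algebraMap F' (Φ.functor.obj X).obj.carrier (i c)) ∧
      ∀ (X Y : (separablyAlgebraicModels F).FullSubcategory) (f : X ⟶ Y) (x : X.obj.carrier),
        (Φ.functor.map f).hom.1 (η X x) = η Y (f.hom.1 x) := by
  have := full_modelHullFunctor hi.isHull hF
  have := essSurj_modelHullFunctor hi.isHull hF
  have : (modelHullFunctor hi.isHull).IsEquivalence := {}
  exact ⟨(modelHullFunctor hi.isHull).asEquivalence, fun X => toHull hi.isHull X.obj,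
    fun X => (isHull_toHull hi.isHull X.obj).isInversiveHull,
    fun X c => (algebraMap_hullExtension hi.isHull X.obj c).symm,
    fun X Y f x => hullFunctor_map_apply hi.isHull f.hom x⟩

end Functor

/-! ### Separable and transformal transcendence bases -/

section SeparablyGenerated

variable {Ω : Type u} [Field Ω] {p : ℕ} [ExpChar Ω p]

/-- Mac Lane's condition makes the finitely generated field K(S) separably generated. -/
theorem exists_finite_separating {K : Subfield Ω} (h : LinearlyDisjoint (frob p 1 K) K (frob p 1 ⊤))
    {S : Set Ω} (hS : S.Finite) :
    ∃ u : Set Ω, u.Finite ∧ AlgIndep K u ∧ adj K S ≤ sepClosure (adj K u) := by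
  have : ExpChar K p := expChar_subfield p K
  set L := IntermediateField.adjoin K S with hL
  have hfin : Algebra.EssFiniteType K L :=
    IntermediateField.essFiniteType_iff.2 ⟨hS.toFinset, by simp [hL]⟩
  obtain ⟨s, hs, hsep⟩ : ∃ s : Finset L, IsTranscendenceBasis K ((↑) : s → L) ∧
      Algebra.IsSeparable (IntermediateField.adjoin K (s : Set L)) L := by
    obtain _ | hp := ‹ExpChar K p›
    · exact exists_isTranscendenceBasis_and_isSeparable_of_perfectField K L
    -- What has to be checked is that p-th powers preserve linear independence over K. Frobenius
    -- gives independence over K^p, and disjointness raises it to K.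
    · refine exists_isTranscendenceBasis_and_isSeparable_of_linearIndepOn_pow_of_essFiniteType
        p hp fun s hs => ?_
      have h1 : LinearIndependent K fun x : s => ((x : L) : Ω) :=
        LinearIndependent.map' (v := fun x : s => (x : L)) hs L.val.toLinearMap
          (LinearMap.ker_eq_bot.2 (RingHom.injective _))
      have h2 : LinearIndependent (frob p 1 K) fun x : s => ((x : L) : Ω) ^ p ^ 1 := by
        rw [linearIndependent_subfield_iff] at h1 ⊢
        intro g hg hs i
        choose b hb hbg using fun i => mem_frob.1 (hg i)
        simp only [← hbg] at hs ⊢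
        rw [← sum_pow_expChar_pow] at hs
        rw [h1 b hb (pow_eq_zero_iff (expChar_pow_pos Ω p 1).ne' |>.1 hs) i,
          zero_pow (expChar_pow_pos Ω p 1).ne']
      have h3 := (h.symm (frob_le 1 K) (frob_mono 1 le_top)).linearIndependent
        (fun i => pow_mem_frob trivial) h2
      simp only [pow_one] at h3
      exact LinearIndependent.of_comp (v := fun x : s => (x : L) ^ p) L.val.toLinearMap h3
  have hadj : adj K S = L.toSubfield := adj_eq_adjoin K S
  refine ⟨L.val '' s, s.finite_toSet.image _, ?_, ?_⟩
  · have h1 : AlgebraicIndependent K fun x : s => L.val x :=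
      hs.1.map' (f := L.val) (RingHom.injective _)
    have := h1.to_subtype_range
    rw [AlgIndep]
    have hr : (L.val '' (s : Set L) : Set Ω) = Set.range fun x : s => L.val x := by
      ext x
      simp
    rw [hr]
    exact this
  · intro x hx
    rw [hadj] at hx
    let f : IntermediateField.adjoin K (s : Set L) →+* Ω :=
      (L.val : L →+* Ω).comp (algebraMap (IntermediateField.adjoin K (s : Set L)) L)
    have h1 : (minpoly (IntermediateField.adjoin K (s : Set L)) (⟨x, hx⟩ : L)).Separable :=
      hsep.isSeparable' _
    set q := minpoly (IntermediateField.adjoin K (s : Set L)) (⟨x, hx⟩ : L)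
    have h2 : (q.map f).eval x = 0 := by
      have h3 := congrArg L.val (minpoly.aeval (IntermediateField.adjoin K (s : Set L))
        (⟨x, hx⟩ : L))
      rw [map_zero] at h3
      rw [Polynomial.eval_map, ← h3, Polynomial.aeval_def]
      exact (Polynomial.hom_eval₂ q (algebraMap (IntermediateField.adjoin K (s : Set L)) L)
        (L.val : L →+* Ω) (⟨x, hx⟩ : L)).symm
    refine mem_sepClosure_iff_polynomial.2 ⟨q.map f, fun n => ?_, h2, ?_⟩
    · rw [Polynomial.coeff_map, adj_eq_adjoin]
      have h4 := IntermediateField.adjoin_map K (s : Set L) L.val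
      change L.val (q.coeff n : L) ∈ IntermediateField.adjoin K (L.val '' s)
      rw [← h4]
      exact ⟨_, (q.coeff n).2, rfl⟩
    · have := (h1.map (f := f)).eval₂_derivative_ne_zero (RingHom.id Ω) h2
      exact this

end SeparablyGenerated

theorem LinearlyDisjoint.algebraicIndependent {Ω : Type u} [Field Ω] {A B C : Subfield Ω}
    (h : LinearlyDisjoint A B C) {ι : Type*} {x : ι → Ω} (hx : ∀ i, x i ∈ B)
    (hi : AlgebraicIndependent A x) : AlgebraicIndependent C x := by
  have h1 : AlgIndep A (Set.range x) := hi.to_subtype_range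
  have h2 : AlgIndep C (Set.range x) := h.algIndep (Set.range_subset_iff.2 hx) h1
  exact (algebraicIndependent_subtype_range hi.injective).1 h2

/-! ### Transformal independence of a separating basis -/

section TransBasis

variable {Ω : Type u} [Field Ω] [DifferenceField Ω]

/-- The characteristic exponent. -/
local notation "𝔭" => ringExpChar Ω

/-- If `x` is algebraically independent over `F ⊔ tw ⊤`, then it is transformally independent
over `F`. -/
theorem TransSep.transIndependent {F : Subfield Ω} (h : TransSep F ⊤) (hF : F.map σ ≤ F) {u : Set Ω}
    (hu : AlgIndep (F ⊔ tw ⊤) u) :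
    AlgebraicIndependent F fun k : u × ℕ => σ^[k.2] (k.1 : Ω) := by
  have hσ (x : Ω) : σ x ∈ F ⊔ tw ⊤ := (le_sup_right : tw ⊤ ≤ F ⊔ tw ⊤)
    (map_le_tw ⊤ (Subfield.mem_map.2 ⟨x, trivial, rfl⟩))
  have hlt (N : ℕ) : AlgebraicIndependent F fun k : u × Fin N => σ^[k.2] (k.1 : Ω) := by
    induction N with
    | zero => exact algebraicIndependent_empty_type_iff.2 (algebraMap F Ω).injective
    | succ N ih =>
      have h1 : AlgebraicIndependent F fun k : u × Fin N => σ (σ^[k.2] (k.1 : Ω)) := by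
        have h2 := ih
        rw [← algebraicIndependent_map σ] at h2
        exact LinearlyDisjoint.algebraicIndependent (h.symm hF (map_subfield_mono le_top))
          (fun k => Subfield.mem_map.2 ⟨_, trivial, rfl⟩) h2
      let _ := (Subfield.inclusion (le_sup_left : F ≤ F ⊔ tw ⊤)).toAlgebra
      have : IsScalarTower F ↥(F ⊔ tw ⊤) Ω := IsScalarTower.of_algebraMap_eq fun _ => rfl
      -- The translates of positive exponent are independent over F and lie in `F ⊔ tw ⊤`, over
      -- which u itself is independent.
      have h2 := h1.sumElim_of_tower (S := ↥(F ⊔ tw ⊤)) (by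
        rintro _ ⟨k, rfl⟩
        exact ⟨⟨_, hσ _⟩, rfl⟩) hu
      let e : u × Fin (N + 1) → u ⊕ (u × Fin N) := fun k =>
        Fin.cases (motive := fun _ => u ⊕ (u × Fin N)) (.inl k.1) (fun j => .inr (k.1, j)) k.2
      have he : Function.Injective e := by
        rintro ⟨x, i⟩ ⟨y, j⟩ hij
        cases i using Fin.cases <;> cases j using Fin.cases <;> simp_all [e]
      convert h2.comp e he using 1
      ext ⟨x, i⟩
      cases i using Fin.cases
      · rfl
      · simp [e, Function.iterate_succ_apply', -Function.iterate_succ]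
  refine algebraicIndependent_of_finite_type fun t ht => ?_
  obtain ⟨N, hN⟩ := (ht.image Prod.snd).bddAbove
  refine (hlt (N + 1)).comp (fun k : t => (k.1.1, ⟨k.1.2, Nat.lt_succ_of_le (hN ⟨_, k.2, rfl⟩)⟩))
    fun k l hkl => Subtype.ext (Prod.ext ?_ ?_)
  · exact (Prod.mk.inj hkl).1
  · exact Fin.mk.inj (Prod.mk.inj hkl).2

end TransBasis

/-! ### Existence of a transformal transcendence basis -/

section TransBasis

variable {Ω : Type u} [Field Ω]

theorem notMem_algClosure_of_algebraicIndependent {F : Subfield Ω} {ι : Type*} {f : ι → Ω}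
    (hf : AlgebraicIndependent F f) {T : Set ι} {i : ι} (hi : i ∉ T) :
    f i ∉ algClosure (adj F (f '' T)) := by
  have h1 : AlgIndep F (Set.range f) := hf.to_subtype_range
  have h2 : f i ∉ f '' T := fun ⟨j, hj, e⟩ => hi (hf.injective e ▸ hj)
  exact ((algIndep_insert_iff h2).1 (h1.subset
    (Set.insert_subset ⟨i, rfl⟩ (Set.image_subset_range f T)))).2

variable [DifferenceField Ω]

/-- The characteristic exponent. -/
local notation "𝔭" => ringExpChar Ω

/-- The p^n-th root y of σ x has y^(p^n) separable over σ(D), a subfield of D^(p^n); pulling back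
along Frobenius, y is separable over D. -/
theorem twistClosed_sepClosure (hΩ : TwistClosed (⊤ : Subfield Ω)) {D : Subfield Ω}
    (hD : TwistClosed D) : TwistClosed (sepClosure D) := by
  intro x hx n
  obtain ⟨y, -, hy⟩ := hΩ x trivial n
  obtain ⟨r, hr, hr0, hr1⟩ := mem_sepClosure_iff_polynomial.1 hx
  refine ⟨y, ?_, hy⟩
  have h1 : σ x ∈ sepClosure (D.map σ) := map_mem_sepClosure σ hx
  have h2 : y ^ 𝔭 ^ n ∈ sepClosure (frob 𝔭 n D) := by
    rw [hy]
    refine sepClosure_mono ?_ h1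
    rintro _ ⟨d, hd, rfl⟩
    obtain ⟨z, hz, e⟩ := hD d hd n
    exact mem_frob.2 ⟨z, hz, e⟩
  refine mem_sepClosure_of_map (iterateFrobenius Ω 𝔭 n) ?_
  rwa [iterateFrobenius_def]

/-- Generation of a model by S thus reduces to separability over the field generated by S and its
twists. -/
theorem ModelSubfield.modelSubfield_sepClosure (hΩ : ModelSubfield (⊤ : Subfield Ω)) {D : Subfield Ω}
    (hD : TwistClosed D) : ModelSubfield (sepClosure D) where
  twistClosed := twistClosed_sepClosure hΩ.twistClosed hD
  primary x _ hs := by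
    obtain ⟨y, -, rfl⟩ := Subfield.mem_map.1
      (hΩ.primary x trivial (sepClosure_mono (map_subfield_mono le_top) hs))
    exact Subfield.mem_map.2 ⟨y, (sepClosure_idem D).le (mem_sepClosure_of_map σ hs), rfl⟩

/-- The set u is a separating transcendence basis of K(S) over `K = F ⊔ tw ⊤`. Its twists lie in K,
so u accounts for exactly the directions not visible after σ. -/
theorem exists_transformal_basis (hΩ : TwistClosed (⊤ : Subfield Ω)) {F : Subfield Ω}
    (hF : TwistClosed F) (h : TransSep F ⊤) {S : Set Ω} (hS : S.Finite)
    (hSΩ : sepClosure (twAdj F S) = ⊤) :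
    ∃ u : Set Ω, u.Finite ∧ AlgIndep (F ⊔ tw ⊤) u ∧ TransSep (twAdj F u) ⊤ ∧
      ∀ a, TransAlg (twAdj F u) a := by
  set K := F ⊔ tw (⊤ : Subfield Ω) with hK
  have htK : tw ⊤ ≤ K := le_sup_right
  have h1 : LinearlyDisjoint (frob 𝔭 1 K) K (frob 𝔭 1 ⊤) := by
    have h2 := h.sup_linearlyDisjoint_frob hF (le_sup_left : F ≤ K) le_top 1
    exact h2.mono (sup_le le_sup_left (((hΩ.tw_le_frob 1).trans (frob_mono 1 htK)).trans
      le_sup_right)) le_rfl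
  obtain ⟨u, hu, hui, huS⟩ := exists_finite_separating h1 hS
  have hD := twistClosed_twAdj hΩ hF u
  have hΩu : (⊤ : Subfield Ω) ≤ sepClosure (adj K u) := by
    rw [← hSΩ]
    refine (sepClosure_mono ?_).trans (sepClosure_idem _).le
    refine (adj_le ((le_sup_left : F ≤ K).trans (le_adj _ S)) (Set.union_subset (subset_adj _ _) ?_)).trans huS
    exact ((twistRoots_subset_tw le_top fun _ _ => trivial).trans htK).trans (le_adj K S)
  refine ⟨u, hu, hui, ?_, ?_⟩
  · refine transSep_of_le_sepClosure le_top hD hΩ ?_ (hΩu.trans (sepClosure_mono ?_))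
    -- With D generated by u and its twists, D = K'(u). `tw ⊤` is disjoint from K' over `tw D` by
    -- base change, and K is disjoint from K'(u) over K' by independence of u over K.
    · set K' := F ⊔ tw (twAdj F u) with hK'
      have h3 : LinearlyDisjoint (tw (twAdj F u)) K' (tw ⊤) :=
        (h.linearlyDisjoint_tw hF).sup hF.tw_le (tw_mono (le_twAdj F u)) (tw_mono le_top)
      have hKK : K' ≤ K := sup_le_sup_left (tw_mono le_top) F
      have h4 : LinearlyDisjoint K' K (adj K' u) := hui.linearlyDisjoint hKK
      have h5 : twAdj F u ≤ adj K' u := by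
        rw [hK', ← adj_twistRoots_eq hΩ hF, twAdj_eq_adj_adj]
      have h6 : tw (twAdj F u) ≤ K' := le_sup_right
      refine LinearlyDisjoint.symm ?_ (tw_mono le_top) hD.tw_le
      refine LinearlyDisjoint.mono ?_ le_rfl h5
      refine LinearlyDisjoint.trans (h3.symm h6 (tw_mono le_top)) (h4.mono ?_ le_rfl)
      exact sup_le htK hKK
    · exact adj_le (sup_le_sup_right (le_twAdj F u) _) ((subset_twAdj F u).trans
        (le_sup_left : twAdj F u ≤ twAdj F u ⊔ tw ⊤))
  -- `tw ⊤` is algebraic over D and the twists of S, and S is algebraic over K(u). So S is algebraic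
  -- over its own twists over D, which bounds the transcendence degree.
  · have hSD : S ⊆ algClosure (adj (twAdj F u) (twistRoots S)) := by
      have h7 : tw ⊤ ≤ algClosure (adj (twAdj F u) (twistRoots S)) := by
        refine (tw_le_algClosure _).trans (algClosure_le ?_)
        rintro _ ⟨y, -, rfl⟩
        have hy : y ∈ algClosure (twAdj F S) := sepClosure_le_algClosure _ (hSΩ ▸ trivial)
        refine algClosure_mono ?_ (map_mem_algClosure σ hy)
        rw [twAdj, map_adj]
        refine adj_mono ((map_subfield_mono (le_twAdj F u)).trans hD.map_le) ?_
        rintro _ ⟨y, hy | ⟨s, hs, n, m, e⟩, rfl⟩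
        · exact ⟨y, hy, 0, 0, by simp⟩
        · exact ⟨s, hs, n + 1, m, by rw [← map_pow, e, Function.iterate_succ_apply' σ (n + 1)]⟩
      intro s hs
      refine algClosure_le (K := adj K u) ?_ (sepClosure_le_algClosure _ (hΩu trivial))
      refine adj_le (sup_le ?_ h7) ?_
      · exact (le_twAdj F u).trans ((le_adj _ _).trans (le_algClosure _))
      · exact (subset_twAdj F u).trans ((le_adj _ _).trans (le_algClosure _))
    obtain ⟨w, hw, hSw⟩ := exists_finite_twAdj_le_algClosure hD.map_le hS hSD
    refine fun a => transAlg_of_le_algClosure (D := ⊤) le_top hw ?_ trivial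
    rw [← hSΩ]
    refine (sepClosure_le_algClosure _).trans (algClosure_le ?_)
    exact (adj_mono (le_twAdj F u) le_rfl).trans hSw

/-- Some translate of a is algebraic over its earlier translates, the base and the twists of x; each
twist of x is algebraic over the translates of x. -/
theorem not_transIndependent_option {F : Subfield Ω} {ι : Type*} {x : ι → Ω} {a : Ω}
    (ha : TransAlg (twAdj F (Set.range x)) a) :
    ¬ AlgebraicIndependent F fun k : Option ι × ℕ => σ^[k.2] (k.1.elim a x) := by
  intro h
  refine ha (algebraicIndependent_of_notMem_lt fun n hn => ?_)
  refine notMem_algClosure_of_algebraicIndependent h (i := (none, n))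
    (T := {k | k.1.isSome ∨ k.2 < n}) (by simp) ?_
  have key (m : ℕ) (i : ι) : σ^[m] (x i) ∈ adj F
      ((fun k : Option ι × ℕ => σ^[k.2] (k.1.elim a x)) '' {k | k.1.isSome ∨ k.2 < n}) :=
    subset_adj _ _ ⟨(some i, m), Or.inl rfl, rfl⟩
  refine algClosure_le ?_ hn
  refine adj_le (adj_le ((le_adj _ _).trans (le_algClosure _)) (Set.union_subset ?_ ?_)) ?_
  · rintro _ ⟨i, rfl⟩
    exact le_algClosure _ (key 0 i)
  · refine (twistRoots_subset_algClosure F _).trans (algClosure_mono (adj_le (le_adj _ _) ?_))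
    rintro _ ⟨m, _, ⟨i, rfl⟩, rfl⟩
    exact key (m + 1) i
  · rintro _ ⟨j, hj, rfl⟩
    exact le_algClosure _ (subset_adj _ _ ⟨(none, j), Or.inr hj, rfl⟩)

end TransBasis

/-! ### Transformal separable generation -/

section

variable {F E : Type u} [Field F] [DifferenceField F] [Field E] [DifferenceField E] [Algebra F E]
  [IsDifferenceExtension F E]

theorem toSubfield_twistedAdjoin (S : Set E) :
    (twistedAdjoin F S).toSubfield = twAdj (algebraMap F E).fieldRange S := by
  have h : (twistedAdjoin F S).toIntermediateField = IntermediateField.adjoin F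
    {y | ∃ s ∈ S, ∃ n m : ℕ, (n = 0 → m = 0) ∧ y ^ ringExpChar E ^ m = σ^[n] s} := rfl
  rw [h, IntermediateField.adjoin_toSubfield, Subfield.closure_union, twAdj, adj]
  congr 1
  · exact Subfield.closure_eq (algebraMap F E).fieldRange
  · congr 1
    ext y
    constructor
    · rintro ⟨s, hs, n, m, hnm, e⟩
      cases n with
      | zero => exact Or.inl (by simpa [hnm rfl, ← show y = s by simpa [hnm rfl] using e] using hs)
      | succ n => exact Or.inr ⟨s, hs, n, m, e⟩
    · rintro (hy | ⟨s, hs, n, m, e⟩)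
      · exact ⟨y, hy, 0, 0, fun _ => rfl, by simp⟩
      · exact ⟨s, hs, n + 1, m, by simp, e⟩

omit [DifferenceField F] [DifferenceField E] [IsDifferenceExtension F E] in
theorem algebraicIndependent_fieldRange_iff {ι : Type*} {x : ι → E} :
    AlgebraicIndependent (algebraMap F E).fieldRange x ↔ AlgebraicIndependent F x :=
  (algebraicIndependent_ringHom_iff_of_comp_eq (algebraMap F E).rangeRestrictFieldEquiv
    (RingHom.id E) Function.injective_id rfl)

theorem exists_isTransformalTranscendenceBasis (hF : IsModel F) (hE : IsModel E)
    (h : IsTransformallySeparable F E) (hfg : IsFinitelyGeneratedModel F E) :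
    ∃ (n : ℕ) (x : Fin n → E), IsTransformalTranscendenceBasis F x ∧
      IsTransformallySeparablyAlgebraic (twistedAdjoin F (Set.range x)).toIntermediateField E := by
  have hE' := isModel_iff_top.1 hE
  have hΩ := hE'.twistClosed
  have hF' := hF.modelSubfield_algebraMap (E := E)
  have hTS := isTransformallySeparable_iff_top.1 h
  obtain ⟨S, hS⟩ := hfg
  have hM := hE'.modelSubfield_sepClosure (twistClosed_twAdj hΩ hF'.twistClosed (S : Set E))
  have hle : twAdj (algebraMap F E).fieldRange (S : Set E) ≤ sepClosure _ := le_sepClosure _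
  let M := IntermediateDifferenceField.ofSubfield (F := F) _
    ((le_twAdj _ _).trans hle) hM.twistClosed.map_le
  have hMtop : sepClosure (twAdj (algebraMap F E).fieldRange (S : Set E)) = ⊤ := by
    -- The separable closure of the field generated by S and its twists is a model containing S,
    -- hence all of E.
    have := hS M ((isModel_intermediate_iff M).2 hM) ((subset_twAdj _ _).trans hle)
    refine eq_top_iff.2 fun x _ => ?_
    have hx : x ∈ M.toIntermediateField := this ▸ trivial
    exact hx
  obtain ⟨u, hu, hui, hsep, halg⟩ := exists_transformal_basis hΩ hF'.twistClosed hTS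
    S.finite_toSet hMtop
  have := hu.fintype
  let e := (Fintype.equivFin u).symm
  have hr : Set.range (fun k => (e k : E)) = u := by
    rw [Set.range_comp' Subtype.val e, e.range_eq_univ, Set.image_univ, Subtype.range_coe]
  refine ⟨_, fun k => (e k : E), ⟨?_, fun a ha => ?_⟩, ?_, fun a => ?_⟩
  · refine algebraicIndependent_fieldRange_iff.1 ?_
    exact (hTS.transIndependent hF'.twistClosed.map_le hui).comp (Prod.map e id)
      (e.injective.prodMap Function.injective_id)
  · exact not_transIndependent_option (by rw [hr]; exact halg a)
      (algebraicIndependent_fieldRange_iff.2 ha)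
  · rw [transSep_over_intermediate_iff, toSubfield_twistedAdjoin, hr]
    exact hsep
  · rw [isTransformallyAlgebraicElement_iff_transAlg, fieldRange_algebraMap_intermediate,
      toSubfield_twistedAdjoin, hr]
    exact halg a

end

/-! ### Specializations -/

theorem nonempty_algHom_of_isAlgebraic (k R : Type*) [Field k] [IsAlgClosed k] [CommRing R]
    [IsDomain R] [Algebra k R] [Algebra.IsAlgebraic k R] : Nonempty (R →ₐ[k] k) :=
  ⟨IsAlgClosed.lift⟩

/-- A point with values in an algebraically closed field extends along elements which are zeros of
polynomials whose leading coefficients do not vanish at the point. -/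
theorem exists_algHom_adjoin {k B L : Type*} [Field k] [IsAlgClosed k] [CommRing B] [Algebra k B]
    [Field L] [Algebra B L] [Algebra k L] [IsScalarTower k B L]
    (hinj : Function.Injective (algebraMap B L)) (ψ : B →ₐ[k] k) (Z : Set L)
    (hZ : ∀ z ∈ Z, ∃ f : Polynomial B, f.aeval z = 0 ∧ ψ f.leadingCoeff ≠ 0) :
    ∃ χ : Algebra.adjoin B Z →ₐ[k] k, ∀ b, χ (algebraMap B _ b) = ψ b := by
  -- Localizing at the kernel turns the nonvanishing leading coefficients into units, so that Z
  -- becomes integral over B'.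
  let P := RingHom.ker ψ
  have hP : P.IsPrime := RingHom.ker_isPrime ψ
  let B' := Localization.AtPrime P
  have hu (y : P.primeCompl) : IsUnit (algebraMap B L y) := by
    refine IsUnit.mk0 _ fun h => y.2 ?_
    rw [map_eq_zero_iff _ hinj] at h
    rw [h]
    exact P.zero_mem
  have hu' (y : P.primeCompl) : IsUnit ((ψ : B →+* k) y) := IsUnit.mk0 _ fun h => y.2 h
  let _ : Algebra B' L := (IsLocalization.lift hu).toAlgebra
  have hBL (b : B) : algebraMap B' L (algebraMap B B' b) = algebraMap B L b :=
    IsLocalization.lift_eq hu b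
  have : IsScalarTower B B' L := IsScalarTower.of_algebraMap_eq fun b => (hBL b).symm
  have : IsScalarTower k B' L := IsScalarTower.of_algebraMap_eq fun c => by
    rw [IsScalarTower.algebraMap_apply k B B', hBL, IsScalarTower.algebraMap_apply k B L]
  have hinj' : Function.Injective (algebraMap B' L) := by
    refine (IsLocalization.lift_injective_iff hu).2 fun x y => ?_
    rw [hinj.eq_iff, (IsLocalization.injective B' (M := P.primeCompl) ?_).eq_iff]
    intro m hm
    have := hinj.isDomain (algebraMap B L)
    exact mem_nonZeroDivisors_of_ne_zero fun h => hm (h ▸ P.zero_mem)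
  let ψ' : B' →+* k := IsLocalization.lift hu'
  have hψ' (b : B) : ψ' (algebraMap B B' b) = ψ b := IsLocalization.lift_eq hu' b
  let I := integralClosure B' L
  have hIinj : Function.Injective (algebraMap B' I) := fun x y h =>
    hinj' (congrArg Subtype.val h)
  have hP' : (RingHom.ker ψ').IsPrime := RingHom.ker_isPrime ψ'
  -- Lying over extends the kernel of the point to a prime Q of the integral closure.
  obtain ⟨Q, -, hQ, hQP⟩ := Ideal.exists_ideal_over_prime_of_isIntegral (S := I) (RingHom.ker ψ') ⊥
    (by
      rw [← RingHom.ker_eq_comap_bot, (RingHom.injective_iff_ker_eq_bot _).1 hIinj]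
      exact bot_le)
  have hmk (b : B') : Ideal.Quotient.mk Q (algebraMap B' I b) = algebraMap k (I ⧸ Q) (ψ' b) := by
    have h1 : ψ' (algebraMap k B' (ψ' b)) = ψ' b := by
      rw [IsScalarTower.algebraMap_apply k B B', hψ', AlgHom.commutes]
      rfl
    have h2 : b - algebraMap k B' (ψ' b) ∈ Q.comap (algebraMap B' I) := by
      rw [hQP, RingHom.mem_ker, map_sub, h1, sub_self]
    have h3 := (Ideal.Quotient.eq (I := Q)).2 (by simpa using! h2 :
      algebraMap B' I b - algebraMap B' I (algebraMap k B' (ψ' b)) ∈ Q)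
    rw [h3, ← IsScalarTower.algebraMap_apply]
    rfl
  -- Modulo Q an integral equation over B' becomes one over k, so the quotient is algebraic over the
  -- algebraically closed field k and has a k-point.
  have halg : Algebra.IsAlgebraic k (I ⧸ Q) := by
    refine ⟨fun y => ?_⟩
    obtain ⟨y, rfl⟩ := Ideal.Quotient.mk_surjective y
    obtain ⟨f, hf, hfy⟩ := (integralClosure.isIntegral y : IsIntegral B' y)
    refine IsIntegral.isAlgebraic ⟨f.map ψ', hf.map ψ', ?_⟩
    rw [Polynomial.eval₂_map, show (algebraMap k (I ⧸ Q)).comp ψ' =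
      (Ideal.Quotient.mk Q).comp (algebraMap B' I) from RingHom.ext fun b => (hmk b).symm,
      ← Polynomial.hom_eval₂, hfy, map_zero]
  have hdom : IsDomain (I ⧸ Q) := Ideal.Quotient.isDomain Q
  obtain ⟨χ₀⟩ := nonempty_algHom_of_isAlgebraic k (I ⧸ Q)
  have hle : Algebra.adjoin B Z ≤ I.restrictScalars B := Algebra.adjoin_le fun z hz => by
    obtain ⟨f, hf, hf0⟩ := hZ z hz
    have h1 : IsUnit (f.map (algebraMap B B')).leadingCoeff := by
      have h2 : IsUnit (algebraMap B B' f.leadingCoeff) :=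
        IsLocalization.map_units B' (⟨f.leadingCoeff, hf0⟩ : P.primeCompl)
      rwa [Polynomial.leadingCoeff_map_of_leadingCoeff_ne_zero _ h2.ne_zero]
    obtain ⟨c, hc⟩ := h1
    have h3 := isIntegral_leadingCoeff_smul (f.map (algebraMap B B')) z (by
      rw [Polynomial.aeval_map_algebraMap, hf])
    have h4 : IsIntegral B' ((↑c⁻¹ : B') • (f.map (algebraMap B B')).leadingCoeff • z) :=
      h3.smul _
    rw [← hc, smul_smul, Units.inv_mul, one_smul] at h4
    exact h4
  let χ₁ : I →ₐ[k] k := χ₀.comp (Ideal.Quotient.mkₐ k Q)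
  let incl : Algebra.adjoin B Z →ₐ[B] I.restrictScalars B := Subalgebra.inclusion hle
  refine ⟨χ₁.comp ({ toRingHom := incl.toRingHom, commutes' := fun c => Subtype.ext ?_ } :
    Algebra.adjoin B Z →ₐ[k] I), fun b => ?_⟩
  · rfl
  · have h1 : χ₁ (algebraMap B' I (algebraMap B B' b)) = ψ b := by
      change χ₀ (Ideal.Quotient.mk Q _) = _
      rw [hmk, AlgHom.commutes, hψ']
      rfl
    rw [← h1]
    change χ₁ (incl _) = _
    congr 1
    exact Subtype.ext (hBL b).symm

/-! ### Specialization of points over subfields -/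

section Specialization

variable {Ω : Type u} [Field Ω] {ι κ : Type*}

/-- The polynomials with coefficients in a subfield. -/
def polyOver (K : Subfield Ω) (ι : Type*) : Subring (MvPolynomial ι Ω) :=
  (MvPolynomial.map (σ := ι) K.subtype).range

theorem C_mem_polyOver {K : Subfield Ω} {c : Ω} (hc : c ∈ K) :
    MvPolynomial.C c ∈ polyOver K ι :=
  ⟨MvPolynomial.C ⟨c, hc⟩, MvPolynomial.map_C _ _⟩

theorem X_mem_polyOver (K : Subfield Ω) (i : ι) : MvPolynomial.X i ∈ polyOver K ι :=
  ⟨MvPolynomial.X i, MvPolynomial.map_X _ _⟩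

theorem eval_map_subtype {K : Subfield Ω} (v : ι → Ω) (f : MvPolynomial ι K) :
    MvPolynomial.eval v (MvPolynomial.map K.subtype f) = MvPolynomial.aeval v f := by
  rw [MvPolynomial.eval_map]
  rfl

theorem polyOver_mono {K L : Subfield Ω} (h : K ≤ L) : polyOver K ι ≤ polyOver L ι := by
  rintro _ ⟨f, rfl⟩
  refine ⟨MvPolynomial.map (Subfield.inclusion h) f, ?_⟩
  rw [MvPolynomial.map_map]
  rfl

theorem eval_mem_of_mem_polyOver {K : Subfield Ω} {f : MvPolynomial ι Ω} (hf : f ∈ polyOver K ι)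
    {v : ι → Ω} (hv : ∀ i, v i ∈ K) : MvPolynomial.eval v f ∈ K := by
  obtain ⟨f, rfl⟩ := hf
  have h := MvPolynomial.eval₂_comp_left K.subtype (RingHom.id K) (fun i => (⟨v i, hv i⟩ : K)) f
  rw [RingHom.comp_id] at h
  rw [MvPolynomial.eval_map]
  exact h ▸ SetLike.coe_mem _

theorem rename_mem_polyOver {K : Subfield Ω} {f : MvPolynomial ι Ω} (hf : f ∈ polyOver K ι)
    (e : ι → κ) : MvPolynomial.rename e f ∈ polyOver K κ := by
  obtain ⟨f, rfl⟩ := hf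
  exact ⟨MvPolynomial.rename e f, MvPolynomial.map_rename _ _ _⟩

theorem exists_basis_expansion {K L : Subfield Ω} {β : Type*} {b : β → Ω}
    (hb : (L : Set Ω) ⊆ Submodule.span K (Set.range b)) {f : MvPolynomial ι Ω}
    (hf : f ∈ polyOver L ι) : ∃ g : β →₀ MvPolynomial ι Ω, (∀ i, g i ∈ polyOver K ι) ∧
      f = g.sum fun i p => MvPolynomial.C (b i) * p := by
  classical
  obtain ⟨f, rfl⟩ := hf
  induction f using MvPolynomial.induction_on' with
  | monomial m a =>
    obtain ⟨r, hr⟩ := Finsupp.mem_span_range_iff_exists_finsupp.1 (hb a.2)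
    refine ⟨r.mapRange (fun c : K => MvPolynomial.monomial m (c : Ω)) (by simp), fun i => ?_, ?_⟩
    · rw [Finsupp.mapRange_apply]
      exact ⟨MvPolynomial.monomial m (r i), MvPolynomial.map_monomial _ _ _⟩
    · rw [MvPolynomial.map_monomial, Finsupp.sum_mapRange_index (by simp)]
      change MvPolynomial.monomial m (a : Ω) = _
      rw [← hr, Finsupp.sum, Finsupp.sum, map_sum]
      refine Finset.sum_congr rfl fun i _ => ?_
      rw [MvPolynomial.C_mul_monomial, mul_comm]
      rfl
  | add f f' ih ih' =>
    obtain ⟨g, hg, e⟩ := ih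
    obtain ⟨g', hg', e'⟩ := ih'
    refine ⟨g + g', fun i => add_mem (hg i) (hg' i), ?_⟩
    rw [map_add, e, e', Finsupp.sum_add_index' (by simp) (by simp [mul_add])]

/-- The point `ρ` is a specialization of `v` over `K`. -/
def Specializes (K : Subfield Ω) (v ρ : ι → Ω) : Prop :=
  ∀ f ∈ polyOver K ι, MvPolynomial.eval v f = 0 → MvPolynomial.eval ρ f = 0

theorem Specializes.mono {K L : Subfield Ω} (h : K ≤ L) {v ρ : ι → Ω} (hv : Specializes L v ρ) :
    Specializes K v ρ := fun f hf => hv f (polyOver_mono h hf)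

theorem Specializes.trans {K : Subfield Ω} {u v w : ι → Ω} (h : Specializes K u v)
    (h' : Specializes K v w) : Specializes K u w := fun f hf h0 => h' f hf (h f hf h0)

theorem Specializes.comp {K : Subfield Ω} {v ρ : ι → Ω} (h : Specializes K v ρ) (e : κ → ι) :
    Specializes K (v ∘ e) (ρ ∘ e) := fun f hf h0 => by
  rw [← MvPolynomial.eval_rename] at h0 ⊢
  exact h _ (rename_mem_polyOver hf e) h0

theorem exists_partial_eval {K : Subfield Ω} {s : κ → Ω} (hs : ∀ j, s j ∈ K)
    {f : MvPolynomial (ι ⊕ κ) Ω} (hf : f ∈ polyOver K (ι ⊕ κ)) : ∃ f' ∈ polyOver K ι,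
      ∀ w : ι → Ω, MvPolynomial.eval (Sum.elim w s) f = MvPolynomial.eval w f' := by
  refine ⟨MvPolynomial.bind₁ (Sum.elim MvPolynomial.X fun j => MvPolynomial.C (s j)) f, ?_,
    fun w => ?_⟩
  · obtain ⟨f, rfl⟩ := hf
    induction f using MvPolynomial.induction_on with
    | C a => simpa using C_mem_polyOver a.2
    | add p q hp hq =>
      rw [map_add, map_add]
      exact add_mem hp hq
    | mul_X p i hp =>
      rw [map_mul, map_mul, MvPolynomial.map_X, MvPolynomial.bind₁_X_right]
      refine mul_mem hp ?_
      rcases i with i | j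
      · exact X_mem_polyOver K i
      · exact C_mem_polyOver (hs j)
  · refine RingHom.congr_fun (f := MvPolynomial.eval (Sum.elim w s))
      (g := (MvPolynomial.eval w).comp (MvPolynomial.bind₁ (Sum.elim MvPolynomial.X
        fun j => MvPolynomial.C (s j)) : _ →ₐ[Ω] _).toRingHom) ?_ f
    refine MvPolynomial.ringHom_ext (fun c => by simp) ?_
    rintro (i | j) <;> simp

/-- Points that are rational over the base are preserved. -/
theorem Specializes.sumElim {K : Subfield Ω} {v ρ : ι → Ω} (h : Specializes K v ρ) {s : κ → Ω}
    (hs : ∀ j, s j ∈ K) : Specializes K (Sum.elim v s) (Sum.elim ρ s) := fun f hf h0 => by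
  obtain ⟨f', hf', e⟩ := exists_partial_eval (ι := ι) hs hf
  rw [e] at h0 ⊢
  exact h _ hf' h0

/-- A polynomial over L splits along a K-basis of L into polynomials over K. Their values at v lie
in C, so disjointness makes them vanish separately, and hence they vanish at ρ. -/
theorem Specializes.extend {K L C : Subfield Ω} (h : LinearlyDisjoint K L C) (hL : K ≤ L)
    (hC : K ≤ C) {v ρ : ι → Ω} (hv : ∀ i, v i ∈ C) (hs : Specializes K v ρ) :
    Specializes L v ρ := fun f hf h0 => by
  obtain ⟨β, b, hbL, hbi, hb⟩ := exists_basis_subfield hL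
  obtain ⟨g, hg, rfl⟩ := exists_basis_expansion hb hf
  have h1 := linearIndependent_iff'.1 (h.linearIndependent hbL hbi) g.support
    (fun i => ⟨MvPolynomial.eval v (g i), eval_mem_of_mem_polyOver (polyOver_mono hC (hg i)) hv⟩)
    (by
      rw [Finsupp.sum, map_sum] at h0
      rw [← h0]
      refine Finset.sum_congr rfl fun i _ => ?_
      rw [map_mul, MvPolynomial.eval_C, Subfield.smul_def, smul_eq_mul, mul_comm])
  rw [Finsupp.sum, map_sum]
  refine Finset.sum_eq_zero fun i hi => ?_
  rw [map_mul, hs (g i) (hg i) (congrArg Subtype.val (h1 i hi)), mul_zero]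

/-- Some coordinate of f in a K-basis of L does not vanish at v. At K-rational points the
coordinates have values in K, so a nonzero coordinate prevents f from vanishing. -/
theorem exists_polyOver_ne_zero {K L : Subfield Ω} (hL : K ≤ L) {f : MvPolynomial ι Ω}
    (hf : f ∈ polyOver L ι) {v : ι → Ω} (h0 : MvPolynomial.eval v f ≠ 0) :
    ∃ g ∈ polyOver K ι, MvPolynomial.eval v g ≠ 0 ∧ ∀ ρ : ι → Ω, (∀ i, ρ i ∈ K) →
      MvPolynomial.eval ρ g ≠ 0 → MvPolynomial.eval ρ f ≠ 0 := by
  obtain ⟨β, b, hbL, hbi, hb⟩ := exists_basis_subfield hL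
  obtain ⟨g, hg, rfl⟩ := exists_basis_expansion hb hf
  rw [Finsupp.sum, map_sum] at h0
  obtain ⟨i, hi, hi0⟩ := Finset.exists_ne_zero_of_sum_ne_zero h0
  rw [map_mul] at hi0
  refine ⟨g i, hg i, right_ne_zero_of_mul hi0, fun ρ hρ h1 h2 => h1 ?_⟩
  have h3 := linearIndependent_iff'.1 hbi g.support
    (fun i => ⟨MvPolynomial.eval ρ (g i), eval_mem_of_mem_polyOver (hg i) hρ⟩)
    (by
      rw [Finsupp.sum, map_sum] at h2
      rw [← h2]
      refine Finset.sum_congr rfl fun i _ => ?_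
      rw [map_mul, MvPolynomial.eval_C, Subfield.smul_def, smul_eq_mul, mul_comm]) i hi
  exact congrArg Subtype.val h3

variable [IsAlgClosed Ω]

theorem isAlgClosed_of_algClosure_le {K : Subfield Ω} (h : algClosure K ≤ K) : IsAlgClosed K :=
  IsAlgClosed.of_exists_root _ fun p _ hp => by
    obtain ⟨x, hx⟩ := IsAlgClosed.exists_aeval_eq_zero Ω p
      (Polynomial.degree_pos_of_irreducible hp).ne'
    have hxK : x ∈ K := h (mem_algClosure.2 ⟨p, hp.ne_zero, hx⟩)
    refine ⟨⟨x, hxK⟩, K.subtype.injective ?_⟩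
    rw [map_zero, ← hx]
    exact (Polynomial.aeval_algebraMap_apply Ω (⟨x, hxK⟩ : K) p).symm

/-- Nullstellensatz. -/
theorem exists_specializes_algClosure [Finite ι] (K : Subfield Ω) (v : ι → Ω)
    {g : MvPolynomial ι Ω} (hg : g ∈ polyOver K ι) (h0 : MvPolynomial.eval v g ≠ 0) :
    ∃ ρ : ι → Ω, (∀ i, ρ i ∈ algClosure K) ∧ Specializes K v ρ ∧ MvPolynomial.eval ρ g ≠ 0 := by
  let R := Algebra.adjoin K (Set.range v)
  have : Algebra.FiniteType K R :=
    (Subalgebra.fg_iff_finiteType _).1 ⟨(Set.finite_range v).toFinset, by simp [R]⟩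
  let w (i : ι) : R := ⟨v i, Algebra.subset_adjoin ⟨i, rfl⟩⟩
  have hw (f : MvPolynomial ι K) : ((MvPolynomial.aeval w f : R) : Ω) = MvPolynomial.aeval v f :=
    (MvPolynomial.aeval_algebraMap_apply Ω w f).symm
  obtain ⟨g, rfl⟩ := hg
  rw [eval_map_subtype] at h0
  obtain ⟨φ₀, hφ₀⟩ := exists_algHom_apply_ne_zero (k := K) (Ω := AlgebraicClosure K) (R := R)
    (f := MvPolynomial.aeval w g) fun h => h0 (by rw [← hw, h]; rfl)
  let φ₁ : AlgebraicClosure K →ₐ[K] Ω := IsAlgClosed.lift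
  have hφ (f : MvPolynomial ι K) : φ₁ (φ₀ (MvPolynomial.aeval w f)) =
      MvPolynomial.aeval (fun i => φ₁ (φ₀ (w i))) f := by
    rw [← AlgHom.comp_apply, MvPolynomial.comp_aeval_apply]
    rfl
  refine ⟨fun i => φ₁ (φ₀ (w i)), fun i => mem_algClosure.2 ?_, ?_, ?_⟩
  · exact (Algebra.IsAlgebraic.isAlgebraic (R := K) (φ₀ (w i))).algHom φ₁
  · rintro _ ⟨f, rfl⟩ hf
    rw [eval_map_subtype] at hf ⊢
    rw [← hφ, (Subtype.ext ((hw f).trans hf) : MvPolynomial.aeval w f = 0), map_zero, map_zero]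
  · rw [eval_map_subtype, ← hφ]
    exact (map_ne_zero φ₁).2 hφ₀

end Specialization

section Specialization

variable {Ω : Type u} [Field Ω] [IsAlgClosed Ω] {ι κ : Type*}

theorem Specializes.exists_extension {k : Subfield Ω} (hk : algClosure k ≤ k) {T : Set Ω}
    {τ : T → Ω} (hτ : ∀ j, τ j ∈ k) (h : Specializes k Subtype.val τ) {z : ι → Ω}
    (hz : ∀ i, ∃ F : Polynomial (Algebra.adjoin k T), F.aeval (z i) = 0 ∧
      ∃ H ∈ polyOver k T, MvPolynomial.eval Subtype.val H = (F.leadingCoeff : Ω) ∧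
        MvPolynomial.eval τ H ≠ 0) :
    ∃ ρ : ι → Ω, (∀ i, ρ i ∈ k) ∧
      Specializes k (Sum.elim Subtype.val z) (Sum.elim τ ρ) := by
  have := isAlgClosed_of_algClosure_le hk
  let B := Algebra.adjoin k T
  let t (j : T) : B := ⟨j, Algebra.subset_adjoin j.2⟩
  let τ' (j : T) : k := ⟨τ j, hτ j⟩
  have ht (f : MvPolynomial T k) : ((MvPolynomial.aeval t f : B) : Ω) =
      MvPolynomial.aeval Subtype.val f := (MvPolynomial.aeval_algebraMap_apply Ω t f).symm
  have hτ' (f : MvPolynomial T k) : ((MvPolynomial.aeval τ' f : k) : Ω) =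
      MvPolynomial.aeval τ f := (MvPolynomial.aeval_algebraMap_apply Ω τ' f).symm
  have hsurj : Function.Surjective (MvPolynomial.aeval t : MvPolynomial T k →ₐ[k] B) := fun b => by
    have hb : (b : Ω) ∈ Algebra.adjoin k T := b.2
    rw [Algebra.adjoin_eq_range] at hb
    obtain ⟨f, hf⟩ := hb
    exact ⟨f, Subtype.ext ((ht f).trans hf)⟩
  let ψ : B →ₐ[k] k := AlgHom.liftOfSurjective _ hsurj (MvPolynomial.aeval τ') fun f hf => by
    refine Subtype.ext ((hτ' f).trans ?_)
    rw [← eval_map_subtype]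
    refine h _ ⟨f, rfl⟩ ?_
    rw [eval_map_subtype, ← ht]
    exact congrArg Subtype.val hf
  have hψ (f : MvPolynomial T k) : (ψ (MvPolynomial.aeval t f) : Ω) = MvPolynomial.aeval τ f := by
    rw [← hτ']
    exact congrArg Subtype.val (AlgHom.liftOfSurjective_apply _ hsurj _ _ f)
  obtain ⟨χ, hχ⟩ := exists_algHom_adjoin (L := Ω) (B := B) Subtype.val_injective ψ (Set.range z) (by
    rintro _ ⟨i, rfl⟩
    obtain ⟨F, hF, _, ⟨f, rfl⟩, e, h0⟩ := hz i
    rw [eval_map_subtype] at e h0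
    refine ⟨F, hF, fun h1 => h0 ?_⟩
    rw [← hψ, (Subtype.ext ((ht f).trans e) : MvPolynomial.aeval t f = F.leadingCoeff), h1]
    rfl)
  let S := Algebra.adjoin B (Set.range z)
  let w : T ⊕ ι → S := Sum.elim (fun j => algebraMap B S (t j))
    fun i => ⟨z i, Algebra.subset_adjoin ⟨i, rfl⟩⟩
  refine ⟨fun i => χ (w (Sum.inr i)), fun i => SetLike.coe_mem _, ?_⟩
  rintro _ ⟨f, rfl⟩ h0
  rw [eval_map_subtype] at h0 ⊢
  have h1 : (MvPolynomial.aeval w f : S) = 0 := by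
    refine Subtype.ext (Eq.trans ?_ h0)
    rw [show (Sum.elim Subtype.val z : T ⊕ ι → Ω) = fun i => algebraMap S Ω (w i) by
      ext (j | i) <;> rfl]
    exact (MvPolynomial.aeval_algebraMap_apply Ω w f).symm
  have h2 : MvPolynomial.aeval (fun i => χ (w i)) f = 0 := by
    have := MvPolynomial.comp_aeval_apply (f := w) χ f
    rw [← this, h1, map_zero]
  have h3 : (Sum.elim τ (fun i => (χ (w (Sum.inr i)) : Ω)) : T ⊕ ι → Ω) =
      fun i => algebraMap k Ω (χ (w i)) := by
    ext (j | i)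
    · change τ j = (χ (algebraMap B S (t j)) : Ω)
      rw [hχ, ← MvPolynomial.aeval_X (R := k) t j, hψ, MvPolynomial.aeval_X]
    · rfl
  have h4 := MvPolynomial.aeval_algebraMap_apply Ω (fun i => χ (w i)) f
  rw [h2, map_zero] at h4
  rw [h3]
  exact h4

/-- Specialization to algebraically closed fields `k₀ ≤ k`: points of `M`, linearly disjoint
from `k` over `k₀`, specialize to points of `k₀`. -/
theorem exists_specializes [Finite ι] [Finite κ] {k₀ k M : Subfield Ω} (hk₀ : algClosure k₀ ≤ k₀)
    (hk : algClosure k ≤ k) (h0k : k₀ ≤ k) (h0M : k₀ ≤ M) (hld : LinearlyDisjoint k₀ k M)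
    (v : ι → Ω) {s : κ → Ω} (hs : ∀ j, s j ∈ M) {g : MvPolynomial (ι ⊕ κ) Ω}
    (hg : g ∈ polyOver k (ι ⊕ κ)) (h0 : MvPolynomial.eval (Sum.elim v s) g ≠ 0) :
    ∃ (ρ : ι → Ω) (τ : κ → Ω), (∀ i, ρ i ∈ k) ∧ (∀ j, τ j ∈ k₀) ∧
      Specializes k (Sum.elim v s) (Sum.elim ρ τ) ∧
      MvPolynomial.eval (Sum.elim ρ τ) g ≠ 0 := by
  have := Fintype.ofFinite ι
  have hkQ : k ≤ adj k (M : Set Ω) := le_adj _ _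
  have hsQ (j) : s j ∈ adj k (M : Set Ω) := subset_adj _ _ (hs j)
  obtain ⟨g', hg', e⟩ := exists_partial_eval (ι := ι) hsQ (polyOver_mono hkQ hg)
  rw [e] at h0
  -- First v alone is specialized, s being kept fixed: its image is algebraic over the field
  -- generated by k and M.
  obtain ⟨v', hv', hvv', hg0⟩ := exists_specializes_algClosure _ v hg' h0
  rw [← e] at hg0
  set c := MvPolynomial.eval (Sum.elim v' s) g with hc
  have hcQ : c ∈ algClosure (adj k (M : Set Ω)) := by
    refine eval_mem_of_mem_polyOver (polyOver_mono (hkQ.trans (le_algClosure _)) hg) ?_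
    rintro (i | j)
    · exact hv' i
    · exact le_algClosure _ (hsQ j)
  -- The inverse of c = g (v', s) is carried along, so that nonvanishing of g is expressed by an
  -- equation and survives specialization.
  let z : Option ι → Ω := fun o => o.elim c⁻¹ v'
  have hz (o) : z o ∈ algClosure (adj k (M : Set Ω)) := by
    cases o
    · exact inv_mem hcQ
    · exact hv' _
  choose T₀ hT₀ hT₀f hzT₀ using fun o => exists_finite_mem_algClosure_adj (hz o)
  set T : Set Ω := (⋃ o, T₀ o) ∪ Set.range s with hT
  have hTf : T.Finite := (Set.finite_iUnion hT₀f).union (Set.finite_range s)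
  have hTM : T ⊆ M := Set.union_subset (Set.iUnion_subset hT₀) (by rintro _ ⟨j, rfl⟩; exact hs j)
  have := hTf.to_subtype
  have hF (o) : ∃ F : Polynomial (Algebra.adjoin k T), F ≠ 0 ∧ F.aeval (z o) = 0 := by
    have h1 : z o ∈ algClosure (adj k T) := algClosure_mono (adj_mono le_rfl
      ((Set.subset_iUnion T₀ o).trans Set.subset_union_left)) (hzT₀ o)
    exact isAlgebraic_adj_iff.1 (mem_algClosure.1 h1)
  choose F hF0 hFz using hF
  have hH (o) : ∃ H ∈ polyOver k T, MvPolynomial.eval Subtype.val H =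
      ((F o).leadingCoeff : Ω) := by
    obtain ⟨f, hf⟩ := (Algebra.adjoin_eq_range k T).le (F o).leadingCoeff.2
    exact ⟨_, ⟨f, rfl⟩, (eval_map_subtype _ _).trans hf⟩
  choose H hHk hHF using hH
  -- The leading coefficients must stay nonzero at a k₀-point of T. A condition over k₀ that implies
  -- this allows the Nullstellensatz over k₀ to be used.
  obtain ⟨H₀, hH₀k, hH₀0, hH₀⟩ := exists_polyOver_ne_zero h0k (prod_mem fun o (_ : o ∈ Finset.univ) => hHk o)
    (v := (Subtype.val : T → Ω)) (by
      rw [map_prod]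
      refine Finset.prod_ne_zero_iff.2 fun o _ h => hF0 o ?_
      rw [hHF] at h
      exact Polynomial.leadingCoeff_eq_zero.1 (Subtype.ext h))
  obtain ⟨τ, hτ, hτs, hτ0⟩ := exists_specializes_algClosure k₀ (Subtype.val : T → Ω) hH₀k hH₀0
  have hτ0 := hH₀ τ (fun j => hk₀ (hτ j)) hτ0
  rw [map_prod] at hτ0
  obtain ⟨ρ, hρ, hρs⟩ := (hτs.extend hld h0k h0M fun j => hTM j.2).exists_extension hk
    (fun j => h0k (hk₀ (hτ j))) (z := z) fun o => ⟨F o, hFz o, H o, hHk o, hHF o,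
      (Finset.prod_ne_zero_iff.1 hτ0) o (Finset.mem_univ o)⟩
  let e' : ι ⊕ κ → T ⊕ Option ι :=
    Sum.elim (fun i => Sum.inr (some i)) fun j => Sum.inl ⟨s j, Or.inr ⟨j, rfl⟩⟩
  have h1 : (Sum.elim v' s : ι ⊕ κ → Ω) = Sum.elim Subtype.val z ∘ e' := by
    ext (i | j) <;> rfl
  have h2 : (Sum.elim (fun i => ρ (some i)) (fun j => τ ⟨s j, Or.inr ⟨j, rfl⟩⟩) : ι ⊕ κ → Ω) =
      Sum.elim τ ρ ∘ e' := by
    ext (i | j) <;> rfl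
  refine ⟨fun i => ρ (some i), fun j => τ ⟨s j, Or.inr ⟨j, rfl⟩⟩, fun i => hρ _,
    fun j => hk₀ (hτ _), ?_, ?_⟩
  · refine ((hvv'.sumElim hsQ).mono hkQ).trans ?_
    rw [h1, h2]
    exact hρs.comp e'
  · rw [h2, ← MvPolynomial.eval_rename]
    have h3 := hρs (MvPolynomial.rename e' g * MvPolynomial.X (Sum.inr none) - 1)
      (sub_mem (mul_mem (rename_mem_polyOver hg e') (X_mem_polyOver _ _)) (one_mem _)) (by
        rw [map_sub, map_mul, MvPolynomial.eval_rename, ← h1, ← hc, MvPolynomial.eval_X, map_one]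
        change c * c⁻¹ - 1 = 0
        rw [mul_inv_cancel₀ hg0, sub_self])
    intro h4
    rw [map_sub, map_mul, h4, zero_mul, map_one, zero_sub, neg_eq_zero] at h3
    exact one_ne_zero h3

end Specialization

section Specialization

variable {Ω : Type u} [Field Ω]

theorem mem_algClosure_of_sum_eq_zero {K : Subfield Ω} {d : ℕ} {c : Fin (d + 1) → Ω}
    (hc : ∀ j, c j ∈ K) (h0 : c (Fin.last d) ≠ 0) {x : Ω} (hx : ∑ j, c j * x ^ (j : ℕ) = 0) :
    x ∈ algClosure K := by
  have hcoeff (n : ℕ) : (∑ j, Polynomial.C (c j) * Polynomial.X ^ (j : ℕ)).coeff n =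
      ∑ j : Fin (d + 1), if n = j then c j else 0 := by
    simp only [Polynomial.finsetSum_coeff, Polynomial.coeff_C_mul_X_pow]
  refine mem_algClosure_iff_polynomial.2
    ⟨∑ j, Polynomial.C (c j) * Polynomial.X ^ (j : ℕ), fun h => h0 ?_, fun n => ?_, ?_⟩
  · have h1 := hcoeff d
    rw [h, Polynomial.coeff_zero, Finset.sum_eq_single (Fin.last d)] at h1
    · simpa using h1.symm
    · intro j _ hj
      exact if_neg fun e => hj (Fin.ext e.symm)
    · simp
  · rw [hcoeff]
    refine sum_mem fun j _ => ?_
    split_ifs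
    exacts [hc j, zero_mem K]
  · simpa [Polynomial.eval_finsetSum] using hx

theorem eval_sum_basis {ι β : Type*} [DecidableEq β] (b : β → Ω) (g : β →₀ MvPolynomial ι Ω)
    {T : Finset β} (hT : g.support ⊆ T) (w : ι → Ω) :
    MvPolynomial.eval w (g.sum fun i p => MvPolynomial.C (b i) * p) =
      ∑ i ∈ T, b i * MvPolynomial.eval w (g i) := by
  rw [Finsupp.sum_of_support_subset _ hT _ (by simp), map_sum]
  simp

theorem sum_C_mul_X_mem_polyOver {ι : Type*} {K : Subfield Ω} {n : ℕ} {a : Fin n → Ω}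
    (ha : ∀ i, a i ∈ K) (e : Fin n → ι) :
    ∑ i, MvPolynomial.C (a i) * MvPolynomial.X (e i) ∈ polyOver K ι :=
  sum_mem fun i _ => mul_mem (C_mem_polyOver (ha i)) (X_mem_polyOver _ _)

theorem eval_sum_C_mul_X {ι : Type*} {n : ℕ} (a : Fin n → Ω) (e : Fin n → ι) (w : ι → Ω) :
    MvPolynomial.eval w (∑ i, MvPolynomial.C (a i) * MvPolynomial.X (e i)) =
      ∑ i, a i * w (e i) := by
  simp

/-- Elements of a free compositum which are algebraic over smaller fields are determined by the
values of specializations. -/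
theorem mem_sup_of_mem_algClosure [IsAlgClosed Ω] {k₀ k M₁ M₂ L₁ L₂ : Subfield Ω}
    (hk₀ : algClosure k₀ ≤ k₀) (hk : algClosure k ≤ k) (h0k : k₀ ≤ k) (h0M₁ : k₀ ≤ M₁)
    (h0M₂ : k₀ ≤ M₂) (hM₁ : M₁ ≤ L₁) (hM₂ : M₂ ≤ L₂) (hkL₁ : k ≤ L₁) (hkL₂ : k ≤ L₂)
    (hld₀ : LinearlyDisjoint k₀ k M₂) (hld : LinearlyDisjoint k L₁ L₂)
    (hrel : ∀ x ∈ L₁, x ∈ algClosure M₁ → x ∈ M₁) {x : Ω} (hx : x ∈ L₁ ⊔ L₂)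
    (ha : x ∈ algClosure (M₁ ⊔ M₂)) : x ∈ (M₁ ⊔ k) ⊔ L₂ := by
  classical
  obtain ⟨y, hy, z, hz, rfl⟩ := mem_sup_iff_div.1 hx
  by_cases hz0 : z = 0
  · rw [hz0, div_zero]
    exact zero_mem _
  obtain ⟨n, a, r, haL, hr, hyr⟩ := mem_span_subfield_iff.1 hy
  obtain ⟨n', a', r', haL', hr', hzr⟩ := mem_span_subfield_iff.1 hz
  obtain ⟨p, hp0, hpM, hpx⟩ := mem_algClosure_iff_polynomial.1 ha
  set d := p.natDegree
  -- After multiplication by e the coefficients of the equation of x are bilinear expressions in M₁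
  -- and M₂, so they become linear polynomials P j over M₁ evaluated in M₂.
  obtain ⟨e, he0, he⟩ := exists_common_denominator (K := M₁) (L := M₂)
    (f := fun j : Fin (d + 1) => p.coeff j) fun j => hpM j
  choose m c l hc hl hcl using fun j => mem_span_subfield_iff.1 (he j)
  let ι := Fin n ⊕ Fin n'
  let κ := Σ j : Fin (d + 1), Fin (m j)
  let v : ι → Ω := Sum.elim r r'
  let s : κ → Ω := fun q => l q.1 q.2
  have hs (j) : s j ∈ M₂ := hl _ _
  let w : ι ⊕ κ → Ω := Sum.elim v s
  have hw (i) : w i ∈ L₂ := by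
    rcases i with (i | i) | i
    exacts [hr i, hr' i, hM₂ (hs i)]
  let N : MvPolynomial (ι ⊕ κ) Ω :=
    ∑ i, MvPolynomial.C (a i) * MvPolynomial.X (Sum.inl (Sum.inl i))
  let D : MvPolynomial (ι ⊕ κ) Ω :=
    ∑ i, MvPolynomial.C (a' i) * MvPolynomial.X (Sum.inl (Sum.inr i))
  let P (j : Fin (d + 1)) : MvPolynomial (ι ⊕ κ) Ω :=
    ∑ i, MvPolynomial.C (c j i) * MvPolynomial.X (Sum.inr ⟨j, i⟩)
  have hN : N ∈ polyOver L₁ _ := sum_C_mul_X_mem_polyOver haL _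
  have hD : D ∈ polyOver L₁ _ := sum_C_mul_X_mem_polyOver haL' _
  have hP (j) : P j ∈ polyOver M₁ _ := sum_C_mul_X_mem_polyOver (hc j) _
  have hPL (j) : P j ∈ polyOver L₁ _ := polyOver_mono hM₁ (hP j)
  have hNw : MvPolynomial.eval w N = y := (eval_sum_C_mul_X _ _ _).trans hyr
  have hDw : MvPolynomial.eval w D = z := (eval_sum_C_mul_X _ _ _).trans hzr
  have hPw (j) : MvPolynomial.eval w (P j) = p.coeff j * e :=
    (eval_sum_C_mul_X _ _ _).trans (hcl j)
  set K := M₁ ⊔ k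
  have hKL : K ≤ L₁ := sup_le hM₁ hkL₁
  obtain ⟨β, b, hbL, hbi, hb⟩ := exists_basis_subfield hKL
  obtain ⟨gN, hgN, hNg⟩ := exists_basis_expansion hb hN
  obtain ⟨gD, hgD, hDg⟩ := exists_basis_expansion hb hD
  set T := gN.support ∪ gD.support with hT
  have hNT (u : ι ⊕ κ → Ω) : MvPolynomial.eval u N =
      ∑ i ∈ T, b i * MvPolynomial.eval u (gN i) := by
    rw [hNg, eval_sum_basis b gN Finset.subset_union_left]
  have hDT (u : ι ⊕ κ → Ω) : MvPolynomial.eval u D =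
      ∑ i ∈ T, b i * MvPolynomial.eval u (gD i) := by
    rw [hDg, eval_sum_basis b gD Finset.subset_union_right]
  by_contra hxK
  -- Here x = N(w) / D(w). If all 2 × 2 minors of the coordinate vectors over `K = M₁ ⊔ k` vanished
  -- at w, these vectors would be proportional and x would be a ratio of coordinates, which lies in
  -- `K ⊔ L₂`.
  obtain ⟨i, j, hij⟩ : ∃ i j, MvPolynomial.eval w (gN i * gD j - gN j * gD i) ≠ 0 := by
    by_contra! h
    have h1 : ∑ i ∈ T, b i * MvPolynomial.eval w (gD i) ≠ 0 := by
      rw [← hDT, hDw]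
      exact hz0
    obtain ⟨j, -, hj⟩ := Finset.exists_ne_zero_of_sum_ne_zero h1
    have hj := right_ne_zero_of_mul hj
    have hmem (f : MvPolynomial (ι ⊕ κ) Ω) (hf : f ∈ polyOver K _) :
        MvPolynomial.eval w f ∈ K ⊔ L₂ :=
      eval_mem_of_mem_polyOver (polyOver_mono le_sup_left hf)
        fun i => (le_sup_right : L₂ ≤ K ⊔ L₂) (hw i)
    refine hxK ?_
    have h2 : y / z = MvPolynomial.eval w (gN j) / MvPolynomial.eval w (gD j) := by
      rw [div_eq_div_iff hz0 hj, ← hNw, ← hDw, hNT, hDT, Finset.sum_mul, Finset.mul_sum]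
      refine Finset.sum_congr rfl fun i _ => ?_
      have h3 := h i j
      rw [map_sub, map_mul, map_mul] at h3
      linear_combination (b i) * h3
    rw [h2]
    exact div_mem (hmem _ (hgN j)) (hmem _ (hgD j))
  have hlast : MvPolynomial.eval w (P (Fin.last d)) ≠ 0 := by
    rw [hPw]
    exact mul_ne_zero (Polynomial.leadingCoeff_ne_zero.2 hp0) he0
  -- One condition over k protects the denominator, the leading coefficient of the equation and the
  -- nonzero minor.
  obtain ⟨g, hg, hg0, hgu⟩ := exists_polyOver_ne_zero (v := w) hkL₁
    (mul_mem (mul_mem hD (hPL (Fin.last d)))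
      (sub_mem (mul_mem (polyOver_mono hKL (hgN i)) (polyOver_mono hKL (hgD j)))
        (mul_mem (polyOver_mono hKL (hgN j)) (polyOver_mono hKL (hgD i))))) (by
      rw [map_mul, map_mul, hDw]
      exact mul_ne_zero (mul_ne_zero hz0 hlast) hij)
  obtain ⟨ρ, τ, hρ, hτ, hspec, hu0⟩ :=
    exists_specializes hk₀ hk h0k h0M₂ hld₀ v hs hg hg0
  set u : ι ⊕ κ → Ω := Sum.elim ρ τ
  have huk (i) : u i ∈ k := by
    rcases i with i | i
    exacts [hρ i, h0k (hτ i)]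
  have hGu := hgu u huk hu0
  rw [map_mul, map_mul] at hGu
  have hDu := left_ne_zero_of_mul (left_ne_zero_of_mul hGu)
  have hspecL : Specializes L₁ w u := hspec.extend hld hkL₁ hkL₂ hw
  have hPu (j) : MvPolynomial.eval u (P j) ∈ M₁ := by
    rw [show P j = ∑ i, MvPolynomial.C (c j i) * MvPolynomial.X (Sum.inr ⟨j, i⟩) from rfl,
      eval_sum_C_mul_X]
    exact sum_mem fun i _ => mul_mem (hc j i) (h0M₁ (hτ _))
  set Y := MvPolynomial.eval u N / MvPolynomial.eval u D with hY
  have hYL : Y ∈ L₁ := div_mem (eval_mem_of_mem_polyOver hN fun i => hkL₁ (huk i))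
    (eval_mem_of_mem_polyOver hD fun i => hkL₁ (huk i))
  -- The equation of x, multiplied by e * z^d, is polynomial in w and specializes. So the value Y,
  -- which is in L₁, is algebraic over M₁, hence in M₁.
  have hYM : Y ∈ M₁ := by
    refine hrel Y hYL (mem_algClosure_of_sum_eq_zero hPu
      (right_ne_zero_of_mul (left_ne_zero_of_mul hGu)) ?_)
    have h1 := hspecL (∑ j, P j * N ^ (j : ℕ) * D ^ (d - j))
      (sum_mem fun j _ => mul_mem (mul_mem (hPL j) (pow_mem hN _)) (pow_mem hD _)) (by
        simp only [map_sum, map_mul, map_pow, hPw, hNw, hDw]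
        rw [Polynomial.eval_eq_sum_range, Finset.sum_range] at hpx
        have h2 : ∑ j : Fin (d + 1), p.coeff j * e * y ^ (j : ℕ) * z ^ (d - j) =
            e * z ^ d * ∑ j : Fin (d + 1), p.coeff j * (y / z) ^ (j : ℕ) := by
          rw [Finset.mul_sum]
          refine Finset.sum_congr rfl fun j _ => ?_
          rw [div_pow, ← pow_sub_mul_pow z (Nat.lt_succ_iff.1 j.2)]
          field_simp
        rw [h2, hpx, mul_zero])
    simp only [map_sum, map_mul, map_pow] at h1
    have h3 : MvPolynomial.eval u D ^ d * ∑ j, MvPolynomial.eval u (P j) * Y ^ (j : ℕ) = 0 := by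
      rw [← h1, Finset.mul_sum]
      refine Finset.sum_congr rfl fun j _ => ?_
      rw [hY, div_pow, ← pow_sub_mul_pow _ (Nat.lt_succ_iff.1 j.2)]
      field_simp
    exact (mul_eq_zero.1 h3).resolve_left (pow_ne_zero _ hDu)
  -- As Y belongs to K, the equality N(u) = Y * D(u) holds coordinate by coordinate. All minors then
  -- vanish at u, contrary to the choice of u.
  have hcoord (i) : MvPolynomial.eval u (gN i) = Y * MvPolynomial.eval u (gD i) := by
    by_cases hi : i ∈ T
    · have hK (f) (hf : f ∈ polyOver K _) : MvPolynomial.eval u f ∈ K :=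
        eval_mem_of_mem_polyOver hf fun i => (le_sup_right : k ≤ K) (huk i)
      have h1 := linearIndependent_iff'.1 hbi T (fun i => ⟨MvPolynomial.eval u (gN i) -
        Y * MvPolynomial.eval u (gD i), sub_mem (hK _ (hgN i))
          (mul_mem ((le_sup_left : M₁ ≤ K) hYM) (hK _ (hgD i)))⟩) (by
        have h2 : MvPolynomial.eval u N - Y * MvPolynomial.eval u D = 0 := by
          rw [hY, div_mul_cancel₀ _ hDu, sub_self]
        rw [hNT, hDT, Finset.mul_sum, ← Finset.sum_sub_distrib] at h2
        rw [← h2]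
        refine Finset.sum_congr rfl fun i _ => ?_
        rw [Subfield.smul_def, smul_eq_mul]
        ring) i hi
      exact sub_eq_zero.1 (congrArg Subtype.val h1)
    · rw [hT, Finset.mem_union, not_or, Finsupp.notMem_support_iff,
        Finsupp.notMem_support_iff] at hi
      rw [hi.1, hi.2, map_zero, mul_zero]
  refine right_ne_zero_of_mul hGu ?_
  rw [map_sub, map_mul, map_mul, hcoord, hcoord]
  ring

end Specialization

/-! ### Linearly free composita -/

section PerfectHull

variable {Ω : Type u} [Field Ω] {p : ℕ} [ExpChar Ω p]

/-- A large power of Frobenius brings a relation down to B and C, and A' contains all p^n-th roots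
of elements of A. This transfers disjointness to perfect closures. -/
theorem LinearlyDisjoint.of_pow {A B C A' B' C' : Subfield Ω} (h : LinearlyDisjoint A B C)
    (hA : ∀ d ∈ A, ∀ n : ℕ, ∃ y ∈ A', y ^ p ^ n = d) (hB : ∀ b ∈ B', ∃ n : ℕ, b ^ p ^ n ∈ B)
    (hC : ∀ c ∈ C', ∃ n : ℕ, c ^ p ^ n ∈ C) : LinearlyDisjoint A' B' C' := by
  rw [linearlyDisjoint_iff_sum]
  intro m a c ha hc hi hs k
  choose n hn using fun k => hB _ (ha k)
  choose n' hn' using fun k => hC _ (hc k)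
  obtain ⟨N, hN⟩ := (Set.finite_range n).bddAbove
  obtain ⟨N', hN'⟩ := (Set.finite_range n').bddAbove
  have hle {D : Subfield Ω} {x : Ω} {i j : ℕ} (hij : i ≤ j) (hx : x ^ p ^ i ∈ D) :
      x ^ p ^ j ∈ D := by
    obtain ⟨d, rfl⟩ := Nat.exists_eq_add_of_le hij
    rw [pow_add, pow_mul]
    exact pow_mem hx _
  set M := max N N'
  have h1 : LinearIndependent A fun k => a k ^ p ^ M := by
    rw [linearIndependent_subfield_iff] at hi ⊢
    intro g hg hgs k
    choose y hy hyg using fun k => hA _ (hg k) M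
    simp only [← hyg] at hgs ⊢
    rw [← sum_pow_expChar_pow] at hgs
    rw [hi y hy ((pow_eq_zero_iff (expChar_pow_pos Ω p M).ne').1 hgs) k,
      zero_pow (expChar_pow_pos Ω p M).ne']
  have h2 := linearlyDisjoint_iff_sum.1 h m _ (fun k => c k ^ p ^ M)
    (fun k => hle ((hN ⟨k, rfl⟩).trans (le_max_left _ _)) (hn k))
    (fun k => hle ((hN' ⟨k, rfl⟩).trans (le_max_right _ _)) (hn' k)) h1 (by
      rw [← sum_pow_expChar_pow, hs, zero_pow (expChar_pow_pos Ω p M).ne']) k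
  exact (pow_eq_zero_iff (expChar_pow_pos Ω p M).ne').1 h2

theorem linearlyDisjoint_self_left {A C : Subfield Ω} (h : A ≤ C) : LinearlyDisjoint A A C :=
  LinearlyDisjoint.symm (fun _ _ _ hi => hi) h le_rfl

theorem sepClosure_fieldRange_le {F : Type u} [Field F] [IsSepClosed F] (f : F →+* Ω) :
    sepClosure f.fieldRange ≤ f.fieldRange := by
  intro x hx
  have h1 := mem_sepClosure.1 hx
  let e : F ≃+* f.fieldRange := f.rangeRestrictFieldEquiv
  set q := (minpoly f.fieldRange x).map (e.symm : f.fieldRange →+* F)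
  have hq : q.Separable := Polynomial.Separable.map h1
  have hqf : q.map f = (minpoly f.fieldRange x).map f.fieldRange.subtype := by
    rw [Polynomial.map_map]
    congr 1
    ext y
    exact congrArg Subtype.val (e.apply_symm_apply y)
  have hqx : (q.map f).eval x = 0 := by
    rw [hqf]
    have := minpoly.aeval f.fieldRange x
    rwa [← Polynomial.eval_map_algebraMap] at this
  obtain ⟨y, rfl⟩ := (IsSepClosed.splits_of_separable q hq).mem_range_of_isRoot hq.ne_zero hqx
  exact ⟨y, rfl⟩

end PerfectHull

/-! ### The compositum of linearly disjoint models -/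

section

variable {Ω : Type u} [Field Ω] [DifferenceField Ω]

/-- The characteristic exponent. -/
local notation "𝔭" => ringExpChar Ω

theorem twistClosed_sup_eq_top {A₁ A₂ : Subfield Ω} (h₁ : TwistClosed A₁) (h₂ : TwistClosed A₂)
    (h : A₁ ⊔ A₂ = ⊤) : TwistClosed (⊤ : Subfield Ω) := by
  intro x _ n
  have h1 : A₁ ⊔ A₂ ≤ (frob 𝔭 n ⊤).comap σ := sup_le
    (fun x hx => (h₁ x hx n).elim fun y hy => mem_frob.2 ⟨y, trivial, hy.2⟩)
    fun x hx => (h₂ x hx n).elim fun y hy => mem_frob.2 ⟨y, trivial, hy.2⟩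
  have h2 : x ∈ (frob 𝔭 n ⊤).comap σ := h1 (h ▸ trivial)
  exact mem_frob.1 h2

/-- A p^n-th power of an algebraic element is separable over the image of σ(D), hence lies in it;
its root is in the image of the perfect field `tw D`. -/
theorem algClosure_map_tw_le {Ω' : Type u} [Field Ω'] (j : Ω →+* Ω') {D : Subfield Ω}
    (hD : TwistClosed D) (h : sepClosure ((D.map σ).map j) ≤ (D.map σ).map j) :
    algClosure ((tw D).map j) ≤ (tw D).map j := by
  have : ExpChar Ω' 𝔭 := ringExpChar_eq_of_ringHom j ▸ inferInstance
  intro x hx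
  have h1 : x ∈ algClosure ((D.map σ).map j) := by
    refine algClosure_le ?_ hx
    rintro _ ⟨y, hy, rfl⟩
    exact map_mem_algClosure j (tw_le_algClosure D hy)
  obtain ⟨n, hn⟩ := exists_pow_mem_sepClosure 𝔭 h1
  obtain ⟨y, hy, e⟩ := Subfield.mem_map.1 (h hn)
  obtain ⟨z, hz, hzy⟩ := hD.exists_root (map_le_tw D hy) n
  refine Subfield.mem_map.2 ⟨z, hz, pow_expChar_pow_injective 𝔭 n ?_⟩
  change j z ^ 𝔭 ^ n = x ^ 𝔭 ^ n
  rw [← map_pow, hzy, e]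

omit [DifferenceField Ω] in
theorem algClosure_insepClosure_le {K : Subfield Ω} (h : sepClosure K ≤ K) :
    algClosure (insepClosure K) ≤ insepClosure K := by
  intro x hx
  obtain ⟨n, hn⟩ := exists_pow_mem_sepClosure 𝔭 (algClosure_le (insepClosure_le_algClosure K) hx)
  exact (mem_insepClosure 𝔭).2 ⟨n, h hn⟩

theorem ModelSubfield.mem_map_tw_of_mem_algClosure {Ω' : Type u} [Field Ω'] (j : Ω →+* Ω')
    {D : Subfield Ω} (h : ModelSubfield D) {x : Ω'} (hx : x ∈ insepClosure (D.map j))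
    (ha : x ∈ algClosure ((tw D).map j)) : x ∈ (tw D).map j := by
  have : ExpChar Ω' 𝔭 := ringExpChar_eq_of_ringHom j ▸ inferInstance
  obtain ⟨n, hn⟩ := (mem_insepClosure 𝔭).1 hx
  obtain ⟨b, hb, e⟩ := Subfield.mem_map.1 hn
  have h1 : b ∈ tw D := h.mem_tw_of_mem_algClosure hb
    (mem_algClosure_of_map j (e ▸ pow_mem ha _))
  obtain ⟨z, hz, hzb⟩ := h.twistClosed.exists_root h1 n
  refine Subfield.mem_map.2 ⟨z, hz, pow_expChar_pow_injective 𝔭 n ?_⟩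
  change j z ^ 𝔭 ^ n = x ^ 𝔭 ^ n
  rw [← map_pow, hzb, e]

theorem TransSep.linearlyDisjoint_map_tw {Ω' : Type u} [Field Ω'] (j : Ω →+* Ω')
    {F D : Subfield Ω} (h : TransSep F D) (hF : TwistClosed F) :
    LinearlyDisjoint ((tw F).map j) (insepClosure (F.map j)) ((tw D).map j) := by
  have : ExpChar Ω' 𝔭 := ringExpChar_eq_of_ringHom j ▸ inferInstance
  refine ((linearlyDisjoint_map_iff j).2 (h.linearlyDisjoint_tw hF)).of_pow (p := 𝔭) ?_
    (fun b hb => (mem_insepClosure 𝔭).1 hb) fun c hc => ⟨0, by simpa using hc⟩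
  intro d hd n
  obtain ⟨e, he, rfl⟩ := Subfield.mem_map.1 hd
  obtain ⟨y, hy, hye⟩ := hF.exists_root he n
  exact ⟨j y, Subfield.mem_map.2 ⟨y, hy, rfl⟩, by rw [← map_pow, hye]⟩

omit [DifferenceField Ω] in
theorem LinearlyDisjoint.insepClosure_map {Ω' : Type u} [Field Ω'] [IsAlgClosed Ω'] (j : Ω →+* Ω')
    {A B C : Subfield Ω} (h : LinearlyDisjoint A B C) : LinearlyDisjoint (insepClosure (A.map j))
      (insepClosure (B.map j)) (insepClosure (C.map j)) := by
  refine ((linearlyDisjoint_map_iff j).2 h).of_pow (p := ringExpChar Ω') ?_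
    (fun b hb => (mem_insepClosure _).1 hb) fun b hb => (mem_insepClosure _).1 hb
  intro d hd n
  obtain ⟨y, hy⟩ := IsAlgClosed.exists_pow_nat_eq d (expChar_pow_pos Ω' (ringExpChar Ω') n)
  exact ⟨y, (mem_insepClosure (ringExpChar Ω')).2 ⟨n, hy ▸ hd⟩, hy⟩

/-- The compositum of linearly disjoint models of FE which are transformally separable over a
separably closed model of FE is a model of FE. -/
theorem modelSubfield_sup_of_linearlyDisjoint {A A₁ A₂ : Subfield Ω} (hA : TwistClosed A)
    (hsc : ∀ (Ω' : Type u) [Field Ω'] (f : Ω →+* Ω'), sepClosure (A.map f) ≤ A.map f)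
    (h₁ : ModelSubfield A₁) (h₂ : ModelSubfield A₂) (hA₁ : A ≤ A₁) (hA₂ : A ≤ A₂)
    (hs₁ : TransSep A A₁) (hs₂ : TransSep A A₂) (hld : LinearlyDisjoint A A₁ A₂)
    (htop : A₁ ⊔ A₂ = ⊤) : ModelSubfield (⊤ : Subfield Ω) := by
  refine ⟨twistClosed_sup_eq_top h₁.1 h₂.1 htop, fun x _ hx => ?_⟩
  -- The specialization argument needs algebraically closed constants, so the separably closed A and
  -- the fields A₁, A₂ are replaced by their perfect closures in an algebraic closure.
  let j : Ω →+* AlgebraicClosure Ω := algebraMap _ _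
  have hk₀ : algClosure ((tw A).map j) ≤ (tw A).map j := by
    refine algClosure_map_tw_le j hA ?_
    rw [Subfield.map_map]
    exact hsc _ _
  have hk : algClosure (insepClosure (A.map j)) ≤ insepClosure (A.map j) :=
    algClosure_insepClosure_le (hsc _ _)
  have hle {D : Subfield Ω} (hD : TwistClosed D) : (tw D).map j ≤ insepClosure (D.map j) :=
    (map_subfield_mono hD.tw_le).trans (le_insepClosure _)
  have hins {D E : Subfield Ω} (h : D ≤ E) : insepClosure (D.map j) ≤ insepClosure (E.map j) :=
    insepClosure_mono (map_subfield_mono h)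
  have htw {D E : Subfield Ω} (h : D ≤ E) : (tw D).map j ≤ (tw E).map j :=
    map_subfield_mono (tw_mono h)
  have hld' := hld.insepClosure_map j
  have hsup : j x ∈ insepClosure (A₁.map j) ⊔ insepClosure (A₂.map j) := by
    refine sup_le_sup (le_insepClosure _) (le_insepClosure _) ?_
    rw [← Subfield.map_sup, htop]
    exact ⟨x, trivial, rfl⟩
  have hσ : (⊤ : Subfield Ω).map σ ≤ tw A₁ ⊔ tw A₂ := by
    rw [← htop, Subfield.map_sup]
    exact sup_le_sup (map_le_tw _) (map_le_tw _)
  have halg : j x ∈ algClosure ((tw A₁).map j ⊔ (tw A₂).map j) := by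
    rw [← Subfield.map_sup]
    exact map_mem_algClosure j (algClosure_mono hσ (sepClosure_le_algClosure _ hx))
  -- First application: A₁ is lowered to `tw A₁`, the constants being `tw A` inside the perfect
  -- closure of A.
  have hx₁ := mem_sup_of_mem_algClosure hk₀ hk (hle hA) (htw hA₁) (htw hA₂) (hle h₁.1) (hle h₂.1)
    (hins hA₁) (hins hA₂) (hs₂.linearlyDisjoint_map_tw j hA) hld'
    (fun y hy hy' => h₁.mem_map_tw_of_mem_algClosure j hy hy') hsup halg
  have hx₁' : j x ∈ insepClosure (A₂.map j) ⊔ (tw A₁).map j :=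
    sup_le (sup_le le_sup_right ((hins hA₂).trans le_sup_left)) le_sup_left hx₁
  have hld₂ : LinearlyDisjoint ((tw A).map j) (insepClosure (A₂.map j)) ((tw A₁).map j) := by
    refine LinearlyDisjoint.symm (LinearlyDisjoint.trans
      ((hs₁.linearlyDisjoint_map_tw j hA).symm (hle hA) (htw hA₁))
      (hld'.mono (sup_le (hle h₁.1) (hins hA₁)) le_rfl)) (htw hA₁) ((hle hA).trans (hins hA₂))
  -- Second application, with the roles exchanged and both fields of constants equal to `tw A`: A₂
  -- is lowered to `tw A₂`.
  have hx₂ := mem_sup_of_mem_algClosure hk₀ hk₀ le_rfl (htw hA₂) (htw hA₁) (hle h₂.1) le_rfl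
    ((htw hA₂).trans (hle h₂.1)) (htw hA₁) (linearlyDisjoint_self_left (htw hA₁)) hld₂
    (fun y hy hy' => h₂.mem_map_tw_of_mem_algClosure j hy hy') hx₁'
    (by rwa [sup_comm])
  have hx₃ : j x ∈ (tw A₁ ⊔ tw A₂).map j := by
    rw [Subfield.map_sup]
    exact sup_le (sup_le le_sup_right ((htw hA₁).trans le_sup_left)) le_sup_left hx₂
  obtain ⟨y, hy, e⟩ := Subfield.mem_map.1 hx₃
  obtain rfl := j.injective e
  -- The element now lies in `tw ⊤`, so it is purely inseparable as well as separable over the image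
  -- of σ.
  obtain ⟨n, hn⟩ := (mem_insepClosure 𝔭).1 (sup_le (tw_mono le_top) (tw_mono le_top) hy :
    y ∈ tw ⊤)
  exact mem_of_mem_sepClosure_of_pow_mem (p := 𝔭) hx hn

end

/-! ### Free composita of abstract models -/

section

variable {A A₁ A₂ B : Type u} [Field A] [DifferenceField A] [Field A₁] [DifferenceField A₁]
  [Field A₂] [DifferenceField A₂] [Field B] [DifferenceField B] [Algebra A A₁]
  [IsDifferenceExtension A A₁] [Algebra A A₂] [IsDifferenceExtension A A₂] [Algebra A B]

theorem IsLinearlyFreeCompositum.isModel {i₁ : A₁ →ₐ[A] B} {i₂ : A₂ →ₐ[A] B}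
    (h : IsLinearlyFreeCompositum i₁ i₂) (hA : IsModel A) [IsSepClosed A] (h₁ : IsModel A₁)
    (h₂ : IsModel A₂) (hs₁ : IsTransformallySeparable A A₁)
    (hs₂ : IsTransformallySeparable A A₂) : IsModel B := by
  have e₁ : (i₁ : A₁ →+* B).comp (algebraMap A A₁) = algebraMap A B := i₁.comp_algebraMap
  have e₂ : (i₂ : A₂ →+* B).comp (algebraMap A A₂) = algebraMap A B := i₂.comp_algebraMap
  have hAB : IsDifferenceHom (algebraMap A B) :=
    e₁ ▸ h.isDifferenceHom_left.comp (isDifferenceHom_algebraMap A A₁)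
  rw [isTransformallySeparable_iff h.isDifferenceHom_left, e₁] at hs₁
  rw [isTransformallySeparable_iff h.isDifferenceHom_right, e₂] at hs₂
  rw [isModel_iff_top]
  refine modelSubfield_sup_of_linearlyDisjoint ((isModel_iff hAB).1 hA).1 ?_
    ((isModel_iff h.isDifferenceHom_left).1 h₁) ((isModel_iff h.isDifferenceHom_right).1 h₂)
    ?_ ?_ hs₁ hs₂ h.linearlyDisjoint ?_
  · intro Ω' _ f
    rw [← fieldRange_comp]
    exact sepClosure_fieldRange_le _
  · rw [← e₁]
    rintro _ ⟨y, rfl⟩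
    exact ⟨_, rfl⟩
  · rw [← e₂]
    rintro _ ⟨y, rfl⟩
    exact ⟨_, rfl⟩
  · refine h.generates _ (fun x hx => ?_) (fun x => ?_) fun x => ?_
    · have := sup_le_sup h.isDifferenceHom_left.map_fieldRange_le
        h.isDifferenceHom_right.map_fieldRange_le
      rw [← Subfield.map_sup] at this
      exact this ⟨x, hx, rfl⟩
    · exact (le_sup_left : (i₁ : A₁ →+* B).fieldRange ≤ _) ⟨x, rfl⟩
    · exact (le_sup_right : (i₂ : A₂ →+* B).fieldRange ≤ _) ⟨x, rfl⟩

end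

/-! ### Existence of the free compositum -/

section TensorProduct

open TensorProduct

theorem eq_zero_of_sum_tmul_eq_zero {A M N : Type*} [Field A] [AddCommGroup M] [Module A M]
    [AddCommGroup N] [Module A N] {n : ℕ} {a : Fin n → M} {b : Fin n → N}
    (hb : LinearIndependent A b) (h : ∑ k, a k ⊗ₜ[A] b k = 0) (k : Fin n) : a k = 0 := by
  classical
  obtain ⟨g, hg⟩ := LinearMap.exists_leftInverse_of_injective
    (Finsupp.linearCombination A b) (LinearMap.ker_eq_bot.2 hb)
  let φ : N →ₗ[A] A := (Finsupp.lapply k).comp g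
  have hφ (l) : φ (b l) = if l = k then 1 else 0 := by
    have : g (b l) = Finsupp.single l 1 := by
      simpa using LinearMap.congr_fun hg (Finsupp.single l 1)
    simp [φ, this, Finsupp.single_apply]
  have := congrArg (fun x => TensorProduct.rid A M (φ.lTensor M x)) h
  simpa [hφ] using this

theorem eq_zero_of_sum_tmul_eq_zero_left {A M N : Type*} [Field A] [AddCommGroup M] [Module A M]
    [AddCommGroup N] [Module A N] {n : ℕ} {a : Fin n → M} {b : Fin n → N}
    (ha : LinearIndependent A a) (h : ∑ k, a k ⊗ₜ[A] b k = 0) (k : Fin n) : b k = 0 := by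
  refine eq_zero_of_sum_tmul_eq_zero ha ?_ k
  simpa using congrArg (TensorProduct.comm A M N) h

variable {A A₁ A₂ : Type*} [Field A] [Field A₁] [Field A₂] [Algebra A A₁] [Algebra A A₂]

theorem exists_ringHom_tensorProduct {T : Type*} [CommRing T] (u : A₁ →+* T) (v : A₂ →+* T)
    (h : ∀ c, u (algebraMap A A₁ c) = v (algebraMap A A₂ c)) :
    ∃ w : A₁ ⊗[A] A₂ →+* T, ∀ a b, w (a ⊗ₜ b) = u a * v b := by
  let _ : Algebra A T := (u.comp (algebraMap A A₁)).toAlgebra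
  let u' : A₁ →ₐ[A] T := { u with commutes' := fun _ => rfl }
  let v' : A₂ →ₐ[A] T := { v with commutes' := fun c => (h c).symm }
  exact ⟨(Algebra.TensorProduct.productMap u' v' : A₁ ⊗[A] A₂ →ₐ[A] T), fun a b =>
    Algebra.TensorProduct.productMap_apply_tmul u' v' a b⟩

theorem injective_ringHom_tensorProduct {T : Type*} [CommRing T] {u : A₁ → T} {v : A₂ → T}
    {w : A₁ ⊗[A] A₂ →+* T} (hw : ∀ a b, w (a ⊗ₜ b) = u a * v b)
    (h : ∀ (n : ℕ) (a : Fin n → A₁) (b : Fin n → A₂), LinearIndependent A b →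
      ∑ k, u (a k) * v (b k) = 0 → ∀ k, a k = 0) : Function.Injective w := by
  rw [injective_iff_map_eq_zero]
  intro x hx
  let e := Algebra.TensorProduct.basis A₁ (Module.Basis.ofVectorSpace A A₂)
  let E := (e.repr x).support.equivFin
  have hsum : x = ∑ k, e.repr x (E.symm k) ⊗ₜ[A] Module.Basis.ofVectorSpace A A₂ (E.symm k) := by
    rw [E.symm.sum_comp fun i => e.repr x i ⊗ₜ[A] Module.Basis.ofVectorSpace A A₂ i]
    conv_lhs => rw [← e.linearCombination_repr x, Finsupp.linearCombination_apply, Finsupp.sum,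
      ← Finset.sum_coe_sort]
    refine Finset.sum_congr rfl fun k _ => ?_
    simp [e, TensorProduct.smul_tmul']
  have h0 := h _ (fun k => e.repr x (E.symm k)) (fun k => Module.Basis.ofVectorSpace A A₂ (E.symm k))
    ((Module.Basis.ofVectorSpace A A₂).linearIndependent.comp _
      (Subtype.val_injective.comp E.symm.injective)) (by
        rw [hsum, map_sum] at hx
        simpa only [hw] using hx)
  rw [hsum]
  exact Finset.sum_eq_zero fun k _ => by rw [h0 k, zero_tmul]

variable [DifferenceField A] [DifferenceField A₁] [DifferenceField A₂]
  [IsDifferenceExtension A A₁] [IsDifferenceExtension A A₂]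

/-- σ carries independence over A to independence over σ(A), and transformal separability raises it
back to A. -/
theorem IsTransformallySeparable.linearIndependent_sigma (h : IsTransformallySeparable A A₂)
    {n : ℕ} {b : Fin n → A₂} (hb : LinearIndependent A b) :
    LinearIndependent A fun k => σ (b k) := by
  have hc (c : A) : algebraMap A A₂ (σ c) = σ (algebraMap A A₂ c) :=
    isDifferenceHom_algebraMap A A₂ c
  have h' := LinearlyDisjoint.symm h (by rintro _ ⟨x, rfl⟩; exact ⟨_, rfl⟩)
    (by rintro _ ⟨x, rfl⟩; exact ⟨_, (hc x).symm⟩) n (fun k => σ (b k)) (fun k => ⟨_, rfl⟩) (by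
      rw [linearIndependent_subfield_iff]
      intro g hg hs k
      choose y hy using hg
      simp only [← hy, RingHom.comp_apply, hc, ← map_mul, ← map_sum] at hs ⊢
      rw [sigma_eq_zero_iff] at hs ⊢
      rw [Fintype.linearIndependent_iff.1 hb y (by simpa [Algebra.smul_def] using hs) k, map_zero])
  rw [linearIndependent_subfield_iff] at h'
  rw [Fintype.linearIndependent_iff]
  intro g hs k
  refine (algebraMap A A₂).injective ?_
  rw [map_zero]
  exact h' (fun k => algebraMap A A₂ (g k)) (fun k => ⟨_, rfl⟩)
    (by simpa [Algebra.smul_def] using hs) k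

theorem exists_sigma_tensorProduct (h₂ : IsTransformallySeparable A A₂) :
    ∃ s : A₁ ⊗[A] A₂ →+* A₁ ⊗[A] A₂, (∀ a b, s (a ⊗ₜ b) = σ a ⊗ₜ σ b) ∧
      Function.Injective s := by
  obtain ⟨s, hs⟩ := exists_ringHom_tensorProduct (A := A) (A₁ := A₁) (A₂ := A₂)
    ((Algebra.TensorProduct.includeLeft : A₁ →ₐ[A] A₁ ⊗[A] A₂).toRingHom.comp σ)
    ((Algebra.TensorProduct.includeRight : A₂ →ₐ[A] A₁ ⊗[A] A₂).toRingHom.comp σ) fun c => by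
      rw [RingHom.comp_apply, RingHom.comp_apply, ← isDifferenceHom_algebraMap A A₁ c,
        ← isDifferenceHom_algebraMap A A₂ c]
      exact Algebra.TensorProduct.tmul_one_eq_one_tmul _
  refine ⟨s, fun a b => by simp [hs], injective_ringHom_tensorProduct hs fun n a b hb h k => ?_⟩
  have := eq_zero_of_sum_tmul_eq_zero (h₂.linearIndependent_sigma hb)
    (a := fun k => σ (a k)) (by simpa using h) k
  exact sigma_eq_zero_iff.1 this

/-- Applying σ on both factors embeds the tensor product over A in the one over `P = tw ⊤`. Since A
is separably closed, the perfect field P is algebraically closed in A₂, so the target is a domain.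
-/
theorem isDomain_tensorProduct_of_isSepClosed {A A₁ A₂ : Type u} [Field A] [Field A₁] [Field A₂]
    [Algebra A A₁] [Algebra A A₂] [DifferenceField A] [DifferenceField A₁] [DifferenceField A₂]
    [IsDifferenceExtension A A₁] [IsDifferenceExtension A A₂] (hA : IsModel A) [IsSepClosed A]
    (h₂ : IsTransformallySeparable A A₂) : IsDomain (A₁ ⊗[A] A₂) := by
  have hA' : TwistClosed (⊤ : Subfield A) := (isModel_iff_top.1 hA).1
  have : PerfectField (tw (⊤ : Subfield A)) := hA'.perfectField
  have hP : algClosure ((tw (⊤ : Subfield A)).map (algebraMap A A₂)) ≤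
      (tw (⊤ : Subfield A)).map (algebraMap A A₂) := by
    refine algClosure_map_tw_le _ hA' ?_
    rw [← fieldRange_id, ← fieldRange_comp, ← fieldRange_comp]
    exact sepClosure_fieldRange_le _
  have : IsDomain (A₁ ⊗[tw (⊤ : Subfield A)] A₂) := by
    refine isDomain_tensorProduct _ _ _ fun x hx => ?_
    obtain ⟨q, hq, hqx⟩ := hx
    have h1 := hP (mem_algClosure_iff_polynomial.2
      ⟨q.map (algebraMap (tw (⊤ : Subfield A)) A₂), by
        rwa [Polynomial.map_ne_zero_iff (algebraMap (tw (⊤ : Subfield A)) A₂).injective],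
        fun n => by
          rw [Polynomial.coeff_map]
          exact Subfield.mem_map.2 ⟨_, (q.coeff n).2, rfl⟩,
        by rwa [Polynomial.eval_map_algebraMap]⟩)
    obtain ⟨y, hy, rfl⟩ := Subfield.mem_map.1 h1
    exact ⟨⟨y, hy⟩, rfl⟩
  let P := tw (⊤ : Subfield A)
  obtain ⟨w, hw⟩ := exists_ringHom_tensorProduct (A := A) (A₁ := A₁) (A₂ := A₂)
    ((Algebra.TensorProduct.includeLeft : A₁ →ₐ[P] A₁ ⊗[P] A₂).toRingHom.comp σ)
    ((Algebra.TensorProduct.includeRight : A₂ →ₐ[P] A₁ ⊗[P] A₂).toRingHom.comp σ) fun c => by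
      rw [RingHom.comp_apply, RingHom.comp_apply, ← isDifferenceHom_algebraMap A A₁ c,
        ← isDifferenceHom_algebraMap A A₂ c]
      exact Algebra.TensorProduct.tmul_one_eq_one_tmul
        (⟨σ c, map_le_tw _ ⟨c, trivial, rfl⟩⟩ : P)
  refine Function.Injective.isDomain w
    (injective_ringHom_tensorProduct hw fun n a b hb h k => ?_)
  have := eq_zero_of_sum_tmul_eq_zero (A := P)
    ((h₂.linearIndependent_sigma hb).restrict_scalars
      (by
        intro x y e
        simpa [Algebra.smul_def] using e))
    (a := fun k => σ (a k)) (by simpa using h) k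
  exact sigma_eq_zero_iff.1 this

/-- The endomorphism σ ⊗ σ is injective by transformal separability of A₂, so it extends to the
fraction field of the tensor product. -/
theorem exists_isLinearlyFreeCompositum {A A₁ A₂ : Type u} [Field A] [Field A₁] [Field A₂]
    [Algebra A A₁] [Algebra A A₂] [DifferenceField A] [DifferenceField A₁] [DifferenceField A₂]
    [IsDifferenceExtension A A₁] [IsDifferenceExtension A A₂] (hA : IsModel A) [IsSepClosed A]
    (h₂ : IsTransformallySeparable A A₂) :
    ∃ (B : Type u) (_ : Field B) (_ : DifferenceField B) (_ : Algebra A B)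
      (i₁ : A₁ →ₐ[A] B) (i₂ : A₂ →ₐ[A] B), IsLinearlyFreeCompositum i₁ i₂ := by
  have : IsDomain (A₁ ⊗[A] A₂) := isDomain_tensorProduct_of_isSepClosed hA h₂
  obtain ⟨s, hs, hsi⟩ := exists_sigma_tensorProduct (A₁ := A₁) h₂
  let B := FractionRing (A₁ ⊗[A] A₂)
  let c : A₁ ⊗[A] A₂ →ₐ[A] B := IsScalarTower.toAlgHom A (A₁ ⊗[A] A₂) B
  have hc : Function.Injective c := IsFractionRing.injective (A₁ ⊗[A] A₂) B
  have hcs : Function.Injective ((c : A₁ ⊗[A] A₂ →+* B).comp s) := hc.comp hsi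
  let _ : DifferenceField B := ⟨IsFractionRing.lift hcs⟩
  have hσ (r : A₁ ⊗[A] A₂) : σ (c r) = c (s r) := IsFractionRing.lift_algebraMap hcs r
  let i₁ : A₁ →ₐ[A] B := c.comp Algebra.TensorProduct.includeLeft
  let i₂ : A₂ →ₐ[A] B := c.comp Algebra.TensorProduct.includeRight
  have hi (a : A₁) (b : A₂) : c (a ⊗ₜ b) = i₁ a * i₂ b := by
    simp only [i₁, i₂, AlgHom.comp_apply, ← map_mul, Algebra.TensorProduct.includeLeft_apply,
      Algebra.TensorProduct.includeRight_apply, Algebra.TensorProduct.tmul_mul_tmul, mul_one,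
      one_mul]
  refine ⟨B, inferInstance, inferInstance, inferInstance, i₁, i₂, ⟨?_, ?_, ?_, ?_⟩⟩
  · intro x
    change c (σ x ⊗ₜ 1) = σ (c (x ⊗ₜ 1))
    rw [hσ, hs, map_one]
  · intro x
    change c (1 ⊗ₜ σ x) = σ (c (1 ⊗ₜ x))
    rw [hσ, hs, map_one]
  · intro S _ h1 h2
    have hS (r : A₁ ⊗[A] A₂) : c r ∈ S := by
      induction r using TensorProduct.induction_on with
      | zero => rw [map_zero]; exact zero_mem S
      | tmul a b => rw [hi]; exact mul_mem (h1 a) (h2 b)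
      | add x y hx hy => rw [map_add]; exact add_mem hx hy
    rw [eq_top_iff]
    intro x _
    obtain ⟨y, z, -, rfl⟩ := IsFractionRing.div_surjective (A := A₁ ⊗[A] A₂) x
    exact div_mem (hS y) (hS z)
  · rw [linearlyDisjoint_iff_sum]
    intro n a b ha hb hli hsum k
    choose α hα using ha
    choose β hβ using hb
    obtain rfl : (fun k => i₁ (α k)) = a := funext hα
    obtain rfl : (fun k => i₂ (β k)) = b := funext hβ
    have hα' : LinearIndependent A α := by
      rw [linearIndependent_subfield_iff] at hli
      rw [Fintype.linearIndependent_iff]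
      intro g hg l
      refine (algebraMap A B).injective ?_
      rw [map_zero]
      refine hli (fun l => algebraMap A B (g l)) (fun l => ⟨_, rfl⟩) ?_ l
      simpa [Algebra.smul_def] using congrArg i₁ hg
    have h0 : ∑ k, α k ⊗ₜ[A] β k = 0 := by
      refine hc ?_
      rw [map_sum, map_zero, ← hsum]
      exact Finset.sum_congr rfl fun k _ => (hi _ _).trans (mul_comm _ _)
    change i₂ (β k) = 0
    rw [eq_zero_of_sum_tmul_eq_zero_left hα' h0 k, map_zero]

end TensorProduct

end FE

end

open FE in
theorem mainTheorem5 :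
    -- (1) existence and uniqueness of the relative transformal separable algebraic closure
    (∀ (F E : Type u) [Field F] [DifferenceField F] [Field E] [DifferenceField E] [Algebra F E]
        [IsDifferenceExtension F E], IsModel F → IsModel E →
      ∃! M : IntermediateDifferenceField F E, IsRelativeClosure M) ∧
    -- (2) the simple roots form a model of FE, which is the relative closure
    (∀ (F E : Type u) [Field F] [DifferenceField F] [Field E] [DifferenceField E] [Algebra F E]
        [IsDifferenceExtension F E], IsModel F → IsModel E →
      ∃ M : IntermediateDifferenceField F E,
        (M.toIntermediateField : Set E) = {a | ∃ f : TwistedPolynomial F, IsSimpleRoot f a} ∧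
        IsModel M.toIntermediateField ∧ IsRelativeClosure M) ∧
    -- (3) transitivity over the relative closure
    (∀ (F E : Type u) [Field F] [DifferenceField F] [Field E] [DifferenceField E] [Algebra F E]
        [IsDifferenceExtension F E], IsModel F → IsModel E →
      ∀ M : IntermediateDifferenceField F E, IsRelativeClosure M →
        (IsTransformallySeparable M.toIntermediateField E ↔ IsTransformallySeparable F E)) ∧
    -- (4) the inversive hull induces an equivalence of categories
    (∀ (F : Type u) [Field F] [DifferenceField F], IsModel F →
      (∃ (F' : Type u) (_ : Field F') (_ : DifferenceField F') (i : F →+* F'),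
        IsInversiveHull i) ∧
      ∀ (F' : Type u) [Field F'] [DifferenceField F'] (i : F →+* F'), IsInversiveHull i →
        ∃ (Φ : (separablyAlgebraicModels F).FullSubcategory ≌
              (perfectInversiveAlgebraic F').FullSubcategory)
          (η : ∀ X : (separablyAlgebraicModels F).FullSubcategory,
            X.obj.carrier →+* (Φ.functor.obj X).obj.carrier),
          (∀ X, IsInversiveHull (η X)) ∧
          (∀ X (c : F), η X (algebraMap F X.obj.carrier c) =
            algebraMap F' (Φ.functor.obj X).obj.carrier (i c)) ∧
          ∀ (X Y : (separablyAlgebraicModels F).FullSubcategory) (f : X ⟶ Y) (x : X.obj.carrier),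
            (Φ.functor.map f).hom.1 (η X x) = η Y (f.hom.1 x)) ∧
    -- (5) transformal separable generation
    (∀ (F E : Type u) [Field F] [DifferenceField F] [Field E] [DifferenceField E] [Algebra F E]
        [IsDifferenceExtension F E], IsModel F → IsModel E →
      IsTransformallySeparable F E → IsFinitelyGeneratedModel F E →
        ∃ (n : ℕ) (x : Fin n → E), IsTransformalTranscendenceBasis F x ∧
          IsTransformallySeparablyAlgebraic
            (twistedAdjoin F (Set.range x)).toIntermediateField E) ∧
    -- (6) amalgamation and closure under tensor products
    (∀ (A A₁ A₂ : Type u) [Field A] [DifferenceField A] [Field A₁] [DifferenceField A₁]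
        [Field A₂] [DifferenceField A₂] [Algebra A A₁] [IsDifferenceExtension A A₁]
        [Algebra A A₂] [IsDifferenceExtension A A₂], IsModel A → IsSepClosed A →
      IsModel A₁ → IsModel A₂ → IsTransformallySeparable A A₁ → IsTransformallySeparable A A₂ →
        (∃ (B : Type u) (_ : Field B) (_ : DifferenceField B) (_ : Algebra A B)
          (i₁ : A₁ →ₐ[A] B) (i₂ : A₂ →ₐ[A] B), IsLinearlyFreeCompositum i₁ i₂) ∧
        ∀ (B : Type u) [Field B] [DifferenceField B] [Algebra A B]
          (i₁ : A₁ →ₐ[A] B) (i₂ : A₂ →ₐ[A] B), IsLinearlyFreeCompositum i₁ i₂ → IsModel B) := by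
  refine ⟨?_, ?_, ?_, ?_, ?_, ?_⟩
  · intro F E _ _ _ _ _ _ hF hE
    obtain ⟨M, -, -, hM⟩ := exists_isRelativeClosure hF hE
    exact ⟨M, hM, fun N hN => hN.unique hM⟩
  · intro F E _ _ _ _ _ _ hF hE
    exact exists_isRelativeClosure hF hE
  · intro F E _ _ _ _ _ _ hF hE M hM
    exact hM.transformallySeparable_iff hF hE
  · intro F _ _ hF
    exact ⟨exists_isInversiveHull F, fun F' _ _ i hi => exists_equivalence_of_isInversiveHull hF hi⟩
  · intro F E _ _ _ _ _ _ hF hE h hfg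
    exact exists_isTransformalTranscendenceBasis hF hE h hfg
  · intro A A₁ A₂ _ _ _ _ _ _ _ _ _ _ hA hsc h₁ h₂ hs₁ hs₂
    exact ⟨exists_isLinearlyFreeCompositum hA hs₂,
      fun B _ _ _ i₁ i₂ h => h.isModel hA h₁ h₂ hs₁ hs₂⟩
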